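/- Let $k\in\{4,5,\dots\}\cup\{\infty\}$ and let $f(x,\mu)$ be a real function of class $C^k$ on an open neighbourhood $W$ of $(0,0)$ in $\mathbb R^2$ with a generic saddle-node at the origin, with signs normalised: at $x=\mu=0$, $$f=0,\quad f_x=0,\quad f_\mu>0,\quad f_{xx}<0.$$ Put $p_0=\sqrt{-\tfrac12 f_\mu f_{xx}}$ and $a_0=\dfrac{2f_{xxx}}{3f_{xx}^2}$ (Takens' coefficient), with all derivatives evaluated at $x=\mu=0$, and let $g_{\nu,a}(y)=\nu-y^2+ay^3$. For open intervals $I,J$, the equations $\dot x=F(x)$ on $I$ and $\dot y=G(y)$ on $J$ are called $C^r$-conjugate if there is a $C^r$ diffeomorphism $h:I\to J$ with $G(h(x))=h'(x)F(x)$ for all $x\in I$. The basin of attraction in $I$ of a stationary point is the set of points of $I$ whose forward solution stays in $I$ for all $t\ge 0$ and converges to that stationary point; the basin of repulsion is the same for reversed time. Then for every $A\in\mathbb R$ there exist open intervals $U,V$ containing $0$ and $\mu_0>0$, with $U\times(-\mu_0,\mu_0)\subseteq W$, such that the following hold. (i) For every $a\in\mathbb R$ there is a continuous function $\nu:(-\mu_0,0)\to\mathbb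 R$ such that, for every $\mu\in(-\mu_0,0)$, $\dot x=f(x,\mu)$ on $U$ is $C^k$-conjugate to $\dot y=g_{\nu(\mu),a}(y)$ on $V$. If $|a|\le A$, then moreover $\nu$ can be chosen with $\nu(\mu)\to0$ as $\mu\to0^-$. (ii) If $f$ is $C^\infty$ on $W$, then $\dot x=f(x,0)$ on $U$ is $C^\infty$-conjugate to $\dot y=g_{0,a_0}(y)$ on $V$. (iii) There are continuous functions $\nu,a:(0,\mu_0)\to\mathbb R$ with $$\nu(\mu)=p_0^2\mu+O(\mu^{3/2}),\qquad a(\mu)=a_0+O(\sqrt\mu)\qquad(\mu\to0^+)$$ such that for every $\mu\in(0,\mu_0)$, writing $g=g_{\nu(\mu),a(\mu)}$: the function $f(\cdot,\mu)$ has exactly two zeros $x_1<x_2$ in $U$, $g$ has exactly two zeros $y_1<y_2$ in $V$, and $$f_x(x_1,\mu)=g'(y_1)>0,\qquad f_x(x_2,\mu)=g'(y_2)<0;$$ the equation $\dot x=f(x,\mu)$ on the basin of repulsion of $x_1$ in $U$ is $C^k$-conjugate to $\dot y=g(y)$ on the basin of repulsion of $y_1$ in $V$; and $\dot x=f(x,\mu)$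 on the basin of attraction of $x_2$ in $U$ is $C^k$-conjugate to $\dot y=g(y)$ on the basin of attraction of $y_2$ in $V$. -/

import Mathlib

open Set Filter Topology Asymptotics
open scoped ContDiff

namespace SaddleNode

/-- The sign-normalised conditions for a generic saddle-node bifurcation of `x' = f x μ` at
`x = μ = 0`: `f = f_x = 0`, `f_μ > 0` and `f_xx < 0` at the origin. -/
structure IsGeneric (f : ℝ → ℝ → ℝ) : Prop where
  f_zero : f 0 0 = 0
  f_x : deriv (fun x => f x 0) 0 = 0
  f_mu : 0 < deriv (fun μ => f 0 μ) 0
  f_xx : iteratedDeriv 2 (fun x => f x 0) 0 < 0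

/-- The extended normal form `y' = ν - y ^ 2 + a * y ^ 3`. -/
def normalForm (ν a : ℝ) (y : ℝ) : ℝ := ν - y ^ 2 + a * y ^ 3

/-- The constant `p₀ = √(-f_μ f_xx / 2)`, with derivatives evaluated at the origin. -/
noncomputable def p₀ (f : ℝ → ℝ → ℝ) : ℝ :=
  √(-(1 / 2) * deriv (fun μ => f 0 μ) 0 * iteratedDeriv 2 (fun x => f x 0) 0)

/-- Takens' coefficient `a₀ = 2 f_xxx / (3 f_xx ^ 2)`, with derivatives evaluated at the origin. -/
noncomputable def a₀ (f : ℝ → ℝ → ℝ) : ℝ :=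
  2 * iteratedDeriv 3 (fun x => f x 0) 0 / (3 * iteratedDeriv 2 (fun x => f x 0) 0 ^ 2)

/-- The differential equations `x' = F x` on the open interval `U` and `y' = G y` on the open
interval `V` are `C^r`-conjugate: there is a `C^r` diffeomorphism `h : U → V` (with inverse `j`)
such that `G (h x) = h' x * F x` for all `x ∈ U`. -/
def Conjugate (r : WithTop ℕ∞) (F : ℝ → ℝ) (U : Set ℝ) (G : ℝ → ℝ) (V : Set ℝ) : Prop :=
  IsOpen U ∧ U.OrdConnected ∧ IsOpen V ∧ V.OrdConnected ∧
  ∃ h j : ℝ → ℝ, MapsTo h U V ∧ MapsTo j V U ∧ InvOn j h U V ∧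
    ContDiffOn ℝ r h U ∧ ContDiffOn ℝ r j V ∧
    ∀ x ∈ U, G (h x) = deriv h x * F x

/-- The basin of attraction of `p` for `x' = F x` on `U`: the initial points of forward solutions
that stay in `U` for all time `t ≥ 0` and converge to `p`. -/
def basinOfAttraction (F : ℝ → ℝ) (U : Set ℝ) (p : ℝ) : Set ℝ :=
  {x | ∃ γ : ℝ → ℝ, γ 0 = x ∧
    (∀ t ∈ Ici (0 : ℝ), γ t ∈ U ∧ HasDerivWithinAt γ (F (γ t)) (Ici 0) t) ∧
    Tendsto γ atTop (𝓝 p)}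

/-- The basin of repulsion of `p`: the basin of attraction under reversed time. -/
def basinOfRepulsion (F : ℝ → ℝ) (U : Set ℝ) (p : ℝ) : Set ℝ :=
  basinOfAttraction (fun x => -F x) U p

end SaddleNode

/-!
A vector field on an interval has few invariants, and each part of the theorem compares them.

*Before the bifurcation* both fields are negative on the whole interval. Measuring time conjugates
such a field to the constant field `-1` on an interval whose length is the transit time
(`conjugate_const`), so two of them are conjugate as soon as their transit times agree. In the
family `ν - y ^ 2 + a * y ^ 3` with `a` fixed, the transit time is a continuous increasing bijection
from the `ν` without zeros on the closed interval onto `(0, ∞)`; it diverges at the upper end because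
the field degenerates there at most linearly at some point (`exists_inverse_transitTime`). Hence `ν`
is a continuous function of the transit time of `f · μ`.

*At the bifurcation* the primitives of `1 / f` and of `1 / (-y ^ 2 + a * y ^ 3)` both have the form
`c / x - a * log |x| + smooth` exactly when `a` is Takens' coefficient. Equating them and putting
`y = x * w` gives an equation for `w` that is smooth at `x = 0`, and the implicit function theorem
solves it (`exists_conjugate_takens`). The interval `V` is the image of `U` under this conjugacy.

*After the bifurcation* a field is conjugate, on the basin of a hyperbolic zero, to its
linearisation, without loss of derivatives (`TwoZeros.conjugate_linear`). The basin ends on one side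
at the other zero, at which time is infinite, and on the other side at an end point of the interval;
rescaling the linear coordinate brings that end point to `-1`. So equality of the two eigenvalues is
all that is needed. The normal form with prescribed eigenvalues is explicit (`paramNu`, `paramA`),
and the asymptotics of its parameters follow from those of the eigenvalues. With `x` of weight `1`
and `μ` of weight `2`, and with `f = b μ - α x² + β x³ + γ x μ` up to weight `4`, the eigenvalues
`l₁ > 0 > l₂` satisfy `l₁ - l₂ = 4 √(α b μ) + O(μ)` and
`l₁ + l₂ = β / (4 α²) (l₁ - l₂)² + O(μ ^ (3 / 2))` (`LocalExpansion.isBigO_eigenvalues`).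
-/

namespace SaddleNode

/-! ### Division by a zero of the vector field -/

theorem segment_mem_Ioo {p q c x t : ℝ} (hc : c ∈ Ioo p q) (hx : x ∈ Ioo p q)
    (ht : t ∈ Icc (0 : ℝ) 1) : c + t * (x - c) ∈ Ioo p q := by
  have h := (convex_Ioo p q) hc hx (sub_nonneg.2 ht.2) ht.1 (by ring)
  have e : c + t * (x - c) = (1 - t) • c + t • x := by simp only [smul_eq_mul]; ring
  rw [e]; exact h

theorem continuousOn_segment {p q c x : ℝ} {G : ℝ → ℝ} (m : ℕ) (hc : c ∈ Ioo p q)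
    (hx : x ∈ Ioo p q) (hG : ContinuousOn G (Ioo p q)) :
    ContinuousOn (fun t : ℝ => t ^ m * G (c + t * (x - c))) (Icc 0 1) := by
  refine (by fun_prop : ContinuousOn (fun t : ℝ => t ^ m) _).mul ?_
  exact hG.comp (by fun_prop) fun t ht => segment_mem_Ioo hc hx ht

theorem continuousOn_weightedMean {p q c : ℝ} {G : ℝ → ℝ} (m : ℕ) (hc : c ∈ Ioo p q)
    (hG : ContinuousOn G (Ioo p q)) :
    ContinuousOn (fun x => ∫ t in (0 : ℝ)..1, t ^ m * G (c + t * (x - c))) (Ioo p q) := by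
  rw [continuousOn_iff_continuous_domRestrict]
  let P : ℝ → ℝ := fun t => (projIcc (0 : ℝ) 1 zero_le_one t : ℝ)
  have hPc : Continuous P := continuous_subtype_val.comp continuous_projIcc
  have key : Continuous fun x : Ioo p q =>
      ∫ t in (0 : ℝ)..1, P t ^ m * G (c + P t * ((x : ℝ) - c)) := by
    apply intervalIntegral.continuous_parametric_intervalIntegral_of_continuous'
    refine ((hPc.comp continuous_snd).pow m).mul ?_
    refine hG.comp_continuous (by fun_prop) fun z => ?_
    exact segment_mem_Ioo hc z.1.2 (projIcc (0 : ℝ) 1 zero_le_one z.2).2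
  refine key.congr fun x => intervalIntegral.integral_congr fun t ht => ?_
  rw [uIcc_of_le zero_le_one] at ht
  simp only [P, projIcc_of_mem zero_le_one ht]

theorem hasDerivAt_weightedMean {p q c x₀ : ℝ} {G : ℝ → ℝ} (m : ℕ) (hc : c ∈ Ioo p q)
    (hx₀ : x₀ ∈ Ioo p q) (hd : DifferentiableOn ℝ G (Ioo p q))
    (hG' : ContinuousOn (deriv G) (Ioo p q)) :
    HasDerivAt (fun x => ∫ t in (0 : ℝ)..1, t ^ m * G (c + t * (x - c)))
      (∫ t in (0 : ℝ)..1, t ^ (m + 1) * deriv G (c + t * (x₀ - c))) x₀ := by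
  obtain ⟨p₁, hp₁, hp₁'⟩ := exists_between (lt_min hc.1 hx₀.1)
  obtain ⟨q₁, hq₁, hq₁'⟩ := exists_between (max_lt hc.2 hx₀.2)
  rw [lt_min_iff] at hp₁'
  rw [max_lt_iff] at hq₁
  have hsub : Icc p₁ q₁ ⊆ Ioo p q := fun z hz => ⟨hp₁.trans_le hz.1, hz.2.trans_lt hq₁'⟩
  obtain ⟨C, hC⟩ := isCompact_Icc.exists_bound_of_continuousOn (hG'.mono hsub)
  have hint : ∀ H : ℝ → ℝ, ContinuousOn H (Ioo p q) → ∀ (j : ℕ) (x : ℝ), x ∈ Ioo p q →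
      IntervalIntegrable (fun t : ℝ => t ^ j * H (c + t * (x - c))) MeasureTheory.volume 0 1 := by
    intro H hH j x hx
    apply ContinuousOn.intervalIntegrable
    rw [uIcc_of_le zero_le_one]
    exact continuousOn_segment j hc hx hH
  have hs : Ioo p₁ q₁ ∈ 𝓝 x₀ := Ioo_mem_nhds hp₁'.2 hq₁.2
  refine (intervalIntegral.hasDerivAt_integral_of_dominated_loc_of_deriv_le
    (F := fun x t => t ^ m * G (c + t * (x - c)))
    (F' := fun x t => t ^ (m + 1) * deriv G (c + t * (x - c)))
    (bound := fun _ => C) hs ?_ (hint G hd.continuousOn m x₀ hx₀) ?_ ?_ (by simp) ?_).2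
  · filter_upwards [Ioo_mem_nhds hx₀.1 hx₀.2] with x hx
    exact (intervalIntegrable_iff.1 (hint G hd.continuousOn m x hx)).aestronglyMeasurable
  · exact (intervalIntegrable_iff.1 (hint _ hG' (m + 1) x₀ hx₀)).aestronglyMeasurable
  · refine Eventually.of_forall fun t ht x hx => ?_
    rw [uIoc_of_le zero_le_one] at ht
    have hmem := segment_mem_Ioo (⟨hp₁'.1, hq₁.1⟩ : c ∈ Ioo p₁ q₁) hx ⟨ht.1.le, ht.2⟩
    have h1 := hC _ (Ioo_subset_Icc_self hmem)
    rw [norm_mul]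
    have h2 : ‖t ^ (m + 1)‖ ≤ 1 := by
      rw [Real.norm_of_nonneg (pow_nonneg ht.1.le _)]
      exact pow_le_one₀ ht.1.le ht.2
    calc _ ≤ 1 * C := mul_le_mul h2 h1 (norm_nonneg _) zero_le_one
      _ = C := one_mul C
  · refine Eventually.of_forall fun t ht x hx => ?_
    rw [uIoc_of_le zero_le_one] at ht
    have hmem := segment_mem_Ioo (⟨hp₁'.1, hq₁.1⟩ : c ∈ Ioo p₁ q₁) hx ⟨ht.1.le, ht.2⟩
    have hmem' := hsub (Ioo_subset_Icc_self hmem)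
    have h1 : HasDerivAt G (deriv G (c + t * (x - c))) (c + t * (x - c)) :=
      (hd.differentiableAt (isOpen_Ioo.mem_nhds hmem')).hasDerivAt
    have h2 : HasDerivAt (fun x : ℝ => c + t * (x - c)) t x := by
      simpa using (((hasDerivAt_id x).sub_const c).const_mul t).const_add c
    have h3 := (h1.comp x h2).const_mul (t ^ m)
    exact h3.congr_deriv (by ring)

/-- The weighted means `x ↦ ∫₀¹ t ^ m * G (c + t * (x - c))` are as smooth as `G`. -/
theorem contDiffOn_weightedMean {p q c : ℝ} (hc : c ∈ Ioo p q) (n : ℕ) :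
    ∀ (m : ℕ) (G : ℝ → ℝ), ContDiffOn ℝ n G (Ioo p q) →
      ContDiffOn ℝ n (fun x => ∫ t in (0 : ℝ)..1, t ^ m * G (c + t * (x - c))) (Ioo p q) := by
  induction n with
  | zero =>
    intro m G hG
    simp only [Nat.cast_zero, contDiffOn_zero] at hG ⊢
    exact continuousOn_weightedMean m hc hG
  | succ n ih =>
    intro m G hG
    push_cast at hG ⊢
    rw [contDiffOn_succ_iff_deriv_of_isOpen isOpen_Ioo] at hG ⊢
    have hder := fun x hx => hasDerivAt_weightedMean (x₀ := x) m hc hx hG.1 hG.2.2.continuousOn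
    refine ⟨fun x hx => (hder x hx).differentiableAt.differentiableWithinAt, by simp, ?_⟩
    exact (ih (m + 1) _ hG.2.2).congr fun x hx => (hder x hx).deriv

theorem dslope_eq_integral {p q c x : ℝ} {F : ℝ → ℝ} (hc : c ∈ Ioo p q) (hx : x ∈ Ioo p q)
    (hF : ContDiffOn ℝ 1 F (Ioo p q)) :
    dslope F c x = ∫ t in (0 : ℝ)..1, t ^ 0 * deriv F (c + t * (x - c)) := by
  have hF' : ContinuousOn (deriv F) (Ioo p q) := hF.continuousOn_deriv_of_isOpen isOpen_Ioo le_rfl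
  rcases eq_or_ne x c with rfl | hne
  · simp
  · rw [dslope_of_ne _ hne, slope_def_field, div_eq_iff (sub_ne_zero.2 hne), mul_comm,
      ← intervalIntegral.integral_const_mul]
    have := intervalIntegral.integral_eq_sub_of_hasDerivAt (a := 0) (b := 1)
      (f := fun t : ℝ => F (c + t * (x - c)))
      (f' := fun t => (x - c) * (t ^ 0 * deriv F (c + t * (x - c)))) ?_ ?_
    · rw [this]; simp
    · intro t ht
      rw [uIcc_of_le zero_le_one] at ht
      have h1 : HasDerivAt F (deriv F (c + t * (x - c))) (c + t * (x - c)) :=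
        ((hF.differentiableOn one_ne_zero).differentiableAt
          (isOpen_Ioo.mem_nhds (segment_mem_Ioo hc hx ht))).hasDerivAt
      have h2 : HasDerivAt (fun t : ℝ => c + t * (x - c)) (x - c) t := by
        simpa using ((hasDerivAt_id t).mul_const (x - c)).const_add c
      have h3 := h1.comp t h2
      exact h3.congr_deriv (by ring)
    · apply ContinuousOn.intervalIntegrable
      rw [uIcc_of_le zero_le_one]
      exact (continuousOn_segment 0 hc hx hF').const_smul (x - c)

/-- **Hadamard's lemma**: dividing by `x - c` costs one derivative. -/
theorem contDiffOn_dslope {p q c : ℝ} {F : ℝ → ℝ} (hc : c ∈ Ioo p q) (n : ℕ)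
    (hF : ContDiffOn ℝ (n + 1) F (Ioo p q)) : ContDiffOn ℝ n (dslope F c) (Ioo p q) := by
  have h1 : ContDiffOn ℝ 1 F (Ioo p q) := hF.of_le (by
    exact_mod_cast Nat.le_add_left 1 n)
  exact (contDiffOn_weightedMean hc n 0 _
    ((contDiffOn_succ_iff_deriv_of_isOpen isOpen_Ioo).1 hF).2.2).congr
    fun x hx => dslope_eq_integral hc hx h1

theorem eq_add_mul_dslope (F : ℝ → ℝ) (c x : ℝ) : F x = F c + (x - c) * dslope F c x := by
  have := sub_smul_dslope F c x
  simp only [smul_eq_mul] at this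
  linarith

/-! ### Conjugacy of vector fields on intervals -/

theorem Conjugate.deriv_mul_deriv {r : WithTop ℕ∞} (hr : 1 ≤ r) {U V : Set ℝ} (hU : IsOpen U)
    (hV : IsOpen V) {h j : ℝ → ℝ} (hh : MapsTo h U V)
    (hinv : InvOn j h U V) (hch : ContDiffOn ℝ r h U) (hcj : ContDiffOn ℝ r j V) {x : ℝ}
    (hx : x ∈ U) : deriv j (h x) * deriv h x = 1 := by
  have hr' : r ≠ 0 := (zero_lt_one.trans_le hr).ne'
  have h1 := ((hch.differentiableOn hr').differentiableAt (hU.mem_nhds hx)).hasDerivAt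
  have h2 := ((hcj.differentiableOn hr').differentiableAt (hV.mem_nhds (hh hx))).hasDerivAt
  have h3 : HasDerivAt (j ∘ h) 1 x := by
    refine (hasDerivAt_id x).congr_of_eventuallyEq ?_
    filter_upwards [hU.mem_nhds hx] with y hy using hinv.1 hy
  exact (h2.comp x h1).unique h3

theorem Conjugate.symm {r : WithTop ℕ∞} (hr : 1 ≤ r) {F G : ℝ → ℝ} {U V : Set ℝ}
    (H : Conjugate r F U G V) : Conjugate r G V F U := by
  obtain ⟨hU, hU', hV, hV', h, j, hh, hj, hinv, hch, hcj, hc⟩ := H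
  refine ⟨hV, hV', hU, hU', j, h, hj, hh, hinv.symm, hcj, hch, fun y hy => ?_⟩
  have h1 := hc (j y) (hj hy)
  have h2 := Conjugate.deriv_mul_deriv hr hU hV hh hinv hch hcj (hj hy)
  rw [hinv.2 hy] at h1 h2
  rw [h1, ← mul_assoc, h2, one_mul]

theorem Conjugate.trans {r : WithTop ℕ∞} (hr : 1 ≤ r) {F G K : ℝ → ℝ} {U V Z : Set ℝ}
    (H : Conjugate r F U G V) (H' : Conjugate r G V K Z) : Conjugate r F U K Z := by
  have hr' : r ≠ 0 := (zero_lt_one.trans_le hr).ne'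
  obtain ⟨hU, hU', hV, hV', h, j, hh, hj, hinv, hch, hcj, hc⟩ := H
  obtain ⟨-, -, hZ, hZ', h', j', hh', hj', hinv', hch', hcj', hc'⟩ := H'
  refine ⟨hU, hU', hZ, hZ', h' ∘ h, j ∘ j', hh'.comp hh, hj.comp hj', ⟨fun x hx => ?_,
    fun z hz => ?_⟩, hch'.comp hch hh, hcj.comp hcj' hj', fun x hx => ?_⟩
  · simp [hinv'.1 (hh hx), hinv.1 hx]
  · simp [hinv.2 (hj' hz), hinv'.2 hz]
  · have h1 := (hch.differentiableOn hr').differentiableAt (hU.mem_nhds hx)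
    have h2 := (hch'.differentiableOn hr').differentiableAt (hV.mem_nhds (hh hx))
    rw [deriv_comp x h2 h1, Function.comp_apply, hc' _ (hh hx), hc x hx, mul_assoc]

/-- Conjugacies are carried along by the reflection `x ↦ -x`. -/
theorem Conjugate.of_neg {r : WithTop ℕ∞} {F G : ℝ → ℝ} {U V U' V' : Set ℝ}
    (hU' : ∀ x, x ∈ U' ↔ -x ∈ U) (hV' : ∀ x, x ∈ V' ↔ -x ∈ V)
    (H : Conjugate r (fun x => F (-x)) U (fun x => G (-x)) V) : Conjugate r F U' G V' := by
  have eU : U' = (fun x : ℝ => -x) ⁻¹' U := Set.ext hU'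
  have eV : V' = (fun x : ℝ => -x) ⁻¹' V := Set.ext hV'
  obtain ⟨hU, hUo, hV, hVo, h, j, hh, hj, hinv, hch, hcj, hc⟩ := H
  refine ⟨eU ▸ hU.preimage continuous_neg, ?_, eV ▸ hV.preimage continuous_neg, ?_,
    fun x => -h (-x), fun y => -j (-y), fun x hx => ?_, fun y hy => ?_, ⟨fun x hx => ?_,
    fun y hy => ?_⟩, ?_, ?_, fun x hx => ?_⟩
  · exact eU ▸ hUo.preimage_anti fun a b hab => neg_le_neg hab
  · exact eV ▸ hVo.preimage_anti fun a b hab => neg_le_neg hab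
  · rw [hV', neg_neg]; exact hh ((hU' x).1 hx)
  · rw [hU', neg_neg]; exact hj ((hV' y).1 hy)
  · simp [hinv.1 ((hU' x).1 hx)]
  · simp [hinv.2 ((hV' y).1 hy)]
  · exact (hch.comp contDiff_neg.contDiffOn fun x hx => (hU' x).1 hx).neg
  · exact (hcj.comp contDiff_neg.contDiffOn fun x hx => (hV' x).1 hx).neg
  · have h1 := hc (-x) ((hU' x).1 hx)
    have h2 : deriv (fun x => -h (-x)) x = deriv h (-x) := by
      rw [deriv.fun_neg, deriv_comp_neg, neg_neg]
    rw [h2]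
    simpa using h1

/-- A map with positive derivative that intertwines two vector fields conjugates the first on an
interval to the second on the image. -/
theorem conjugate_image {k : ℕ∞} (hk : 1 ≤ k) {F G h : ℝ → ℝ} {p q : ℝ}
    (hch : ContDiffOn ℝ k h (Ioo p q)) (hpos : ∀ x ∈ Ioo p q, 0 < deriv h x)
    (hc : ∀ x ∈ Ioo p q, G (h x) = deriv h x * F x) :
    Conjugate k F (Ioo p q) G (h '' Ioo p q) := by
  have hk1 : (1 : WithTop ℕ∞) ≤ (k : WithTop ℕ∞) := by exact_mod_cast hk
  have hk' : (k : WithTop ℕ∞) ≠ 0 := (zero_lt_one.trans_le hk1).ne'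
  have hmono : StrictMonoOn h (Ioo p q) := by
    refine strictMonoOn_of_deriv_pos (convex_Ioo p q) hch.continuousOn ?_
    rwa [interior_Ioo]
  have hstrict : ∀ x ∈ Ioo p q, HasStrictDerivAt h (deriv h x) x := fun x hx =>
    (hch.contDiffAt (isOpen_Ioo.mem_nhds hx)).hasStrictDerivAt hk'
  have hleft : LeftInvOn (Function.invFunOn h (Ioo p q)) h (Ioo p q) :=
    hmono.injOn.leftInvOn_invFunOn
  have hright : RightInvOn (Function.invFunOn h (Ioo p q)) h (h '' Ioo p q) :=
    fun y hy => Function.invFunOn_eq hy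
  refine ⟨isOpen_Ioo, ordConnected_Ioo, ?_, ?_, h, Function.invFunOn h (Ioo p q),
    mapsTo_image _ _, fun y hy => Function.invFunOn_mem hy, ⟨hleft, hright⟩, hch, ?_, hc⟩
  · rw [isOpen_iff_mem_nhds]
    rintro _ ⟨x, hx, rfl⟩
    rw [← (hstrict x hx).map_nhds_eq (hpos x hx).ne']
    exact image_mem_map (isOpen_Ioo.mem_nhds hx)
  · exact (isPreconnected_Ioo.image h hch.continuousOn).ordConnected
  · rintro _ ⟨x, hx, rfl⟩
    have hca := hch.contDiffAt (isOpen_Ioo.mem_nhds hx)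
    have hfd := (hstrict x hx).hasDerivAt.hasFDerivAt_equiv (hpos x hx).ne'
    have hinv := hca.to_localInverse hfd hk'
    refine (hinv.congr_of_eventuallyEq ?_).contDiffWithinAt
    have hs := hca.hasStrictFDerivAt' hfd hk'
    have hcont := hs.localInverse_continuousAt
    have hself : hs.localInverse h _ x (h x) = x := hs.localInverse_apply_image
    have hmem : ∀ᶠ y in 𝓝 (h x), hs.localInverse h _ x y ∈ Ioo p q :=
      hcont.eventually (by rw [hself]; exact isOpen_Ioo.mem_nhds hx)
    filter_upwards [hmem, hs.eventually_right_inverse] with y hy hy'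
    have h2 : Function.invFunOn h (Ioo p q) (h (hs.localInverse h _ x y)) = _ := hleft hy
    rw [hy'] at h2
    exact h2

/-! ### Linearisation at a hyperbolic zero -/

/-- The phase portrait after the bifurcation: on `(P, Q)` the field `F` is negative, positive and
negative to the left of, between and to the right of its two hyperbolic zeros `x₁ < x₂`. The smaller
interval `(p, q)`, with `P < p` and `q < Q`, is the phase space; the margin makes `F` regular at its
end points. -/
structure TwoZeros (F : ℝ → ℝ) (P p x₁ x₂ q Q : ℝ) : Prop where
  lt_p : P < p
  p_lt : p < x₁
  lt : x₁ < x₂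
  lt_q : x₂ < q
  q_lt : q < Q
  neg_left : ∀ x ∈ Ioo P x₁, F x < 0
  pos_mid : ∀ x ∈ Ioo x₁ x₂, 0 < F x
  neg_right : ∀ x ∈ Ioo x₂ Q, F x < 0
  zero_left : F x₁ = 0
  zero_right : F x₂ = 0
  deriv_left : 0 < deriv F x₁
  deriv_right : deriv F x₂ < 0

theorem TwoZeros.reflect {F : ℝ → ℝ} {P p x₁ x₂ q Q : ℝ} (H : TwoZeros F P p x₁ x₂ q Q) :
    TwoZeros (fun x => F (-x)) (-Q) (-q) (-x₂) (-x₁) (-p) (-P) where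
  lt_p := neg_lt_neg H.q_lt
  p_lt := neg_lt_neg H.lt_q
  lt := neg_lt_neg H.lt
  lt_q := neg_lt_neg H.p_lt
  q_lt := neg_lt_neg H.lt_p
  neg_left x hx := H.neg_right _ ⟨by linarith [hx.2], by linarith [hx.1]⟩
  pos_mid x hx := H.pos_mid _ ⟨by linarith [hx.2], by linarith [hx.1]⟩
  neg_right x hx := H.neg_left _ ⟨by linarith [hx.2], by linarith [hx.1]⟩
  zero_left := by simp [H.zero_right]
  zero_right := by simp [H.zero_left]
  deriv_left := by rw [deriv_comp_neg, neg_neg]; linarith [H.deriv_right]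
  deriv_right := by rw [deriv_comp_neg, neg_neg]; linarith [H.deriv_left]

theorem TwoZeros.setOf_zero {F : ℝ → ℝ} {P p x₁ x₂ q Q : ℝ} (H : TwoZeros F P p x₁ x₂ q Q) :
    {x ∈ Ioo p q | F x = 0} = {x₁, x₂} := by
  ext x
  simp only [mem_ofPred_eq, mem_insert_iff, mem_singleton_iff]
  constructor
  · rintro ⟨hx, h0⟩
    rcases lt_trichotomy x x₁ with h | h | h
    · exact absurd h0 (H.neg_left x ⟨H.lt_p.trans hx.1, h⟩).ne
    · exact Or.inl h
    · rcases lt_trichotomy x x₂ with h' | h' | h'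
      · exact absurd h0 (H.pos_mid x ⟨h, h'⟩).ne'
      · exact Or.inr h'
      · exact absurd h0 (H.neg_right x ⟨h', hx.2.trans H.q_lt⟩).ne
  · rintro (rfl | rfl)
    · exact ⟨⟨H.p_lt, H.lt.trans H.lt_q⟩, H.zero_left⟩
    · exact ⟨⟨H.p_lt.trans H.lt, H.lt_q⟩, H.zero_right⟩

theorem hasDerivAt_primitive {a b c x : ℝ} {f : ℝ → ℝ} (hf : ContinuousOn f (Ioo a b))
    (hc : c ∈ Ioo a b) (hx : x ∈ Ioo a b) : HasDerivAt (fun y => ∫ s in c..y, f s) (f x) x := by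
  refine intervalIntegral.integral_hasDerivAt_right ?_ ?_ ?_
  · exact (hf.mono (ordConnected_Ioo.uIcc_subset hc hx)).intervalIntegrable
  · exact hf.stronglyMeasurableAtFilter isOpen_Ioo x hx
  · exact hf.continuousAt (isOpen_Ioo.mem_nhds hx)

/-- Logarithmic divergence of transit times: a derivative at least `K / (q - x)` forces `h → ∞`. -/
theorem tendsto_atTop_of_le_deriv {c q K : ℝ} {h h' : ℝ → ℝ} (hcq : c < q) (hK : 0 < K)
    (hd : ∀ x ∈ Ico c q, HasDerivAt h (h' x) x) (hb : ∀ x ∈ Ico c q, K / (q - x) ≤ h' x) :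
    Tendsto h (𝓝[<] q) atTop := by
  have hu : ∀ x ∈ Ico c q,
      HasDerivAt (fun x => h x + K * Real.log (q - x)) (h' x - K / (q - x)) x := by
    intro x hx
    have h1 : HasDerivAt (fun x : ℝ => q - x) (-1) x := by
      simpa using (hasDerivAt_id x).const_sub q
    have h2 := (h1.log (sub_pos.2 hx.2).ne').const_mul K
    exact ((hd x hx).add h2).congr_deriv (by ring)
  have hmono : MonotoneOn (fun x => h x + K * Real.log (q - x)) (Ico c q) := by
    refine monotoneOn_of_deriv_nonneg (convex_Ico c q)
      (fun x hx => (hu x hx).continuousAt.continuousWithinAt) ?_ ?_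
    · intro x hx
      rw [interior_Ico] at hx
      exact (hu x (Ioo_subset_Ico_self hx)).differentiableAt.differentiableWithinAt
    · intro x hx
      rw [interior_Ico] at hx
      rw [(hu x (Ioo_subset_Ico_self hx)).deriv]
      exact sub_nonneg.2 (hb x (Ioo_subset_Ico_self hx))
  have hlog : Tendsto (fun x => Real.log (q - x)) (𝓝[<] q) atBot := by
    refine Real.tendsto_log_nhdsGT_zero.comp ?_
    refine tendsto_nhdsWithin_iff.2 ⟨?_, ?_⟩
    · have : Tendsto (fun x : ℝ => q - x) (𝓝 q) (𝓝 (q - q)) :=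
        (continuous_const.sub continuous_id).tendsto q
      rw [sub_self] at this
      exact this.mono_left nhdsWithin_le_nhds
    · filter_upwards [self_mem_nhdsWithin] with x hx using mem_Ioi.2 (sub_pos.2 (mem_Iio.1 hx))
  have hlim : Tendsto (fun x => (h c + K * Real.log (q - c)) + (-K) * Real.log (q - x))
      (𝓝[<] q) atTop :=
    tendsto_atTop_add_const_left _ _ (hlog.const_mul_atBot_of_neg (neg_lt_zero.2 hK))
  refine tendsto_atTop_mono' _ ?_ hlim
  filter_upwards [Ioo_mem_nhdsLT hcq] with x hx
  have := hmono (left_mem_Ico.2 hcq) (Ioo_subset_Ico_self hx) hx.1.le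
  simp only at this
  linarith

/-- **Linearisation.** Up to the second zero, a vector field is conjugate to its linear part at the
repelling zero `x₁`, without loss of derivatives. With `F x = (x - x₁) * φ x` and
`φ x = λ + (x - x₁) * ψ x`, the conjugacy is `h x = (x - x₁) * exp (∫ -ψ / φ)`; the relation
`h' * F = λ * h` regains the derivatives lost in the two divisions. -/
theorem TwoZeros.conjugate_linear {k : ℕ∞} (hk : 2 ≤ k) {F : ℝ → ℝ} {P p x₁ x₂ q Q : ℝ}
    (H : TwoZeros F P p x₁ x₂ q Q) (hF : ContDiffOn ℝ k F (Ioo P Q)) :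
    Conjugate k F (Ioo p x₂) (fun y => deriv F x₁ * y) (Ioi (-1)) := by
  obtain ⟨hPp, hpx, hx12, hxq, hqQ, hneg, hpos, -, hz₁, hz₂, hd₁, -⟩ := H
  set l := deriv F x₁ with hl
  have hx₁ : x₁ ∈ Ioo P Q := ⟨by linarith, by linarith⟩
  have hx₂ : x₂ ∈ Ioo P Q := ⟨by linarith, by linarith⟩
  have hJ : Ioo P x₂ ⊆ Ioo P Q := Ioo_subset_Ioo_right (by linarith)
  have hx₁J : x₁ ∈ Ioo P x₂ := ⟨hx₁.1, hx12⟩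
  let φ := dslope F x₁
  let ψ := dslope φ x₁
  have hFφ : ∀ x, F x = (x - x₁) * φ x := fun x => by
    rw [eq_add_mul_dslope F x₁ x, hz₁, zero_add]
  have hφψ : ∀ x, φ x = l + (x - x₁) * ψ x := fun x => by
    rw [eq_add_mul_dslope φ x₁ x]; simp [φ, hl, ψ]
  have hreg : ∀ m : ℕ, ((m + 2 : ℕ) : ℕ∞) ≤ k →
      ContDiffOn ℝ (m + 1) φ (Ioo P Q) ∧ ContDiffOn ℝ m ψ (Ioo P Q) := by
    intro m hm
    have h1 : ContDiffOn ℝ (((m + 1 : ℕ) : WithTop ℕ∞) + 1) F (Ioo P Q) :=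
      hF.of_le (by exact_mod_cast hm)
    have h2 := contDiffOn_dslope hx₁ (m + 1) h1
    push_cast at h2
    exact ⟨h2, contDiffOn_dslope hx₁ m h2⟩
  have hφpos : ∀ x ∈ Ioo P x₂, 0 < φ x := by
    intro x hx
    rcases lt_trichotomy x x₁ with h | h | h
    · have h1 := hneg x ⟨hx.1, h⟩
      rw [hFφ] at h1
      by_contra h2
      exact absurd h1 (not_lt.2 (mul_nonneg_of_nonpos_of_nonpos (by linarith) (not_lt.1 h2)))
    · rw [h]; simpa [φ] using hd₁
    · have h1 := hpos x ⟨h, hx.2⟩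
      rw [hFφ] at h1
      exact (pos_iff_pos_of_mul_pos h1).1 (by linarith)
  have hφc : ContinuousOn φ (Ioo P Q) := (hreg 0 (by simpa using hk)).1.continuousOn
  have hψc : ContinuousOn ψ (Ioo P Q) := (hreg 0 (by simpa using hk)).2.continuousOn
  let E : ℝ → ℝ := fun x => ∫ s in x₁..x, -ψ s / φ s
  have hE : ∀ x ∈ Ioo P x₂, HasDerivAt E (-ψ x / φ x) x := fun x hx =>
    hasDerivAt_primitive (f := fun s => -ψ s / φ s)
      ((hψc.mono hJ).neg.div (hφc.mono hJ) fun s hs => (hφpos s hs).ne') hx₁J hx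
  let h₀ : ℝ → ℝ := fun x => (x - x₁) * Real.exp (E x)
  have hh₀ : ∀ x ∈ Ioo P x₂, HasDerivAt h₀ (l * Real.exp (E x) / φ x) x := by
    intro x hx
    have h1 := ((hasDerivAt_id x).sub_const x₁).mul (hE x hx).exp
    refine h1.congr_deriv ?_
    have h2 := (hφpos x hx).ne'
    simp only [id]
    rw [eq_div_iff h2]
    field_simp
    linear_combination hφψ x
  have hEreg : ∀ m : ℕ, ((m + 2 : ℕ) : ℕ∞) ≤ k → ContDiffOn ℝ (m + 1) E (Ioo P x₂) := by
    intro m hm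
    rw [contDiffOn_succ_iff_deriv_of_isOpen isOpen_Ioo]
    refine ⟨fun x hx => (hE x hx).differentiableAt.differentiableWithinAt, by simp, ?_⟩
    refine ContDiffOn.congr ?_ fun x hx => (hE x hx).deriv
    exact ((hreg m hm).2.mono hJ).neg.div (((hreg m hm).1.mono hJ).of_le
      (by exact_mod_cast Nat.le_succ m)) fun x hx => (hφpos x hx).ne'
  have hh₀reg : ContDiffOn ℝ k h₀ (Ioo P x₂) := by
    have main : ∀ m : ℕ, ((m + 2 : ℕ) : ℕ∞) ≤ k →
        ContDiffOn ℝ ((m + 2 : ℕ) : WithTop ℕ∞) h₀ (Ioo P x₂) := by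
      intro m hm
      have e : ((m + 2 : ℕ) : WithTop ℕ∞) = ((m : WithTop ℕ∞) + 1) + 1 := by
        push_cast; rw [add_assoc]; rfl
      rw [e, contDiffOn_succ_iff_deriv_of_isOpen isOpen_Ioo]
      refine ⟨fun x hx => (hh₀ x hx).differentiableAt.differentiableWithinAt, ?_, ?_⟩
      · intro h; exact absurd h (by exact_mod_cast WithTop.coe_ne_top)
      · refine ContDiffOn.congr ?_ fun x hx => (hh₀ x hx).deriv
        exact (contDiffOn_const.mul (hEreg m hm).exp).div ((hreg m hm).1.mono hJ)
          fun x hx => (hφpos x hx).ne'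
    rw [contDiffOn_iff_forall_nat_le]
    intro m hm
    rcases Nat.lt_or_ge m 2 with h2 | h2
    · exact (main 0 (by simpa using hk)).of_le (by exact_mod_cast h2.le)
    · obtain ⟨n, rfl⟩ := Nat.exists_eq_add_of_le' h2
      exact main n (by exact_mod_cast hm)
  have hh₀pos : ∀ x ∈ Ioo P x₂, 0 < l * Real.exp (E x) / φ x := fun x hx =>
    div_pos (mul_pos hd₁ (Real.exp_pos _)) (hφpos x hx)
  have hmono : StrictMonoOn h₀ (Ioo P x₂) := by
    refine strictMonoOn_of_deriv_pos (convex_Ioo _ _) hh₀reg.continuousOn fun x hx => ?_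
    rw [interior_Ioo] at hx
    rw [(hh₀ x hx).deriv]
    exact hh₀pos x hx
  have hpJ : p ∈ Ioo P x₂ := ⟨hPp, hpx.trans hx12⟩
  have hhp : h₀ p < 0 := mul_neg_of_neg_of_pos (by linarith) (Real.exp_pos _)
  have htop : Tendsto h₀ (𝓝[<] x₂) atTop := by
    obtain ⟨c, hc₁, hc₂⟩ := exists_between hx12
    have hcJ : c ∈ Ioo P x₂ := ⟨hx₁.1.trans hc₁, hc₂⟩
    have hcsub : Icc c x₂ ⊆ Ioo P Q := fun z hz => ⟨hcJ.1.trans_le hz.1, hz.2.trans_lt hx₂.2⟩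
    have hχ : ContinuousOn (dslope F x₂) (Icc c x₂) := by
      refine (contDiffOn_dslope hx₂ 0 (hF.of_le ?_)).continuousOn.mono hcsub
      simpa using (show (1 : WithTop ℕ∞) ≤ k by exact_mod_cast one_le_two.trans hk)
    obtain ⟨C, hC⟩ := isCompact_Icc.exists_bound_of_continuousOn hχ
    have hC0 : 0 < |C| + 1 := by positivity
    have hhc : 0 < h₀ c := mul_pos (by linarith) (Real.exp_pos _)
    refine tendsto_atTop_of_le_deriv (K := l * h₀ c / (|C| + 1)) hc₂ (by positivity)
      (fun x hx => hh₀ x ⟨hcJ.1.trans_le hx.1, hx.2⟩) fun x hx => ?_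
    have hxJ : x ∈ Ioo P x₂ := ⟨hcJ.1.trans_le hx.1, hx.2⟩
    have h1 : F x ≤ (|C| + 1) * (x₂ - x) := by
      rw [eq_add_mul_dslope F x₂ x, hz₂, zero_add]
      have := (abs_le.1 (hC x (Ico_subset_Icc_self hx))).1
      have h3 := le_abs_self C
      nlinarith [hx.2]
    have h2 : 0 < F x := hpos x ⟨hc₁.trans_le hx.1, hx.2⟩
    have h3 : h₀ c ≤ h₀ x := hmono.monotoneOn hcJ hxJ hx.1
    have h4 : l * Real.exp (E x) / φ x = l * h₀ x / F x := by
      rw [hFφ x, div_eq_div_iff (hφpos x hxJ).ne' (by rw [← hFφ x]; exact h2.ne')]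
      simp only [h₀]; ring
    rw [h4, div_div, div_le_div_iff₀ (mul_pos hC0 (sub_pos.2 hx.2)) h2]
    exact mul_le_mul (mul_le_mul_of_nonneg_left h3 hd₁.le) h1 h2.le
      (mul_nonneg hd₁.le (hhc.le.trans h3))
  have hJp : Ioo p x₂ ⊆ Ioo P x₂ := Ioo_subset_Ioo_left hPp.le
  have himage : (fun x => h₀ x / (-h₀ p)) '' Ioo p x₂ = Ioi (-1) := by
    apply Subset.antisymm
    · rintro _ ⟨x, hx, rfl⟩
      rw [mem_Ioi, lt_div_iff₀ (by linarith)]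
      have := hmono hpJ (hJp hx) hx.1
      linarith
    · have hne₁ : (𝓝[Ioo p x₂] p).NeBot := left_nhdsWithin_Ioo_neBot (hpx.trans hx12)
      have hne₂ : (𝓝[Ioo p x₂] x₂).NeBot := right_nhdsWithin_Ioo_neBot (hpx.trans hx12)
      have hcont : ContinuousOn (fun x => h₀ x / (-h₀ p)) (Ioo P x₂) :=
        hh₀reg.continuousOn.div_const _
      refine isPreconnected_Ioo.intermediate_value_Ioi (l₁ := 𝓝[Ioo p x₂] p)
        (l₂ := 𝓝[Ioo p x₂] x₂) inf_le_right inf_le_right (hcont.mono hJp) ?_ ?_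
      · have h1 := (hcont.continuousAt (isOpen_Ioo.mem_nhds hpJ)).tendsto
        have h2 : h₀ p / (-h₀ p) = -1 := by rw [div_neg, div_self hhp.ne]
        simp only [h2] at h1
        exact h1.mono_left nhdsWithin_le_nhds
      · exact (htop.mono_left (nhdsWithin_mono _ fun x hx => hx.2)).atTop_div_const (by linarith)
  have hder : ∀ x ∈ Ioo p x₂,
      HasDerivAt (fun x => h₀ x / (-h₀ p)) (l * Real.exp (E x) / φ x / (-h₀ p)) x :=
    fun x hx => (hh₀ x (hJp hx)).div_const _
  rw [← himage]
  refine conjugate_image (one_le_two.trans hk) ((hh₀reg.mono hJp).div_const _) ?_ ?_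
  · intro x hx
    rw [(hder x hx).deriv]
    exact div_pos (hh₀pos x (hJp hx)) (by linarith)
  · intro x hx
    rw [(hder x hx).deriv, hFφ x]
    have := (hφpos x (hJp hx)).ne'
    simp only [h₀]
    field_simp

/-! ### Basins -/

theorem TwoZeros.basinOfRepulsion_eq {k : ℕ∞} (hk : 2 ≤ k) {F : ℝ → ℝ} {P p x₁ x₂ q Q : ℝ}
    (H : TwoZeros F P p x₁ x₂ q Q) (hF : ContDiffOn ℝ k F (Ioo P Q)) :
    basinOfRepulsion F (Ioo p q) x₁ = Ioo p x₂ := by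
  have hk1 : (1 : WithTop ℕ∞) ≤ (k : WithTop ℕ∞) := by exact_mod_cast one_le_two.trans hk
  have hk0 : (k : WithTop ℕ∞) ≠ 0 := (zero_lt_one.trans_le hk1).ne'
  apply Subset.antisymm
  · rintro x ⟨γ, rfl, hγ, hlim⟩
    refine ⟨(hγ 0 self_mem_Ici).1.1, ?_⟩
    by_contra! hx
    have hcont : ContinuousOn γ (Ici 0) := fun t ht => (hγ t ht).2.continuousWithinAt
    obtain ⟨T, hT, hT0⟩ := ((hlim.eventually (gt_mem_nhds H.lt)).and (eventually_ge_atTop 0)).exists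
    obtain ⟨t, ht, hγt⟩ : x₂ ∈ γ '' Icc 0 T :=
      intermediate_value_Icc' hT0 (hcont.mono Icc_subset_Ici_self) ⟨hT.le, hx⟩
    have hsub : Icc p q ⊆ Ioo P Q := fun z hz => ⟨H.lt_p.trans_le hz.1, hz.2.trans_lt H.q_lt⟩
    obtain ⟨K, hK⟩ := (hF.mono hsub).neg.exists_lipschitzOnWith hk0 (convex_Icc p q) isCompact_Icc
    -- By uniqueness the solution stays at `x₂` once it is there.
    have hstay : ∀ b, t ≤ b → γ b = x₂ := by
      intro b hb
      have := ODE_solution_unique_of_mem_Icc_right (v := fun _ x => -F x) (s := fun _ => Icc p q)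
        (f := γ) (g := fun _ => x₂) (K := K) (a := t) (b := b) (fun _ _ => hK)
        (hcont.mono fun s hs => ht.1.trans hs.1)
        (fun s hs => (hγ s (ht.1.trans hs.1)).2.mono (Ici_subset_Ici.2 (ht.1.trans hs.1)))
        (fun s hs => Ioo_subset_Icc_self (hγ s (ht.1.trans hs.1)).1)
        continuousOn_const
        (fun s hs => by simpa [H.zero_right] using hasDerivWithinAt_const s (Ici s) x₂)
        (fun s hs => ⟨(H.p_lt.trans H.lt).le, H.lt_q.le⟩) hγt
      exact this (right_mem_Icc.2 hb)
    have h2 : Tendsto γ atTop (𝓝 x₂) := tendsto_const_nhds.congr' (by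
      filter_upwards [eventually_ge_atTop t] with b hb using (hstay b hb).symm)
    exact H.lt.ne (tendsto_nhds_unique hlim h2)
  · intro x hx
    have hl := H.deriv_left
    have hconj := H.conjugate_linear hk hF
    obtain ⟨-, -, -, -, j, h, hj, hh, hinv, hcj, -, hc⟩ := hconj.symm hk1
    have hy : ∀ t : ℝ, 0 ≤ t → h x * Real.exp (-(deriv F x₁ * t)) ∈ Ioi (-1 : ℝ) := by
      intro t ht
      have h1 : -1 < h x := hh hx
      have h2 : Real.exp (-(deriv F x₁ * t)) ≤ 1 := Real.exp_le_one_iff.2 (by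
        have := mul_nonneg hl.le ht; linarith)
      have h3 := Real.exp_pos (-(deriv F x₁ * t))
      rw [mem_Ioi]
      nlinarith
    have hdj : ∀ y ∈ Ioi (-1 : ℝ), HasDerivAt j (deriv j y) y := fun y hy =>
      ((hcj.differentiableOn hk0).differentiableAt (isOpen_Ioi.mem_nhds hy)).hasDerivAt
    have h0 : (0 : ℝ) ∈ Ioi (-1 : ℝ) := by simp
    have hj0 : j 0 = x₁ := by
      have h1 := hc 0 h0
      simp only [mul_zero] at h1
      have h2 := hj h0
      have h3 : j 0 ∈ {x ∈ Ioo p q | F x = 0} := ⟨⟨h2.1, h2.2.trans H.lt_q⟩, h1⟩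
      rw [H.setOf_zero] at h3
      exact h3.resolve_right h2.2.ne
    refine ⟨fun t => j (h x * Real.exp (-(deriv F x₁ * t))), ?_, fun t ht => ⟨?_, ?_⟩, ?_⟩
    · simp [hinv.2 hx]
    · have := hj (hy t ht)
      exact ⟨this.1, this.2.trans H.lt_q⟩
    · have h1 : HasDerivAt (fun t => h x * Real.exp (-(deriv F x₁ * t)))
          (h x * (Real.exp (-(deriv F x₁ * t)) * -(deriv F x₁ * 1))) t :=
        (((hasDerivAt_id t).const_mul (deriv F x₁)).neg.exp).const_mul (h x)
      have h2 := (hdj _ (hy t ht)).comp t h1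
      refine (h2.congr_deriv ?_).hasDerivWithinAt
      simp only
      rw [hc _ (hy t ht)]
      ring
    · have h1 : Tendsto (fun t => h x * Real.exp (-(deriv F x₁ * t))) atTop (𝓝 (h x * 0)) := by
        refine Tendsto.const_mul _ (Real.tendsto_exp_atBot.comp ?_)
        exact tendsto_neg_atTop_atBot.comp (tendsto_id.const_mul_atTop hl)
      rw [mul_zero] at h1
      have h2 := (hdj 0 h0).continuousAt.tendsto
      rw [hj0] at h2
      exact h2.comp h1

theorem neg_mem_basinOfAttraction {F : ℝ → ℝ} {U U' : Set ℝ} {p x : ℝ}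
    (hU : ∀ x ∈ U, -x ∈ U') (hx : x ∈ basinOfAttraction F U p) :
    -x ∈ basinOfAttraction (fun x => -F (-x)) U' (-p) := by
  obtain ⟨γ, rfl, hγ, hlim⟩ := hx
  refine ⟨fun t => -γ t, rfl, fun t ht => ⟨hU _ (hγ t ht).1, ?_⟩, hlim.neg⟩
  simpa using (hγ t ht).2.fun_neg

theorem mem_basinOfAttraction_iff_neg {F : ℝ → ℝ} {p q x₂ x : ℝ} :
    x ∈ basinOfAttraction F (Ioo p q) x₂ ↔
      -x ∈ basinOfRepulsion (fun x => F (-x)) (Ioo (-q) (-p)) (-x₂) := by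
  constructor
  · exact neg_mem_basinOfAttraction fun x hx => ⟨neg_lt_neg hx.2, neg_lt_neg hx.1⟩
  · intro hx
    have := neg_mem_basinOfAttraction (U' := Ioo p q)
      (fun x hx => ⟨by linarith [hx.2], by linarith [hx.1]⟩) hx
    simpa using this

theorem TwoZeros.conjugate_basinOfRepulsion {k : ℕ∞} (hk : 2 ≤ k) {F G : ℝ → ℝ}
    {P p x₁ x₂ q Q P' p' y₁ y₂ q' Q' : ℝ}
    (H : TwoZeros F P p x₁ x₂ q Q) (hF : ContDiffOn ℝ k F (Ioo P Q))
    (H' : TwoZeros G P' p' y₁ y₂ q' Q') (hG : ContDiffOn ℝ k G (Ioo P' Q'))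
    (heq : deriv F x₁ = deriv G y₁) :
    Conjugate k F (basinOfRepulsion F (Ioo p q) x₁) G (basinOfRepulsion G (Ioo p' q') y₁) := by
  have hk1 : (1 : WithTop ℕ∞) ≤ (k : WithTop ℕ∞) := by exact_mod_cast one_le_two.trans hk
  rw [H.basinOfRepulsion_eq hk hF, H'.basinOfRepulsion_eq hk hG]
  have h1 := H.conjugate_linear hk hF
  rw [heq] at h1
  exact h1.trans hk1 ((H'.conjugate_linear hk hG).symm hk1)

theorem TwoZeros.conjugate_basinOfAttraction {k : ℕ∞} (hk : 2 ≤ k) {F G : ℝ → ℝ}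
    {P p x₁ x₂ q Q P' p' y₁ y₂ q' Q' : ℝ}
    (H : TwoZeros F P p x₁ x₂ q Q) (hF : ContDiffOn ℝ k F (Ioo P Q))
    (H' : TwoZeros G P' p' y₁ y₂ q' Q') (hG : ContDiffOn ℝ k G (Ioo P' Q'))
    (heq : deriv F x₂ = deriv G y₂) :
    Conjugate k F (basinOfAttraction F (Ioo p q) x₂) G (basinOfAttraction G (Ioo p' q') y₂) := by
  have hreg : ∀ {K : ℝ → ℝ} {a b : ℝ}, ContDiffOn ℝ k K (Ioo a b) →
      ContDiffOn ℝ k (fun x => K (-x)) (Ioo (-b) (-a)) := fun hK =>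
    hK.comp contDiff_neg.contDiffOn fun x hx => ⟨by linarith [hx.2], by linarith [hx.1]⟩
  refine Conjugate.of_neg (fun x => mem_basinOfAttraction_iff_neg)
    (fun x => mem_basinOfAttraction_iff_neg)
    (H.reflect.conjugate_basinOfRepulsion hk (hreg hF) H'.reflect (hreg hG) ?_)
  rw [deriv_comp_neg, deriv_comp_neg, neg_neg, neg_neg, heq]

/-! ### Transit times of vector fields without zeros -/

/-- The time that `x' = F x`, with `F < 0`, takes to cross the interval `(p, q)`. -/
noncomputable def transitTime (F : ℝ → ℝ) (p q : ℝ) : ℝ := ∫ x in p..q, (-F x)⁻¹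

/-- The flow box theorem on an interval: measuring time conjugates a negative vector field to the
constant field `-1`. -/
theorem conjugate_const {k : ℕ∞} (hk : 1 ≤ k) {F : ℝ → ℝ} {p q : ℝ} (hpq : p < q)
    (hFc : ContinuousOn F (Icc p q)) (hF : ContDiffOn ℝ k F (Ioo p q))
    (hneg : ∀ x ∈ Icc p q, F x < 0) :
    Conjugate k F (Ioo p q) (fun _ => -1) (Ioo 0 (transitTime F p q)) := by
  have hcont : ContinuousOn (fun x => (-F x)⁻¹) (Icc p q) :=
    hFc.neg.inv₀ fun x hx => (neg_pos.2 (hneg x hx)).ne'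
  let h : ℝ → ℝ := fun x => transitTime F p x
  have hh : ∀ x ∈ Ioo p q, HasDerivAt h (-F x)⁻¹ x := by
    intro x hx
    refine intervalIntegral.integral_hasDerivAt_right ?_ ?_ ?_
    · apply ContinuousOn.intervalIntegrable
      rw [uIcc_of_le hx.1.le]
      exact hcont.mono (Icc_subset_Icc_right hx.2.le)
    · exact (hcont.mono Ioo_subset_Icc_self).stronglyMeasurableAtFilter isOpen_Ioo x hx
    · exact hcont.continuousAt (Icc_mem_nhds hx.1 hx.2)
  have hhc : ContinuousOn h (Icc p q) := by
    have := intervalIntegral.continuousOn_primitive_interval (a := p) (b := q)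
      (f := fun x => (-F x)⁻¹) (μ := MeasureTheory.volume)
      (by rw [uIcc_of_le hpq.le]; exact hcont.integrableOn_Icc)
    rwa [uIcc_of_le hpq.le] at this
  have hpos : ∀ x ∈ Ioo p q, 0 < deriv h x := fun x hx => by
    rw [(hh x hx).deriv]; exact inv_pos.2 (neg_pos.2 (hneg x (Ioo_subset_Icc_self hx)))
  have hmono : StrictMonoOn h (Icc p q) := by
    refine strictMonoOn_of_deriv_pos (convex_Icc p q) hhc ?_
    rwa [interior_Icc]
  have hp : h p = 0 := by simp [h, transitTime]
  have himage : h '' Ioo p q = Ioo 0 (transitTime F p q) := by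
    apply Subset.antisymm
    · rintro _ ⟨x, hx, rfl⟩
      exact ⟨hp ▸ hmono (left_mem_Icc.2 hpq.le) (Ioo_subset_Icc_self hx) hx.1,
        hmono (Ioo_subset_Icc_self hx) (right_mem_Icc.2 hpq.le) hx.2⟩
    · have := intermediate_value_Ioo hpq.le hhc
      rwa [hp] at this
  have hreg : ContDiffOn ℝ k h (Ioo p q) := by
    have h1 : ContDiffOn ℝ ((k : WithTop ℕ∞) + 1) h (Ioo p q) := by
      rw [contDiffOn_succ_iff_deriv_of_isOpen isOpen_Ioo]
      refine ⟨fun x hx => (hh x hx).differentiableAt.differentiableWithinAt, fun h => ?_, ?_⟩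
      · exact absurd h (by simp)
      · refine ContDiffOn.congr ?_ fun x hx => (hh x hx).deriv
        exact hF.neg.inv fun x hx => (neg_pos.2 (hneg x (Ioo_subset_Icc_self hx))).ne'
    exact h1.of_le le_self_add
  rw [← himage]
  refine conjugate_image hk hreg hpos fun x hx => ?_
  have := (hneg x (Ioo_subset_Icc_self hx)).ne
  rw [(hh x hx).deriv]
  field_simp

theorem conjugate_of_transitTime_eq {k : ℕ∞} (hk : 1 ≤ k) {F G : ℝ → ℝ} {p q p' q' : ℝ}
    (hpq : p < q) (hFc : ContinuousOn F (Icc p q)) (hF : ContDiffOn ℝ k F (Ioo p q))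
    (hFneg : ∀ x ∈ Icc p q, F x < 0)
    (hpq' : p' < q') (hGc : ContinuousOn G (Icc p' q')) (hG : ContDiffOn ℝ k G (Ioo p' q'))
    (hGneg : ∀ x ∈ Icc p' q', G x < 0) (heq : transitTime F p q = transitTime G p' q') :
    Conjugate k F (Ioo p q) G (Ioo p' q') := by
  have hk1 : (1 : WithTop ℕ∞) ≤ (k : WithTop ℕ∞) := by exact_mod_cast hk
  have h1 := conjugate_const hk hpq hFc hF hFneg
  rw [heq] at h1
  exact h1.trans hk1 ((conjugate_const hk hpq' hGc hG hGneg).symm hk1)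

theorem continuousOn_parametric_integral {X : Type*} [TopologicalSpace X] {S : Set X} {p q : ℝ}
    (hpq : p ≤ q) {Φ : X → ℝ → ℝ}
    (hΦ : ContinuousOn (fun z : X × ℝ => Φ z.1 z.2) (S ×ˢ Icc p q)) :
    ContinuousOn (fun s => ∫ y in p..q, Φ s y) S := by
  rw [continuousOn_iff_continuous_domRestrict]
  have key : Continuous fun s : S => ∫ y in p..q, Φ s (projIcc p q hpq y) := by
    apply intervalIntegral.continuous_parametric_intervalIntegral_of_continuous'
    refine hΦ.comp_continuous (f := fun z : S × ℝ => ((z.1 : X), (projIcc p q hpq z.2 : ℝ))) ?_ ?_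
    · exact (continuous_subtype_val.comp continuous_fst).prodMk
        (continuous_subtype_val.comp (continuous_projIcc.comp continuous_snd))
    · exact fun z => ⟨z.1.2, (projIcc p q hpq z.2).2⟩
  refine key.congr fun x => intervalIntegral.integral_congr fun t ht => ?_
  rw [uIcc_of_le hpq] at ht
  simp only [projIcc_of_mem hpq ht]

/-- The transit time tends to infinity as the speed degenerates at a point `y₀` of the closed
interval, interior or not, at most linearly. -/
theorem exists_le_integral_inv {p q y₀ C : ℝ} (hpq : p < q) (hy₀ : y₀ ∈ Icc p q) (hC : 0 < C)
    (M : ℝ) : ∃ ε > 0, ∀ φ : ℝ → ℝ, ContinuousOn φ (Icc p q) → (∀ y ∈ Icc p q, 0 < φ y) →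
      (∀ y ∈ Icc p q, φ y ≤ C * (|y - y₀| + ε)) → M ≤ ∫ y in p..q, (φ y)⁻¹ := by
  set L := (q - p) / 2 with hL
  have hLpos : 0 < L := by rw [hL]; linarith
  set ε := L * Real.exp (-(C * M)) with hε
  have hεpos : 0 < ε := by positivity
  have hlog : M ≤ ∫ x in ε..(L + ε), (C * x)⁻¹ := by
    simp only [mul_inv]
    rw [intervalIntegral.integral_const_mul, integral_inv_of_pos hεpos (by linarith),
      ← div_eq_inv_mul, le_div_iff₀ hC, Real.le_log_iff_exp_le (by positivity),
      le_div_iff₀ hεpos]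
    have : Real.exp (M * C) * Real.exp (-(C * M)) = 1 := by
      rw [← Real.exp_add]; simp [mul_comm]
    calc Real.exp (M * C) * ε = L * (Real.exp (M * C) * Real.exp (-(C * M))) := by rw [hε]; ring
      _ ≤ L + ε := by rw [this]; linarith
  refine ⟨ε, hεpos, fun φ hφc hφpos hφle => ?_⟩
  have hinv : ContinuousOn (fun y => (φ y)⁻¹) (Icc p q) := hφc.inv₀ fun y hy => (hφpos y hy).ne'
  have hsub : ∀ c d, p ≤ c → c ≤ d → d ≤ q →
      ∫ y in c..d, (C * (|y - y₀| + ε))⁻¹ ≤ ∫ y in p..q, (φ y)⁻¹ := by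
    intro c d hc hcd hd
    have hcdsub : Icc c d ⊆ Icc p q := Icc_subset_Icc hc hd
    have hi : ∀ a b, p ≤ a → a ≤ b → b ≤ q →
        IntervalIntegrable (fun y => (φ y)⁻¹) MeasureTheory.volume a b := by
      intro a b ha hab hb
      apply ContinuousOn.intervalIntegrable
      rw [uIcc_of_le hab]
      exact hinv.mono (Icc_subset_Icc ha hb)
    have hpos' : ∀ y, 0 < C * (|y - y₀| + ε) := fun y => by positivity
    calc ∫ y in c..d, (C * (|y - y₀| + ε))⁻¹ ≤ ∫ y in c..d, (φ y)⁻¹ := by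
          refine intervalIntegral.integral_mono_on hcd ?_ (hi c d hc hcd hd) fun y hy => ?_
          · apply Continuous.intervalIntegrable
            exact Continuous.inv₀ (by fun_prop) fun y => (hpos' y).ne'
          · exact inv_anti₀ (hφpos y (hcdsub hy)) (hφle y (hcdsub hy))
      _ ≤ ∫ y in p..q, (φ y)⁻¹ := by
          refine intervalIntegral.integral_mono_interval hc hcd hd ?_ (hi p q le_rfl hpq.le le_rfl)
          refine (MeasureTheory.ae_restrict_iff' measurableSet_Ioc).2 (Eventually.of_forall ?_)
          exact fun y hy => (inv_pos.2 (hφpos y (Ioc_subset_Icc_self hy))).le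
  rcases le_total (y₀ + L) q with h | h
  · refine le_trans (hlog.trans_eq ?_) (hsub y₀ (y₀ + L) hy₀.1 (by linarith) h)
    have h1 := intervalIntegral.integral_comp_sub_right (a := y₀) (b := y₀ + L)
      (fun x => (C * x)⁻¹) (y₀ - ε)
    rw [show y₀ - (y₀ - ε) = ε by ring, show y₀ + L - (y₀ - ε) = L + ε by ring] at h1
    rw [← h1]
    refine intervalIntegral.integral_congr fun y hy => ?_
    rw [uIcc_of_le (by linarith)] at hy
    simp only [abs_of_nonneg (sub_nonneg.2 hy.1)]
    ring_nf
  · have hp : p ≤ y₀ - L := by rw [hL] at h ⊢; linarith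
    refine le_trans (hlog.trans_eq ?_) (hsub (y₀ - L) y₀ hp (by linarith) hy₀.2)
    have h1 := intervalIntegral.integral_comp_sub_left (a := y₀ - L) (b := y₀)
      (fun x => (C * x)⁻¹) (y₀ + ε)
    rw [show y₀ + ε - y₀ = ε by ring, show y₀ + ε - (y₀ - L) = L + ε by ring] at h1
    rw [← h1]
    refine intervalIntegral.integral_congr fun y hy => ?_
    rw [uIcc_of_le (by linarith)] at hy
    simp only [abs_of_nonpos (sub_nonpos.2 hy.2)]
    ring_nf

/-- In the family `y' = ν - w y` on `(p, q)`, each positive transit time is that of some `ν`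
below the minimum of `w`; this `ν` depends continuously on that time, and tends to the minimum as the
time tends to infinity. -/
theorem exists_inverse_transitTime {p q y₀ C : ℝ} {w : ℝ → ℝ} (hpq : p < q) (hy₀ : y₀ ∈ Icc p q)
    (hw : ContinuousOn w (Icc p q)) (hmin : ∀ y ∈ Icc p q, w y₀ ≤ w y) (hC : 0 < C)
    (hlip : ∀ y ∈ Icc p q, w y - w y₀ ≤ C * |y - y₀|) :
    ∃ N : ℝ → ℝ, ContinuousOn N (Ioi 0) ∧ Tendsto N atTop (𝓝 (w y₀)) ∧
      ∀ τ ∈ Ioi (0 : ℝ), N τ < w y₀ ∧ transitTime (fun y => N τ - w y) p q = τ := by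
  set T : ℝ → ℝ := fun ν => transitTime (fun y => ν - w y) p q with hT
  have hTdef : ∀ ν, T ν = ∫ y in p..q, (w y - ν)⁻¹ := fun ν => by
    simp only [hT, transitTime, neg_sub]
  have hposw : ∀ ν < w y₀, ∀ y ∈ Icc p q, 0 < w y - ν := fun ν hν y hy => by
    linarith [hmin y hy]
  have hcw : ∀ ν < w y₀, ContinuousOn (fun y => (w y - ν)⁻¹) (Icc p q) := fun ν hν =>
    (hw.sub continuousOn_const).inv₀ fun y hy => (hposw ν hν y hy).ne'
  have hTc : ContinuousOn T (Iio (w y₀)) := by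
    have h1 : ContinuousOn (fun ν => ∫ y in p..q, (w y - ν)⁻¹) (Iio (w y₀)) := by
      refine continuousOn_parametric_integral hpq.le (Φ := fun ν y => (w y - ν)⁻¹) ?_
      refine ContinuousOn.inv₀ ?_ fun z hz => (hposw z.1 hz.1 z.2 hz.2).ne'
      exact (hw.comp continuousOn_snd fun z hz => hz.2).sub continuousOn_fst
    exact h1.congr fun ν _ => hTdef ν
  have hTm : StrictMonoOn T (Iio (w y₀)) := by
    intro ν hν ν' hν' hlt
    rw [hTdef, hTdef]
    refine intervalIntegral.integral_lt_integral_of_continuousOn_of_le_of_exists_lt hpq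
      (hcw ν hν) (hcw ν' hν') (fun y hy => ?_) ⟨p, left_mem_Icc.2 hpq.le, ?_⟩
    · exact inv_anti₀ (hposw ν' hν' y (Ioc_subset_Icc_self hy)) (by linarith)
    · exact inv_strictAnti₀ (hposw ν' hν' p (left_mem_Icc.2 hpq.le)) (by linarith)
  have hsurj : ∀ τ ∈ Ioi (0 : ℝ), ∃ ν < w y₀, T ν = τ := by
    intro τ hτ
    rw [mem_Ioi] at hτ
    obtain ⟨ε, hε, hεφ⟩ := exists_le_integral_inv hpq hy₀ hC τ
    have hhi : τ ≤ T (w y₀ - C * ε) := by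
      rw [hTdef]
      have hlt : w y₀ - C * ε < w y₀ := by linarith [mul_pos hC hε]
      refine hεφ (fun y => w y - (w y₀ - C * ε)) (hw.sub continuousOn_const) (hposw _ hlt)
        fun y hy => ?_
      linarith [hlip y hy]
    have hR : 0 < (q - p) / τ := div_pos (sub_pos.2 hpq) hτ
    have hlo : T (w y₀ - (q - p) / τ) ≤ τ := by
      have hlt : w y₀ - (q - p) / τ < w y₀ := by linarith
      have h1 : ∫ y in p..q, (w y - (w y₀ - (q - p) / τ))⁻¹ ≤ ∫ _ in p..q, ((q - p) / τ)⁻¹ := by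
        refine intervalIntegral.integral_mono_on hpq.le ?_ (by simp) fun y hy => ?_
        · apply ContinuousOn.intervalIntegrable
          rw [uIcc_of_le hpq.le]
          exact hcw _ hlt
        · exact inv_anti₀ hR (by linarith [hmin y hy])
      rw [hTdef]
      refine h1.trans_eq ?_
      have := (sub_pos.2 hpq).ne'
      rw [intervalIntegral.integral_const, smul_eq_mul]
      field_simp
    have hpre : IsPreconnected (Iio (w y₀)) := isPreconnected_Iio
    obtain ⟨ν, hν, h⟩ := hpre.intermediate_value (a := w y₀ - (q - p) / τ) (b := w y₀ - C * ε)
      (by rw [mem_Iio]; linarith) (by rw [mem_Iio]; linarith [mul_pos hC hε]) hTc ⟨hlo, hhi⟩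
    exact ⟨ν, hν, h⟩
  choose! N hN hTN using hsurj
  have hgt : ∀ τ ∈ Ioi (0 : ℝ), ∀ c < w y₀, T c < τ → c < N τ := fun τ hτ c hc h =>
    (hTm.lt_iff_lt hc (hN τ hτ)).1 (by rwa [hTN τ hτ])
  refine ⟨N, fun τ hτ => ?_, ?_, fun τ hτ => ⟨hN τ hτ, hTN τ hτ⟩⟩
  · refine (tendsto_order.2 ⟨fun c hc => ?_, fun c hc => ?_⟩ : ContinuousWithinAt N (Ioi 0) τ)
    · have hcm : c < w y₀ := hc.trans (hN τ hτ)
      have h1 : T c < τ := by rw [← hTN τ hτ]; exact hTm hcm (hN τ hτ) hc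
      filter_upwards [self_mem_nhdsWithin, nhdsWithin_le_nhds (lt_mem_nhds h1)] with σ hσ h
        using hgt σ hσ c hcm h
    · obtain ⟨d, hd, hd'⟩ := exists_between (lt_min hc (hN τ hτ))
      rw [lt_min_iff] at hd'
      have h1 : τ < T d := by rw [← hTN τ hτ]; exact hTm (hN τ hτ) hd'.2 hd
      filter_upwards [self_mem_nhdsWithin, nhdsWithin_le_nhds (gt_mem_nhds h1)] with σ hσ h
      refine lt_trans ((hTm.lt_iff_lt (hN σ hσ) hd'.2).1 ?_) hd'.1
      rwa [hTN σ hσ]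
  · refine tendsto_order.2 ⟨fun c hc => ?_, fun c hc => ?_⟩
    · filter_upwards [eventually_gt_atTop 0, eventually_gt_atTop (T c)] with σ hσ h
        using hgt σ hσ c hc h
    · filter_upwards [eventually_gt_atTop 0] with σ hσ using (hN σ hσ).trans hc

/-! ### The normal form at the bifurcation value -/

theorem contDiffOn_infty_dslope {p q c : ℝ} {F : ℝ → ℝ} (hc : c ∈ Ioo p q)
    (hF : ContDiffOn ℝ ∞ F (Ioo p q)) : ContDiffOn ℝ ∞ (dslope F c) (Ioo p q) :=
  contDiffOn_infty.2 fun n => contDiffOn_dslope hc n (hF.of_le (by exact_mod_cast le_top))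

theorem deriv_dslope {p q c x : ℝ} {F : ℝ → ℝ} (hc : c ∈ Ioo p q) (hx : x ∈ Ioo p q)
    (hF : ContDiffOn ℝ 2 F (Ioo p q)) :
    deriv (dslope F c) x = ∫ t in (0 : ℝ)..1, t ^ 1 * deriv (deriv F) (c + t * (x - c)) := by
  have hF1 : ContDiffOn ℝ 1 F (Ioo p q) := hF.of_le one_le_two
  have hF2 : ContDiffOn ℝ (1 + 1) F (Ioo p q) := by simpa [one_add_one_eq_two] using hF
  have hF' := ((contDiffOn_succ_iff_deriv_of_isOpen isOpen_Ioo).1 hF2).2.2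
  have h1 := hasDerivAt_weightedMean 0 hc hx (hF'.differentiableOn one_ne_zero)
    (hF'.continuousOn_deriv_of_isOpen isOpen_Ioo le_rfl)
  refine (h1.congr_of_eventuallyEq ?_).deriv
  filter_upwards [isOpen_Ioo.mem_nhds hx] with y hy using dslope_eq_integral hc hy hF1

theorem deriv_dslope_self {p q c : ℝ} {F : ℝ → ℝ} (hc : c ∈ Ioo p q)
    (hF : ContDiffOn ℝ 2 F (Ioo p q)) : deriv (dslope F c) c = iteratedDeriv 2 F c / 2 := by
  rw [deriv_dslope hc hc hF, iteratedDeriv_succ, iteratedDeriv_one]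
  simp [integral_id]
  ring

theorem iteratedDeriv_two_dslope_self {p q c : ℝ} {F : ℝ → ℝ} (hc : c ∈ Ioo p q)
    (hF : ContDiffOn ℝ 3 F (Ioo p q)) :
    iteratedDeriv 2 (dslope F c) c = iteratedDeriv 3 F c / 3 := by
  have hF2 : ContDiffOn ℝ 2 F (Ioo p q) := hF.of_le (by norm_num)
  have e3 : (3 : WithTop ℕ∞) = 1 + 1 + 1 := by norm_num
  have hF' : ContDiffOn ℝ 1 (deriv (deriv F)) (Ioo p q) := by
    rw [e3, contDiffOn_succ_iff_deriv_of_isOpen isOpen_Ioo,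
      contDiffOn_succ_iff_deriv_of_isOpen isOpen_Ioo] at hF
    exact hF.2.2.2.2
  have h1 := hasDerivAt_weightedMean 1 hc hc (hF'.differentiableOn one_ne_zero)
    (hF'.continuousOn_deriv_of_isOpen isOpen_Ioo le_rfl)
  have h2 : deriv (deriv (dslope F c)) c =
      ∫ t in (0 : ℝ)..1, t ^ (1 + 1) * deriv (deriv (deriv F)) (c + t * (c - c)) := by
    refine (h1.congr_of_eventuallyEq ?_).deriv
    filter_upwards [isOpen_Ioo.mem_nhds hc] with y hy using deriv_dslope hc hy hF2
  rw [iteratedDeriv_succ, iteratedDeriv_one, h2, iteratedDeriv_succ, iteratedDeriv_succ,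
    iteratedDeriv_one]
  simp [integral_pow]
  ring

/-- The `C^∞` implicit function theorem in the plane, with the implicit function smooth on a whole
neighbourhood: the smoothness at nearby points comes from the theorem at those points. -/
theorem exists_implicit_contDiffOn {Φ : ℝ × ℝ → ℝ} {O : Set (ℝ × ℝ)} (hO : IsOpen O) {w₀ : ℝ}
    (h0 : ((0 : ℝ), w₀) ∈ O) (hΦ : ContDiffOn ℝ ∞ Φ O) (hΦ0 : Φ (0, w₀) = 0)
    (hd : fderiv ℝ Φ (0, w₀) (0, 1) ≠ 0) :
    ∃ δ > 0, ∃ w : ℝ → ℝ, ContDiffOn ℝ ∞ w (Ioo (-δ) δ) ∧ w 0 = w₀ ∧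
      ∀ x ∈ Ioo (-δ) δ, (x, w x) ∈ O ∧ Φ (x, w x) = 0 := by
  have hn : (∞ : WithTop ℕ∞) ≠ 0 := by simp
  have hat : ∀ u ∈ O, ContDiffAt ℝ ∞ Φ u := fun u hu => hΦ.contDiffAt (hO.mem_nhds hu)
  have hinv : ∀ u, fderiv ℝ Φ u (0, 1) ≠ 0 →
      (fderiv ℝ Φ u ∘L ContinuousLinearMap.inr ℝ ℝ ℝ).IsInvertible := by
    intro u hu
    refine ⟨ContinuousLinearEquiv.unitsEquivAut ℝ (Units.mk0 _ hu), ?_⟩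
    ext
    simp
  set w := (hat _ h0).implicitFunction hn (hinv _ hd) with hw
  have hw0 : w 0 = w₀ := (hat _ h0).implicitFunction_apply_self hn (hinv _ hd)
  have hwc : ContDiffAt ℝ ∞ w 0 := (hat _ h0).contDiffAt_implicitFunction hn (hinv _ hd)
  have hev : ∀ᶠ x in 𝓝 (0 : ℝ), Φ (x, w x) = Φ (0, w₀) :=
    (hat _ h0).eventually_apply_implicitFunction hn (hinv _ hd)
  have hcont : ∀ᶠ x in 𝓝 (0 : ℝ), ContinuousAt w x :=
    ((hwc.of_le (by simp : (1 : WithTop ℕ∞) ≤ ∞)).eventually (by simp)).mono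
      fun x hx => hx.continuousAt
  have htend : Tendsto (fun x => (x, w x)) (𝓝 0) (𝓝 ((0 : ℝ), w₀)) := by
    have := (continuousAt_id.prodMk hwc.continuousAt).tendsto
    simpa [hw0] using this
  have hO' : ∀ᶠ x in 𝓝 (0 : ℝ), (x, w x) ∈ O := htend.eventually (hO.mem_nhds h0)
  have hd' : ∀ᶠ x in 𝓝 (0 : ℝ), fderiv ℝ Φ (x, w x) (0, 1) ≠ 0 := by
    refine htend.eventually (p := fun u => fderiv ℝ Φ u (0, 1) ≠ 0)
      (ContinuousAt.eventually_ne (g := fun u => fderiv ℝ Φ u (0, 1)) ?_ hd)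
    have h1 : ContinuousAt (fderiv ℝ Φ) (0, w₀) :=
      (hΦ.continuousOn_fderiv_of_isOpen hO (by simp)).continuousAt (hO.mem_nhds h0)
    exact h1.clm_apply continuousAt_const
  obtain ⟨δ, hδ, hball⟩ := Metric.eventually_nhds_iff_ball.1 (hev.and (hcont.and (hO'.and hd')))
  rw [Real.ball_eq_Ioo, zero_sub, zero_add] at hball
  refine ⟨δ, hδ, w, fun x hx => ?_, hw0, fun x hx => ⟨(hball x hx).2.2.1, ?_⟩⟩
  · obtain ⟨-, h2, h3, h4⟩ := hball x hx
    refine (((hat _ h3).contDiffAt_implicitFunction hn (hinv _ h4)).congr_of_eventuallyEq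
      ?_).contDiffWithinAt
    have h5 : Tendsto (fun y => (y, w y)) (𝓝 x) (𝓝 (x, w x)) :=
      (continuousAt_id.prodMk h2).tendsto
    filter_upwards [h5.eventually
      ((hat _ h3).eventually_apply_eq_iff_implicitFunction hn (hinv _ h4)),
      isOpen_Ioo.mem_nhds hx] with y hy hy'
    exact (hy.1 (((hball y hy').1).trans (hball x hx).1.symm)).symm
  · rw [(hball x hx).1, hΦ0]

/-- **Takens' normal form.** A smooth field with a double zero at the origin is smoothly conjugate
to `-y ^ 2 + a * y ^ 3` on arbitrarily small intervals. Equating the primitives of `1 / f` and of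
`1 / (-y ^ 2 + a * y ^ 3)`, which share their `log` term for this `a`, gives for `w = y / x` the
equation `1 / w - a x log w + a x log (1 - a x w) = 1 / α - x S x`, regular at `x = 0`. -/
theorem exists_conjugate_takens {f : ℝ → ℝ} {δ₀ ε : ℝ} (hδ₀ : 0 < δ₀) (hε : 0 < ε)
    (hf : ContDiffOn ℝ ∞ f (Ioo (-δ₀) δ₀)) (hf0 : f 0 = 0) (hf1 : deriv f 0 = 0)
    (hf2 : iteratedDeriv 2 f 0 < 0) :
    ∃ u₀ u₁ v₀ v₁ : ℝ, -ε < u₀ ∧ u₀ < 0 ∧ 0 < u₁ ∧ u₁ < ε ∧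
      -ε < v₀ ∧ v₀ < 0 ∧ 0 < v₁ ∧ v₁ < ε ∧
      Conjugate ∞ f (Ioo u₀ u₁)
        (normalForm 0 (2 * iteratedDeriv 3 f 0 / (3 * iteratedDeriv 2 f 0 ^ 2))) (Ioo v₀ v₁) := by
  have h0 : (0 : ℝ) ∈ Ioo (-δ₀) δ₀ := ⟨by linarith, hδ₀⟩
  let q₁ := dslope f 0
  let q₂ := dslope q₁ 0
  let q₃ := dslope q₂ 0
  let q₄ := dslope q₃ 0
  have hq₁ : ContDiffOn ℝ ∞ q₁ (Ioo (-δ₀) δ₀) := contDiffOn_infty_dslope h0 hf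
  have hq₂ : ContDiffOn ℝ ∞ q₂ (Ioo (-δ₀) δ₀) := contDiffOn_infty_dslope h0 hq₁
  have hq₃ : ContDiffOn ℝ ∞ q₃ (Ioo (-δ₀) δ₀) := contDiffOn_infty_dslope h0 hq₂
  have hq₄ : ContDiffOn ℝ ∞ q₄ (Ioo (-δ₀) δ₀) := contDiffOn_infty_dslope h0 hq₃
  obtain ⟨α, hα⟩ : ∃ α, α = -(iteratedDeriv 2 f 0 / 2) := ⟨_, rfl⟩
  obtain ⟨β, hβ⟩ : ∃ β, β = iteratedDeriv 3 f 0 / 6 := ⟨_, rfl⟩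
  have hα0 : 0 < α := by rw [hα]; linarith
  obtain ⟨a, ha⟩ : ∃ a, a = β / α ^ 2 := ⟨_, rfl⟩
  have haeq : 2 * iteratedDeriv 3 f 0 / (3 * iteratedDeriv 2 f 0 ^ 2) = a := by
    rw [ha, hβ, hα]; field_simp; ring
  rw [haeq]
  have hq₂0 : q₂ 0 = -α := by
    simp only [q₂, dslope_same, q₁]
    rw [deriv_dslope_self h0 (by exact_mod_cast contDiffOn_infty.1 hf 2), hα, neg_neg]
  have hq₃0 : q₃ 0 = β := by
    simp only [q₃, q₂, dslope_same]
    rw [deriv_dslope_self h0 (by exact_mod_cast contDiffOn_infty.1 hq₁ 2)]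
    simp only [q₁]
    rw [iteratedDeriv_two_dslope_self h0 (by exact_mod_cast contDiffOn_infty.1 hf 3), hβ]
    ring
  have hfq : ∀ x, f x = x ^ 2 * q₂ x := by
    intro x
    have h1 := eq_add_mul_dslope f 0 x
    have h2 := eq_add_mul_dslope q₁ 0 x
    have h3 : q₁ 0 = 0 := by simp [q₁, hf1]
    rw [hf0] at h1
    rw [h3] at h2
    simp only [q₁, q₂] at *
    rw [h1, h2]; ring
  have hq₂q : ∀ x, q₂ x = -α + β * x + x ^ 2 * q₄ x := by
    intro x
    have h1 := eq_add_mul_dslope q₂ 0 x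
    have h2 := eq_add_mul_dslope q₃ 0 x
    rw [hq₃0] at h2
    rw [hq₂0] at h1
    simp only [q₃, q₄] at *
    rw [h1, h2]; ring
  have hnegev : ∀ᶠ x in 𝓝 (0 : ℝ), q₂ x < 0 :=
    (hq₂.continuousOn.continuousAt (isOpen_Ioo.mem_nhds h0)).eventually
      (gt_mem_nhds (by rw [hq₂0]; linarith))
  obtain ⟨δ₁, hδ₁, hball⟩ := Metric.eventually_nhds_iff_ball.1
    (hnegev.and (isOpen_Ioo.mem_nhds h0 : ∀ᶠ x in 𝓝 (0 : ℝ), x ∈ Ioo (-δ₀) δ₀))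
  rw [Real.ball_eq_Ioo, zero_sub, zero_add] at hball
  have h0' : (0 : ℝ) ∈ Ioo (-δ₁) δ₁ := ⟨by linarith, hδ₁⟩
  have hsub : Ioo (-δ₁) δ₁ ⊆ Ioo (-δ₀) δ₀ := fun x hx => (hball x hx).2
  -- `1 / f x = -1 / (α x²) - a / x - R x`, and `S` is a primitive of `R`.
  let R : ℝ → ℝ := fun x => -((β ^ 2 + q₄ x * (α + β * x)) / (α ^ 2 * q₂ x))
  have hRreg : ContDiffOn ℝ ∞ R (Ioo (-δ₁) δ₁) := by
    refine (ContDiffOn.div (contDiffOn_const.add ((hq₄.mono hsub).mul (by fun_prop)))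
      (contDiffOn_const.mul (hq₂.mono hsub)) fun x hx => ?_).neg
    exact mul_ne_zero (by positivity) (hball x hx).1.ne
  have hRq : ∀ x ∈ Ioo (-δ₁) δ₁, 1 / α + x ^ 2 * R x = -1 / q₂ x - a * x := by
    intro x hx
    have h1 := (hball x hx).1.ne
    simp only [R, ha]
    field_simp
    rw [hq₂q x]
    ring
  let S : ℝ → ℝ := fun x => ∫ s in (0 : ℝ)..x, R s
  have hS : ∀ x ∈ Ioo (-δ₁) δ₁, HasDerivAt S (R x) x := fun x hx =>
    hasDerivAt_primitive hRreg.continuousOn h0' hx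
  have hSreg : ContDiffOn ℝ ∞ S (Ioo (-δ₁) δ₁) := by
    rw [contDiffOn_infty_iff_deriv_of_isOpen isOpen_Ioo]
    exact ⟨fun x hx => (hS x hx).differentiableAt.differentiableWithinAt,
      hRreg.congr fun x hx => (hS x hx).deriv⟩
  let O : Set (ℝ × ℝ) := {z | z.1 ∈ Ioo (-δ₁) δ₁ ∧ 0 < z.2 ∧ 0 < 1 - a * (z.1 * z.2)}
  have hO : IsOpen O := by
    refine (isOpen_Ioo.preimage continuous_fst).inter ?_
    exact (isOpen_lt continuous_const continuous_snd).inter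
      (isOpen_lt (f := fun _ : ℝ × ℝ => (0 : ℝ)) (g := fun z => 1 - a * (z.1 * z.2))
        continuous_const (by fun_prop))
  let Φ : ℝ × ℝ → ℝ := fun z => (z.2)⁻¹ - a * (z.1 * Real.log z.2)
    + a * (z.1 * Real.log (1 - a * (z.1 * z.2))) - 1 / α + z.1 * S z.1
  have hΦreg : ContDiffOn ℝ ∞ Φ O := by
    have hS' : ContDiffOn ℝ ∞ (fun z : ℝ × ℝ => S z.1) O :=
      hSreg.comp contDiff_fst.contDiffOn fun z hz => hz.1
    have hl1 : ContDiffOn ℝ ∞ (fun z : ℝ × ℝ => Real.log z.2) O :=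
      contDiff_snd.contDiffOn.log fun z hz => hz.2.1.ne'
    have hl2 : ContDiffOn ℝ ∞ (fun z : ℝ × ℝ => Real.log (1 - a * (z.1 * z.2))) O :=
      ContDiffOn.log (by fun_prop) fun z hz => hz.2.2.ne'
    have hi : ContDiffOn ℝ ∞ (fun z : ℝ × ℝ => (z.2)⁻¹) O :=
      contDiff_snd.contDiffOn.inv fun z hz => hz.2.1.ne'
    have hx : ContDiffOn ℝ ∞ (fun z : ℝ × ℝ => z.1) O := contDiff_fst.contDiffOn
    exact (((hi.sub (contDiffOn_const.mul (hx.mul hl1))).add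
      (contDiffOn_const.mul (hx.mul hl2))).sub contDiffOn_const).add (hx.mul hS')
  have hmem0 : ((0 : ℝ), 1 * α) ∈ O := ⟨h0', by simpa using hα0, by simp⟩
  rw [one_mul] at hmem0
  have hΦ0 : Φ (0, α) = 0 := by simp [Φ]
  have hΦd : fderiv ℝ Φ (0, α) (0, 1) ≠ 0 := by
    have h1 : HasFDerivAt Φ (fderiv ℝ Φ (0, α)) (0, α) :=
      ((hΦreg.differentiableOn (by simp)).differentiableAt (hO.mem_nhds hmem0)).hasFDerivAt
    have h2 : HasDerivAt (fun w : ℝ => ((0 : ℝ), w)) ((0 : ℝ), (1 : ℝ)) α :=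
      (hasDerivAt_const α (0 : ℝ)).prodMk (hasDerivAt_id α)
    have h3 := h1.comp_hasDerivAt α h2
    have h4 : HasDerivAt (Φ ∘ fun w : ℝ => ((0 : ℝ), w)) (-(α ^ 2)⁻¹) α := by
      have : (Φ ∘ fun w : ℝ => ((0 : ℝ), w)) = fun w => w⁻¹ - 1 / α := by
        funext w; simp [Φ]
      rw [this]
      exact (hasDerivAt_inv hα0.ne').sub_const _
    rw [h3.unique h4]
    exact neg_ne_zero.2 (inv_ne_zero (by positivity))
  obtain ⟨δ₂, hδ₂, w, hwreg, hw0, hw⟩ := exists_implicit_contDiffOn hO hmem0 hΦreg hΦ0 hΦd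
  let h : ℝ → ℝ := fun x => x * w x
  have hwd : ∀ x ∈ Ioo (-δ₂) δ₂, HasDerivAt w (deriv w x) x := fun x hx =>
    ((hwreg.differentiableOn (by simp)).differentiableAt (isOpen_Ioo.mem_nhds hx)).hasDerivAt
  have hhd : ∀ x ∈ Ioo (-δ₂) δ₂, HasDerivAt h (w x + x * deriv w x) x := by
    intro x hx
    exact ((hasDerivAt_id x).mul (hwd x hx)).congr_deriv (by simp)
  have hhreg : ContDiffOn ℝ ∞ h (Ioo (-δ₂) δ₂) := contDiffOn_id.mul hwreg
  have hconj : ∀ x ∈ Ioo (-δ₂) δ₂, normalForm 0 a (h x) = deriv h x * f x := by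
    intro x hx
    obtain ⟨⟨hx₁, hwpos, hpos⟩, hI⟩ := hw x hx
    have hw' := hwd x hx
    have hq := (hball x hx₁).1.ne
    have hx' := hasDerivAt_id x
    have hne : 1 - a * (x * w x) ≠ 0 := hpos.ne'
    have hwne : w x ≠ 0 := hwpos.ne'
    have hD : HasDerivAt (fun x => Φ (x, w x))
        (-deriv w x / w x ^ 2 - a * (1 * Real.log (w x) + x * (deriv w x / w x))
          + a * (1 * Real.log (1 - a * (x * w x))
            + x * (-(a * (1 * w x + x * deriv w x)) / (1 - a * (x * w x))))
          + (1 * S x + x * R x)) x := by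
      have e1 := hw'.fun_inv hwne
      have e2 := (hx'.fun_mul (hw'.log hwne)).const_mul a
      have e3 := (hx'.fun_mul ((((hx'.fun_mul hw').const_mul a).const_sub 1).log hne)).const_mul a
      have e4 := hx'.fun_mul (hS x hx₁)
      exact (((e1.sub e2).add e3).sub_const (1 / α)).add e4
    have hD0 : HasDerivAt (fun x => Φ (x, w x)) 0 x := by
      refine (hasDerivAt_const x (0 : ℝ)).congr_of_eventuallyEq ?_
      filter_upwards [isOpen_Ioo.mem_nhds hx] with y hy using (hw y hy).2
    have hDeq := hD.unique hD0
    have hR := hRq x hx₁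
    simp only [Φ] at hI
    -- The combination `x * I' - I` of the identity `I = 0` is free of logarithms.
    have key : -(x * deriv w x) / w x ^ 2 - (w x)⁻¹ - a * (x ^ 2 * (deriv w x / w x))
        - a ^ 2 * x ^ 2 * (w x + x * deriv w x) / (1 - a * (x * w x))
        + (-1 / q₂ x - a * x) = 0 := by
      rw [← hR]
      linear_combination x * hDeq - hI
    rw [(hhd x hx).deriv, hfq x]
    simp only [normalForm, h]
    have key2 : (w x + x * deriv w x) * q₂ x = -(w x ^ 2 * (1 - a * (x * w x))) := by
      obtain ⟨D, hDdef⟩ : ∃ D, D = 1 - a * (x * w x) := ⟨_, rfl⟩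
      rw [← hDdef] at key hne ⊢
      field_simp at key
      linear_combination -key - q₂ x * (w x + x * deriv w x) * (1 + a * (x * w x)) * hDdef
    linear_combination (-x ^ 2) * key2
  -- Shrink the interval so that `h' > 0` on it and its image is small.
  have hd0 : ∀ᶠ x in 𝓝 (0 : ℝ), 0 < deriv h x := by
    have hm : (0 : ℝ) ∈ Ioo (-δ₂) δ₂ := ⟨by linarith, hδ₂⟩
    refine ((hhreg.continuousOn_deriv_of_isOpen isOpen_Ioo (by simp)).continuousAt
      (isOpen_Ioo.mem_nhds hm)).eventually (lt_mem_nhds ?_)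
    rw [(hhd 0 hm).deriv, hw0]
    simpa using hα0
  have hmε : ∀ᶠ x in 𝓝 (0 : ℝ), h x ∈ Ioo (-ε) ε := by
    have hm : (0 : ℝ) ∈ Ioo (-δ₂) δ₂ := ⟨by linarith, hδ₂⟩
    refine (hhd 0 hm).continuousAt.eventually (isOpen_Ioo.mem_nhds ?_)
    simp [h, hε]
  have hs : ∀ᶠ x in 𝓝 (0 : ℝ), x ∈ Ioo (-δ₂) δ₂ := Ioo_mem_nhds (by linarith) hδ₂
  have hs' : ∀ᶠ x in 𝓝 (0 : ℝ), x ∈ Ioo (-ε) ε := Ioo_mem_nhds (by linarith) hε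
  obtain ⟨δ₃, hδ₃, hball₃⟩ := Metric.eventually_nhds_iff_ball.1 (hd0.and (hmε.and (hs.and hs')))
  rw [Real.ball_eq_Ioo, zero_sub, zero_add] at hball₃
  obtain ⟨u, hu, huδ⟩ := exists_between hδ₃
  have hIcc : Icc (-u) u ⊆ Ioo (-δ₃) δ₃ := fun x hx => ⟨by linarith [hx.1], by linarith [hx.2]⟩
  have hl : -u ∈ Ioo (-δ₃) δ₃ := ⟨by linarith, by linarith⟩
  have hr : u ∈ Ioo (-δ₃) δ₃ := ⟨by linarith, huδ⟩
  have hsub₃ : Ioo (-δ₃) δ₃ ⊆ Ioo (-δ₂) δ₂ := fun x hx => (hball₃ x hx).2.2.1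
  have hcont : ContinuousOn h (Icc (-u) u) := hhreg.continuousOn.mono (hIcc.trans hsub₃)
  have hmono : StrictMonoOn h (Icc (-u) u) := by
    refine strictMonoOn_of_deriv_pos (convex_Icc _ _) hcont fun x hx => ?_
    rw [interior_Icc] at hx
    exact (hball₃ x (hIcc (Ioo_subset_Icc_self hx))).1
  have hh0 : h 0 = 0 := by simp [h]
  have hmem0 : (0 : ℝ) ∈ Icc (-u) u := ⟨by linarith, hu.le⟩
  have hmeml : -u ∈ Icc (-u) u := left_mem_Icc.2 (by linarith)
  have hmemr : u ∈ Icc (-u) u := right_mem_Icc.2 (by linarith)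
  have himage : h '' Ioo (-u) u = Ioo (h (-u)) (h u) := by
    apply Subset.antisymm
    · rintro _ ⟨x, hx, rfl⟩
      exact ⟨hmono hmeml (Ioo_subset_Icc_self hx) hx.1, hmono (Ioo_subset_Icc_self hx) hmemr hx.2⟩
    · exact intermediate_value_Ioo (by linarith) hcont
  have hUsub : Ioo (-u) u ⊆ Ioo (-δ₃) δ₃ := Ioo_subset_Icc_self.trans hIcc
  refine ⟨-u, u, h (-u), h u, (hball₃ _ hl).2.2.2.1, by linarith, hu, (hball₃ _ hr).2.2.2.2,
    (hball₃ _ hl).2.1.1, ?_, ?_, (hball₃ _ hr).2.1.2, ?_⟩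
  · rw [← hh0]; exact hmono hmeml hmem0 (by linarith)
  · calc (0 : ℝ) = h 0 := hh0.symm
      _ < h u := hmono hmem0 hmemr hu
  · rw [← himage]
    exact conjugate_image (k := ⊤) le_top (hhreg.mono (hUsub.trans hsub₃))
      (fun x hx => (hball₃ x (hUsub hx)).1) fun x hx => hconj x (hsub₃ (hUsub hx))

/-! ### Normal forms with prescribed eigenvalues -/

/-- For the zeros `d * (r - 1)` and `d * (r + 1)` of a normal form with derivatives `l₁` and `l₂`,
the asymmetry `r` as a function of `l₁` and `l₂`: the small root of
`2 * r = ρ * (1 - 3 * r ^ 2)`, where `ρ = (l₁ + l₂) / (l₁ - l₂)`, written without cancellation. -/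
noncomputable def asymmetry (l₁ l₂ : ℝ) : ℝ :=
  (l₁ + l₂) / (l₁ - l₂) / (1 + √(1 + 3 * ((l₁ + l₂) / (l₁ - l₂)) ^ 2))

/-- Half the distance of the two zeros of the normal form with derivatives `l₁`, `l₂` there. -/
noncomputable def halfGap (l₁ l₂ : ℝ) : ℝ :=
  (l₁ - l₂) / 4 * ((1 + 3 * asymmetry l₁ l₂ ^ 2) / (1 - 3 * asymmetry l₁ l₂ ^ 2))

/-- The parameter `ν` of the normal form with derivatives `l₁`, `l₂` at its zeros. -/
noncomputable def paramNu (l₁ l₂ : ℝ) : ℝ :=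
  halfGap l₁ l₂ ^ 2 * (1 - asymmetry l₁ l₂ ^ 2) ^ 2 / (1 + 3 * asymmetry l₁ l₂ ^ 2)

/-- The parameter `a` of the normal form with derivatives `l₁`, `l₂` at its zeros. -/
noncomputable def paramA (l₁ l₂ : ℝ) : ℝ :=
  2 * asymmetry l₁ l₂ / (halfGap l₁ l₂ * (1 + 3 * asymmetry l₁ l₂ ^ 2))

theorem asymmetry_spec (l₁ l₂ : ℝ) :
    0 < 1 - 3 * asymmetry l₁ l₂ ^ 2 ∧
      2 * asymmetry l₁ l₂ = (l₁ + l₂) / (l₁ - l₂) * (1 - 3 * asymmetry l₁ l₂ ^ 2) := by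
  unfold asymmetry
  obtain ⟨ρ, hρ⟩ : ∃ ρ, ρ = (l₁ + l₂) / (l₁ - l₂) := ⟨_, rfl⟩
  rw [← hρ]
  obtain ⟨t, ht⟩ : ∃ t, t = √(1 + 3 * ρ ^ 2) := ⟨_, rfl⟩
  have ht0 : 0 ≤ t := ht ▸ Real.sqrt_nonneg _
  have ht2 : t ^ 2 = 1 + 3 * ρ ^ 2 := by rw [ht]; exact Real.sq_sqrt (by positivity)
  rw [← ht]
  have e : 1 - 3 * (ρ / (1 + t)) ^ 2 = 2 / (1 + t) := by
    field_simp
    linear_combination ht2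
  rw [e]
  exact ⟨by positivity, by ring⟩

theorem abs_asymmetry_le (l₁ l₂ : ℝ) : |asymmetry l₁ l₂| ≤ |(l₁ + l₂) / (l₁ - l₂)| := by
  have h := Real.sqrt_nonneg (1 + 3 * ((l₁ + l₂) / (l₁ - l₂)) ^ 2)
  rw [asymmetry, abs_div, abs_of_pos (a := 1 + _) (by positivity)]
  exact div_le_self (abs_nonneg _) (by linarith)

theorem halfGap_pos {l₁ l₂ : ℝ} (h : l₂ < l₁) : 0 < halfGap l₁ l₂ :=
  mul_pos (by linarith) (div_pos (by positivity) (asymmetry_spec l₁ l₂).1)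

theorem normalForm_eq_mul {l₁ l₂ : ℝ} (h : l₂ < l₁) (y : ℝ) :
    normalForm (paramNu l₁ l₂) (paramA l₁ l₂) y =
      (y - halfGap l₁ l₂ * (asymmetry l₁ l₂ - 1)) * (y - halfGap l₁ l₂ * (asymmetry l₁ l₂ + 1)) *
        (paramA l₁ l₂ * y - (1 - asymmetry l₁ l₂ ^ 2) / (1 + 3 * asymmetry l₁ l₂ ^ 2)) := by
  have hd := (halfGap_pos h).ne'
  simp only [normalForm, paramNu, paramA]
  generalize halfGap l₁ l₂ = d at *
  generalize asymmetry l₁ l₂ = r at *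
  have : 1 + 3 * r ^ 2 ≠ 0 := by positivity
  field_simp
  ring

theorem hasDerivAt_normalForm (ν a y : ℝ) :
    HasDerivAt (normalForm ν a) (-(2 * y) + 3 * a * y ^ 2) y := by
  unfold normalForm
  refine ((((hasDerivAt_const y ν).fun_sub (hasDerivAt_pow 2 y)).fun_add
    ((hasDerivAt_pow 3 y).const_mul a))).congr_deriv ?_
  push_cast
  ring

theorem contDiff_normalForm {n : WithTop ℕ∞} (ν a : ℝ) : ContDiff ℝ n (normalForm ν a) := by
  unfold normalForm
  fun_prop

theorem deriv_normalForm_left {l₁ l₂ : ℝ} (h : l₂ < l₁) :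
    deriv (normalForm (paramNu l₁ l₂) (paramA l₁ l₂))
      (halfGap l₁ l₂ * (asymmetry l₁ l₂ - 1)) = l₁ := by
  have hd := (halfGap_pos h).ne'
  obtain ⟨hr, hρ⟩ := asymmetry_spec l₁ l₂
  have hl : l₁ - l₂ ≠ 0 := (sub_pos.2 h).ne'
  rw [(hasDerivAt_normalForm _ _ _).deriv]
  have hgap : halfGap l₁ l₂ * (4 * (1 - 3 * asymmetry l₁ l₂ ^ 2)) =
      (l₁ - l₂) * (1 + 3 * asymmetry l₁ l₂ ^ 2) := by
    rw [halfGap]; field_simp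
  simp only [paramA]
  generalize halfGap l₁ l₂ = d at *
  generalize asymmetry l₁ l₂ = r at *
  have h3 : 1 + 3 * r ^ 2 ≠ 0 := by positivity
  field_simp at hρ ⊢
  refine mul_right_cancel₀ hr.ne' ?_
  linear_combination (1 / 2 : ℝ) * hgap * (1 + 2 * r - 3 * r ^ 2)
    + (1 / 2 : ℝ) * (1 + 3 * r ^ 2) * hρ

theorem deriv_normalForm_right {l₁ l₂ : ℝ} (h : l₂ < l₁) :
    deriv (normalForm (paramNu l₁ l₂) (paramA l₁ l₂))
      (halfGap l₁ l₂ * (asymmetry l₁ l₂ + 1)) = l₂ := by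
  have hd := (halfGap_pos h).ne'
  obtain ⟨hr, hρ⟩ := asymmetry_spec l₁ l₂
  have hl : l₁ - l₂ ≠ 0 := (sub_pos.2 h).ne'
  rw [(hasDerivAt_normalForm _ _ _).deriv]
  have hgap : halfGap l₁ l₂ * (4 * (1 - 3 * asymmetry l₁ l₂ ^ 2)) =
      (l₁ - l₂) * (1 + 3 * asymmetry l₁ l₂ ^ 2) := by
    rw [halfGap]; field_simp
  simp only [paramA]
  generalize halfGap l₁ l₂ = d at *
  generalize asymmetry l₁ l₂ = r at *
  have h3 : 1 + 3 * r ^ 2 ≠ 0 := by positivity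
  field_simp at hρ ⊢
  refine mul_right_cancel₀ hr.ne' ?_
  linear_combination (1 / 2 : ℝ) * hgap * (3 * r ^ 2 + 2 * r - 1)
    + (1 / 2 : ℝ) * (1 + 3 * r ^ 2) * hρ

/-- The normal form with prescribed eigenvalues has no further zeros on an interval where
`|a * y| ≤ 1 / 3`: its third linear factor is negative there. -/
theorem twoZeros_normalForm {l₁ l₂ P p q Q : ℝ} (h₁ : 0 < l₁) (h₂ : l₂ < 0) (hP : P < p)
    (hp : p ≤ -(2 * halfGap l₁ l₂)) (hq : 2 * halfGap l₁ l₂ ≤ q) (hQ : q < Q)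
    (ha : ∀ y ∈ Ioo P Q, |paramA l₁ l₂ * y| ≤ 1 / 3) :
    TwoZeros (normalForm (paramNu l₁ l₂) (paramA l₁ l₂)) P p
      (halfGap l₁ l₂ * (asymmetry l₁ l₂ - 1)) (halfGap l₁ l₂ * (asymmetry l₁ l₂ + 1)) q Q := by
  have h := h₂.trans h₁
  have hd := halfGap_pos h
  obtain ⟨hr, -⟩ := asymmetry_spec l₁ l₂
  have hfac := normalForm_eq_mul h
  have hdl := deriv_normalForm_left h
  have hdr := deriv_normalForm_right h
  have hrabs : |asymmetry l₁ l₂| < 1 := by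
    rw [← sq_lt_one_iff_abs_lt_one]; nlinarith [sq_nonneg (asymmetry l₁ l₂)]
  rw [abs_lt] at hrabs
  have hc : 1 / 3 < (1 - asymmetry l₁ l₂ ^ 2) / (1 + 3 * asymmetry l₁ l₂ ^ 2) := by
    rw [lt_div_iff₀ (by positivity)]; linarith
  have hthird : ∀ y ∈ Ioo P Q,
      paramA l₁ l₂ * y - (1 - asymmetry l₁ l₂ ^ 2) / (1 + 3 * asymmetry l₁ l₂ ^ 2) < 0 :=
    fun y hy => by linarith [(abs_le.1 (ha y hy)).2]
  have hy₁ : -(2 * halfGap l₁ l₂) < halfGap l₁ l₂ * (asymmetry l₁ l₂ - 1) := by nlinarith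
  have hy₂ : halfGap l₁ l₂ * (asymmetry l₁ l₂ + 1) < 2 * halfGap l₁ l₂ := by nlinarith
  have hy₁₂ : halfGap l₁ l₂ * (asymmetry l₁ l₂ - 1) < halfGap l₁ l₂ * (asymmetry l₁ l₂ + 1) := by
    linarith
  refine ⟨hP, hp.trans_lt hy₁, hy₁₂, hy₂.trans_le hq, hQ, fun y hy => ?_, fun y hy => ?_,
    fun y hy => ?_, ?_, ?_, ?_, ?_⟩
  · rw [hfac]
    refine mul_neg_of_pos_of_neg (mul_pos_of_neg_of_neg (by linarith [hy.2]) (by linarith [hy.2]))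
      (hthird y ⟨hy.1, by linarith [hy.2]⟩)
  · rw [hfac]
    refine mul_pos_of_neg_of_neg (mul_neg_of_pos_of_neg (by linarith [hy.1]) (by linarith [hy.2]))
      (hthird y ⟨by linarith [hy.1], by linarith [hy.2]⟩)
  · rw [hfac]
    refine mul_neg_of_pos_of_neg (mul_pos (by linarith [hy.1]) (by linarith [hy.1]))
      (hthird y ⟨by linarith [hy.1], hy.2⟩)
  · rw [hfac]; simp
  · rw [hfac]; simp
  · rw [hdl]; exact h₁
  · rw [hdr]; exact h₂

theorem continuousOn_asymmetry {l₁ l₂ : ℝ → ℝ} {S : Set ℝ} (h₁ : ContinuousOn l₁ S)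
    (h₂ : ContinuousOn l₂ S) (h : ∀ μ ∈ S, l₂ μ < l₁ μ) :
    ContinuousOn (fun μ => asymmetry (l₁ μ) (l₂ μ)) S := by
  have hρ : ContinuousOn (fun μ => (l₁ μ + l₂ μ) / (l₁ μ - l₂ μ)) S :=
    (h₁.add h₂).div (h₁.sub h₂) fun μ hμ => (sub_pos.2 (h μ hμ)).ne'
  refine hρ.div (continuousOn_const.add
    (continuousOn_const.add (continuousOn_const.mul (hρ.pow 2))).sqrt) fun μ _ => ?_
  positivity

theorem continuousOn_halfGap {l₁ l₂ : ℝ → ℝ} {S : Set ℝ} (h₁ : ContinuousOn l₁ S)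
    (h₂ : ContinuousOn l₂ S) (h : ∀ μ ∈ S, l₂ μ < l₁ μ) :
    ContinuousOn (fun μ => halfGap (l₁ μ) (l₂ μ)) S := by
  have hr := (continuousOn_asymmetry h₁ h₂ h).pow 2
  refine ((h₁.sub h₂).div_const 4).mul
    ((continuousOn_const.add (continuousOn_const.mul hr)).div
      (continuousOn_const.sub (continuousOn_const.mul hr)) fun μ _ => ?_)
  exact (asymmetry_spec _ _).1.ne'

theorem continuousOn_paramNu {l₁ l₂ : ℝ → ℝ} {S : Set ℝ} (h₁ : ContinuousOn l₁ S)
    (h₂ : ContinuousOn l₂ S) (h : ∀ μ ∈ S, l₂ μ < l₁ μ) :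
    ContinuousOn (fun μ => paramNu (l₁ μ) (l₂ μ)) S := by
  have hr := (continuousOn_asymmetry h₁ h₂ h).pow 2
  refine (((continuousOn_halfGap h₁ h₂ h).pow 2).mul ((continuousOn_const.sub hr).pow 2)).div
    (continuousOn_const.add (continuousOn_const.mul hr)) fun μ _ => ?_
  positivity

theorem continuousOn_paramA {l₁ l₂ : ℝ → ℝ} {S : Set ℝ} (h₁ : ContinuousOn l₁ S)
    (h₂ : ContinuousOn l₂ S) (h : ∀ μ ∈ S, l₂ μ < l₁ μ) :
    ContinuousOn (fun μ => paramA (l₁ μ) (l₂ μ)) S := by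
  have hr := continuousOn_asymmetry h₁ h₂ h
  refine (continuousOn_const.mul hr).div ((continuousOn_halfGap h₁ h₂ h).mul
    (continuousOn_const.add (continuousOn_const.mul (hr.pow 2)))) fun μ hμ => ?_
  exact mul_ne_zero (halfGap_pos (h μ hμ)).ne' (by positivity)

/-! ### Asymptotics of the matched parameters -/

theorem tendsto_sqrt_nhdsGT_zero : Tendsto (fun μ : ℝ => √μ) (𝓝[>] 0) (𝓝 0) := by
  have := (Real.continuous_sqrt.tendsto 0).mono_left (nhdsWithin_le_nhds (s := Ioi 0))
  simpa using this

theorem isBigO_sqrt_pow {m n : ℕ} (h : m ≤ n) :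
    (fun μ : ℝ => √μ ^ n) =O[𝓝[>] 0] fun μ => √μ ^ m := by
  refine IsBigO.of_bound 1 ?_
  filter_upwards [Ioo_mem_nhdsGT zero_lt_one] with μ hμ
  have h1 : √μ ≤ 1 := Real.sqrt_le_one.2 hμ.2.le
  have h0 := Real.sqrt_nonneg μ
  rw [Real.norm_of_nonneg (by positivity), Real.norm_of_nonneg (by positivity), one_mul]
  exact pow_le_pow_of_le_one h0 h1 h

/-- A function that behaves like `c * √μ` with `c > 0` is positive and comparable to `√μ`. -/
theorem comparable_of_isBigO {g : ℝ → ℝ} {c : ℝ} (hc : 0 < c)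
    (h : (fun μ => g μ - c * √μ) =O[𝓝[>] 0] fun μ => √μ ^ 2) :
    (∀ᶠ μ in 𝓝[>] 0, 0 < g μ) ∧ g =O[𝓝[>] 0] (fun μ => √μ) ∧
      (fun μ => (g μ)⁻¹) =O[𝓝[>] 0] fun μ => (√μ)⁻¹ := by
  obtain ⟨C, hC0, hC⟩ := h.exists_pos
  have hsmall : ∀ᶠ μ in 𝓝[>] (0 : ℝ), C * √μ < c / 2 := by
    have := tendsto_sqrt_nhdsGT_zero.const_mul C
    rw [mul_zero] at this
    exact this.eventually (gt_mem_nhds (by positivity))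
  have hlow : ∀ᶠ μ in 𝓝[>] (0 : ℝ), 0 < √μ ∧ c / 2 * √μ ≤ g μ := by
    filter_upwards [hC.bound, hsmall, self_mem_nhdsWithin] with μ h1 h2 h3
    have hs : 0 < √μ := Real.sqrt_pos.2 h3
    refine ⟨hs, ?_⟩
    rw [Real.norm_of_nonneg (pow_nonneg hs.le 2)] at h1
    have := (abs_le.1 h1).1
    nlinarith
  refine ⟨hlow.mono fun μ h => (mul_pos (by positivity) h.1).trans_le h.2, ?_, ?_⟩
  · have h1 : (fun μ : ℝ => √μ ^ 2) =O[𝓝[>] 0] fun μ => √μ := by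
      simpa using isBigO_sqrt_pow one_le_two
    have h2 := (h.trans h1).add ((isBigO_refl (fun μ : ℝ => √μ) _).const_mul_left c)
    simpa using h2
  · refine IsBigO.of_bound (c / 2)⁻¹ ?_
    filter_upwards [hlow] with μ h
    have hpos := (mul_pos (half_pos hc) h.1)
    rw [norm_inv, norm_inv, Real.norm_of_nonneg (hpos.trans_le h.2).le,
      Real.norm_of_nonneg h.1.le, ← mul_inv]
    exact inv_anti₀ hpos h.2

theorem sqrt_sq_eventuallyEq : (fun μ : ℝ => √μ ^ 2) =ᶠ[𝓝[>] 0] fun μ => μ := by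
  filter_upwards [self_mem_nhdsWithin] with μ hμ using Real.sq_sqrt (le_of_lt hμ)

section Asymptotics

variable {l₁ l₂ : ℝ → ℝ} {p a : ℝ}

theorem isBigO_sum (hd : (fun μ => (l₁ μ - l₂ μ) - 4 * p * √μ) =O[𝓝[>] 0] fun μ => √μ ^ 2)
    (hp : 0 < p)
    (hs : (fun μ => (l₁ μ + l₂ μ) - a / 4 * (l₁ μ - l₂ μ) ^ 2) =O[𝓝[>] 0] fun μ => √μ ^ 3) :
    (fun μ => l₁ μ + l₂ μ) =O[𝓝[>] 0] fun μ => √μ ^ 2 := by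
  obtain ⟨-, h1, -⟩ := comparable_of_isBigO (by positivity) hd
  have h2 := (hs.trans (isBigO_sqrt_pow (by norm_num : 2 ≤ 3))).add
    ((h1.pow 2).const_mul_left (a / 4))
  simpa using h2

theorem isBigO_asymmetry (hd : (fun μ => (l₁ μ - l₂ μ) - 4 * p * √μ) =O[𝓝[>] 0] fun μ => √μ ^ 2)
    (hp : 0 < p)
    (hs : (fun μ => (l₁ μ + l₂ μ) - a / 4 * (l₁ μ - l₂ μ) ^ 2) =O[𝓝[>] 0] fun μ => √μ ^ 3) :
    (fun μ => asymmetry (l₁ μ) (l₂ μ)) =O[𝓝[>] 0] fun μ => √μ := by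
  obtain ⟨-, -, h1⟩ := comparable_of_isBigO (by positivity) hd
  have h2 := (isBigO_sum hd hp hs).mul h1
  have h3 : (fun μ => asymmetry (l₁ μ) (l₂ μ)) =O[𝓝[>] 0]
      fun μ => (l₁ μ + l₂ μ) * (l₁ μ - l₂ μ)⁻¹ :=
    IsBigO.of_bound 1 (Eventually.of_forall fun μ => by
      rw [one_mul, ← div_eq_mul_inv]; exact abs_asymmetry_le _ _)
  refine (h3.trans h2).trans_eventuallyEq ?_
  filter_upwards [self_mem_nhdsWithin] with μ hμ
  have : √μ ≠ 0 := (Real.sqrt_pos.2 hμ).ne'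
  field_simp

/-- A differentiable function of `r ^ 2` differs from its value at `r = 0` by `O(μ)`, for the
asymmetry `r`. -/
theorem isBigO_comp_asymmetry_sq
    (hd : (fun μ => (l₁ μ - l₂ μ) - 4 * p * √μ) =O[𝓝[>] 0] fun μ => √μ ^ 2) (hp : 0 < p)
    (hs : (fun μ => (l₁ μ + l₂ μ) - a / 4 * (l₁ μ - l₂ μ) ^ 2) =O[𝓝[>] 0] fun μ => √μ ^ 3)
    {K : ℝ → ℝ} (hK : DifferentiableAt ℝ K 0) :
    (fun μ => K (asymmetry (l₁ μ) (l₂ μ) ^ 2) - K 0) =O[𝓝[>] 0] fun μ => √μ ^ 2 := by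
  have hr := (isBigO_asymmetry hd hp hs).pow 2
  have hr0 : Tendsto (fun μ => asymmetry (l₁ μ) (l₂ μ) ^ 2) (𝓝[>] 0) (𝓝 0) := by
    refine hr.trans_tendsto ?_
    simpa using tendsto_sqrt_nhdsGT_zero.pow 2
  have h1 := hK.isBigO_sub.comp_tendsto hr0
  simp only [Function.comp_def, sub_zero] at h1
  exact h1.trans hr

theorem isBigO_paramNu (hd : (fun μ => (l₁ μ - l₂ μ) - 4 * p * √μ) =O[𝓝[>] 0] fun μ => √μ ^ 2)
    (hp : 0 < p)
    (hs : (fun μ => (l₁ μ + l₂ μ) - a / 4 * (l₁ μ - l₂ μ) ^ 2) =O[𝓝[>] 0] fun μ => √μ ^ 3) :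
    (fun μ => paramNu (l₁ μ) (l₂ μ) - p ^ 2 * μ) =O[𝓝[>] 0] fun μ => √μ ^ 3 := by
  obtain ⟨-, h1, -⟩ := comparable_of_isBigO (by positivity) hd
  let K : ℝ → ℝ := fun z => (1 + 3 * z) * (1 - z) ^ 2 / (1 - 3 * z) ^ 2
  have hK : DifferentiableAt ℝ K 0 := by
    refine DifferentiableAt.div (by fun_prop) (by fun_prop) (by norm_num)
  have h2 := isBigO_comp_asymmetry_sq hd hp hs hK
  have h3 : (fun μ => (l₁ μ - l₂ μ) ^ 2 / 16 * (K (asymmetry (l₁ μ) (l₂ μ) ^ 2) - K 0))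
      =O[𝓝[>] 0] fun μ => √μ ^ 3 := by
    have h4 := ((h1.pow 2).const_mul_left (1 / 16)).mul h2
    simp only [← pow_add] at h4
    refine (h4.congr_left fun μ => ?_).trans (isBigO_sqrt_pow (by norm_num : 3 ≤ 2 + 2))
    ring
  have h5 : (fun μ => (l₁ μ - l₂ μ - 4 * p * √μ) * ((l₁ μ - l₂ μ + 4 * p * √μ) / 16))
      =O[𝓝[>] 0] fun μ => √μ ^ 3 := by
    have h6 : (fun μ => (l₁ μ - l₂ μ + 4 * p * √μ)) =O[𝓝[>] 0] fun μ => √μ :=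
      h1.add ((isBigO_refl _ _).const_mul_left (4 * p))
    have h7 := hd.mul (h6.const_mul_left (1 / 16))
    refine (h7.congr_left fun μ => ?_).congr_right fun μ => ?_ <;> ring
  refine (h3.add h5).congr' ?_ EventuallyEq.rfl
  filter_upwards [sqrt_sq_eventuallyEq] with μ hμ
  have hr := (asymmetry_spec (l₁ μ) (l₂ μ)).1
  have hK0 : K 0 = 1 := by simp [K]
  have e : p ^ 2 * μ = p ^ 2 * √μ ^ 2 := by rw [hμ]
  rw [hK0, e]
  simp only [K, paramNu, halfGap]
  generalize asymmetry (l₁ μ) (l₂ μ) = r at *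
  have h9 : 1 + 3 * r ^ 2 ≠ 0 := by positivity
  have h10 := hr.ne'
  field_simp
  ring

theorem isBigO_paramA (hd : (fun μ => (l₁ μ - l₂ μ) - 4 * p * √μ) =O[𝓝[>] 0] fun μ => √μ ^ 2)
    (hp : 0 < p)
    (hs : (fun μ => (l₁ μ + l₂ μ) - a / 4 * (l₁ μ - l₂ μ) ^ 2) =O[𝓝[>] 0] fun μ => √μ ^ 3) :
    (fun μ => paramA (l₁ μ) (l₂ μ) - a) =O[𝓝[>] 0] fun μ => √μ := by
  obtain ⟨hpos, -, h1⟩ := comparable_of_isBigO (by positivity) hd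
  let K : ℝ → ℝ := fun z => ((1 - 3 * z) / (1 + 3 * z)) ^ 2
  have hK : DifferentiableAt ℝ K 0 := by
    refine DifferentiableAt.pow (DifferentiableAt.div (by fun_prop) (by fun_prop) (by norm_num)) 2
  have h2 := isBigO_comp_asymmetry_sq hd hp hs hK
  have hK0 : K 0 = 1 := by simp [K]
  rw [hK0] at h2
  have hss : (fun μ : ℝ => √μ ^ 2) =O[𝓝[>] 0] fun μ => √μ := by
    simpa using isBigO_sqrt_pow one_le_two
  have hK1 : (fun μ => K (asymmetry (l₁ μ) (l₂ μ) ^ 2)) =O[𝓝[>] 0] fun _ => (1 : ℝ) := by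
    have h3 : (fun μ : ℝ => √μ ^ 2) =O[𝓝[>] 0] fun _ => (1 : ℝ) := by
      simpa using isBigO_sqrt_pow (Nat.zero_le 2)
    simpa using (h2.trans h3).add (isBigO_refl (fun _ : ℝ => (1 : ℝ)) _)
  have h4 : (fun μ => 4 * ((l₁ μ + l₂ μ) - a / 4 * (l₁ μ - l₂ μ) ^ 2) * ((l₁ μ - l₂ μ)⁻¹ ^ 2) *
      K (asymmetry (l₁ μ) (l₂ μ) ^ 2)) =O[𝓝[>] 0] fun μ => √μ := by
    refine (((hs.const_mul_left 4).mul (h1.pow 2)).mul hK1).trans_eventuallyEq ?_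
    filter_upwards [self_mem_nhdsWithin] with μ hμ
    have : √μ ≠ 0 := (Real.sqrt_pos.2 hμ).ne'
    field_simp
  refine (h4.add ((h2.trans hss).const_mul_left a)).congr' ?_ EventuallyEq.rfl
  filter_upwards [hpos] with μ hμ
  obtain ⟨hr, hρ⟩ := asymmetry_spec (l₁ μ) (l₂ μ)
  simp only [K, paramA, halfGap]
  generalize asymmetry (l₁ μ) (l₂ μ) = r at *
  have h9 : 1 + 3 * r ^ 2 ≠ 0 := by positivity
  have h10 := hr.ne'
  have h11 := hμ.ne'
  field_simp at hρ ⊢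
  linear_combination (-4) * (1 - 3 * r ^ 2) * hρ

theorem tendsto_halfGap (hd : (fun μ => (l₁ μ - l₂ μ) - 4 * p * √μ) =O[𝓝[>] 0] fun μ => √μ ^ 2)
    (hp : 0 < p)
    (hs : (fun μ => (l₁ μ + l₂ μ) - a / 4 * (l₁ μ - l₂ μ) ^ 2) =O[𝓝[>] 0] fun μ => √μ ^ 3) :
    Tendsto (fun μ => halfGap (l₁ μ) (l₂ μ)) (𝓝[>] 0) (𝓝 0) := by
  obtain ⟨-, h1, -⟩ := comparable_of_isBigO (by positivity) hd
  have hl := h1.trans_tendsto tendsto_sqrt_nhdsGT_zero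
  have hr := (isBigO_asymmetry hd hp hs).trans_tendsto tendsto_sqrt_nhdsGT_zero
  have hq := ((hr.pow 2).const_mul 3)
  have h2 := (hl.div_const 4).mul ((hq.const_add 1).div (hq.const_sub 1) (by norm_num))
  simp only [zero_div, zero_mul] at h2
  exact h2

end Asymptotics

/-! ### Zeros of concave functions -/

/-- A function with strictly decreasing derivative that is positive at `c` and negative at `p < c`
and at `q > c` has the phase portrait `TwoZeros`. -/
theorem exists_twoZeros {F : ℝ → ℝ} {P p c q Q : ℝ} (hPp : P < p) (hpc : p < c) (hcq : c < q)
    (hqQ : q < Q) (hd : DifferentiableOn ℝ F (Ioo P Q)) (hanti : StrictAntiOn (deriv F) (Ioo P Q))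
    (hp : F p < 0) (hc : 0 < F c) (hq : F q < 0) :
    ∃ x₁ x₂, x₁ < c ∧ c < x₂ ∧ TwoZeros F P p x₁ x₂ q Q := by
  have hcont := hd.continuousOn
  obtain ⟨x₁, hx₁, h₁⟩ := intermediate_value_Ioo hpc.le
    (hcont.mono fun z hz => ⟨hPp.trans_le hz.1, by linarith [hz.2]⟩) ⟨hp, hc⟩
  obtain ⟨x₂, hx₂, h₂⟩ := intermediate_value_Ioo' hcq.le
    (hcont.mono fun z hz => ⟨by linarith [hz.1], hz.2.trans_lt hqQ⟩) ⟨hq, hc⟩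
  have hx₁₂ : x₁ < x₂ := hx₁.2.trans hx₂.1
  have m₁ : x₁ ∈ Ioo P Q := ⟨by linarith [hx₁.1], by linarith [hx₂.2]⟩
  have m₂ : x₂ ∈ Ioo P Q := ⟨by linarith [hx₁.1], by linarith [hx₂.2]⟩
  have hsub : Icc x₁ x₂ ⊆ Ioo P Q := fun z hz => ⟨m₁.1.trans_le hz.1, hz.2.trans_lt m₂.2⟩
  obtain ⟨ξ, hξ, hξ'⟩ := exists_deriv_eq_zero hx₁₂ (hcont.mono hsub) (h₁.trans h₂.symm)
  have mξ := hsub (Ioo_subset_Icc_self hξ)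
  have hinc : StrictMonoOn F (Ioc P ξ) := by
    have hs : Ioc P ξ ⊆ Ioo P Q := fun z hz => ⟨hz.1, hz.2.trans_lt mξ.2⟩
    refine strictMonoOn_of_deriv_pos (convex_Ioc P ξ) (hcont.mono hs) fun z hz => ?_
    rw [interior_Ioc] at hz
    rw [← hξ']
    exact hanti (hs (Ioo_subset_Ioc_self hz)) mξ hz.2
  have hdec : StrictAntiOn F (Ico ξ Q) := by
    have hs : Ico ξ Q ⊆ Ioo P Q := fun z hz => ⟨mξ.1.trans_le hz.1, hz.2⟩
    refine strictAntiOn_of_deriv_neg (convex_Ico ξ Q) (hcont.mono hs) fun z hz => ?_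
    rw [interior_Ico] at hz
    rw [← hξ']
    exact hanti mξ (hs (Ioo_subset_Ico_self hz)) hz.1
  have n₁ : x₁ ∈ Ioc P ξ := ⟨m₁.1, hξ.1.le⟩
  have n₂ : x₂ ∈ Ico ξ Q := ⟨hξ.2.le, m₂.2⟩
  refine ⟨x₁, x₂, hx₁.2, hx₂.1, hPp, hx₁.1, hx₁₂, hx₂.2, hqQ, fun x hx => ?_, fun x hx => ?_,
    fun x hx => ?_, h₁, h₂, ?_, ?_⟩
  · rw [← h₁]
    exact hinc ⟨hx.1, (hx.2.trans hξ.1).le⟩ n₁ hx.2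
  · rcases le_total x ξ with h | h
    · rw [← h₁]
      exact hinc n₁ ⟨m₁.1.trans hx.1, h⟩ hx.1
    · rw [← h₂]
      exact hdec ⟨h, hx.2.trans m₂.2⟩ n₂ hx.2
  · rw [← h₂]
    exact hdec n₂ ⟨(hξ.2.trans hx.1).le, hx.2⟩ hx.1
  · rw [← hξ']; exact hanti m₁ mξ hξ.1
  · rw [← hξ']; exact hanti mξ m₂ hξ.2

/-- The zeros of a continuous family with the phase portrait `TwoZeros` depend continuously on the
parameter: `x₁ μ < c < x₂ μ` is the open condition `0 < f c μ`. -/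
theorem continuousOn_zeros {f : ℝ → ℝ → ℝ} {P p q Q : ℝ} {M : Set ℝ} {x₁ x₂ : ℝ → ℝ}
    (hf : ∀ c ∈ Ioo P Q, ContinuousOn (f c) M)
    (H : ∀ μ ∈ M, TwoZeros (fun x => f x μ) P p (x₁ μ) (x₂ μ) q Q) :
    ContinuousOn x₁ M ∧ ContinuousOn x₂ M := by
  have hmid : ∀ c ∈ Ioo P Q, ∀ μ ∈ M, 0 < f c μ → x₁ μ < c ∧ c < x₂ μ := by
    intro c hc μ hμ h
    have h' := H μ hμ
    constructor
    · by_contra! h1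
      rcases h1.eq_or_lt with h1 | h1
      · rw [h1, h'.zero_left] at h; exact lt_irrefl _ h
      · exact lt_asymm h (h'.neg_left c ⟨hc.1, h1⟩)
    · by_contra! h1
      rcases h1.eq_or_lt with h1 | h1
      · rw [← h1, h'.zero_right] at h; exact lt_irrefl _ h
      · exact lt_asymm h (h'.neg_right c ⟨h1, hc.2⟩)
  have hout : ∀ c ∈ Ioo P Q, ∀ μ ∈ M, f c μ < 0 → c < x₁ μ ∨ x₂ μ < c := by
    intro c hc μ hμ h
    have h' := H μ hμ
    by_contra! h1
    rcases h1.1.eq_or_lt with h2 | h2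
    · rw [← h2, h'.zero_left] at h; exact lt_irrefl _ h
    · rcases h1.2.eq_or_lt with h3 | h3
      · rw [h3, h'.zero_right] at h; exact lt_irrefl _ h
      · exact lt_asymm h (h'.pos_mid c ⟨h2, h3⟩)
  have hposev : ∀ c ∈ Ioo P Q, ∀ μ ∈ M, 0 < f c μ → ∀ᶠ σ in 𝓝[M] μ, σ ∈ M ∧ 0 < f c σ :=
    fun c hc μ hμ h =>
      eventually_mem_nhdsWithin.and (((hf c hc) μ hμ).eventually (lt_mem_nhds h))
  have hnegev : ∀ c ∈ Ioo P Q, ∀ μ ∈ M, f c μ < 0 → ∀ᶠ σ in 𝓝[M] μ, σ ∈ M ∧ f c σ < 0 :=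
    fun c hc μ hμ h =>
      eventually_mem_nhdsWithin.and (((hf c hc) μ hμ).eventually (gt_mem_nhds h))
  constructor
  · intro μ hμ
    have h := H μ hμ
    have hP₁ : P < x₁ μ := h.lt_p.trans h.p_lt
    have hQ₂ : x₂ μ < Q := h.lt_q.trans h.q_lt
    obtain ⟨m, hm₁, hm₂⟩ := exists_between h.lt
    have hm : m ∈ Ioo P Q := ⟨hP₁.trans hm₁, hm₂.trans hQ₂⟩
    refine tendsto_order.2 ⟨fun c hc => ?_, fun c hc => ?_⟩
    · obtain ⟨d, hd, hd'⟩ := exists_between (max_lt hc hP₁)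
      rw [max_lt_iff] at hd
      have hdm : d ∈ Ioo P Q := ⟨hd.2, by linarith [h.lt]⟩
      filter_upwards [hnegev d hdm μ hμ (h.neg_left d ⟨hd.2, hd'⟩),
        hposev m hm μ hμ (h.pos_mid m ⟨hm₁, hm₂⟩)] with σ hσ hσ'
      have h1 := (hmid m hm σ hσ'.1 hσ'.2).2
      exact hd.1.trans ((hout d hdm σ hσ.1 hσ.2).resolve_right (by linarith))
    · obtain ⟨d, hd, hd'⟩ := exists_between (lt_min hc h.lt)
      rw [lt_min_iff] at hd'
      have hdm : d ∈ Ioo P Q := ⟨hP₁.trans hd, hd'.2.trans hQ₂⟩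
      filter_upwards [hposev d hdm μ hμ (h.pos_mid d ⟨hd, hd'.2⟩)] with σ hσ
      exact (hmid d hdm σ hσ.1 hσ.2).1.trans hd'.1
  · intro μ hμ
    have h := H μ hμ
    have hP₁ : P < x₁ μ := h.lt_p.trans h.p_lt
    have hQ₂ : x₂ μ < Q := h.lt_q.trans h.q_lt
    obtain ⟨m, hm₁, hm₂⟩ := exists_between h.lt
    have hm : m ∈ Ioo P Q := ⟨hP₁.trans hm₁, hm₂.trans hQ₂⟩
    refine tendsto_order.2 ⟨fun c hc => ?_, fun c hc => ?_⟩
    · obtain ⟨d, hd, hd'⟩ := exists_between (max_lt hc h.lt)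
      rw [max_lt_iff] at hd
      have hdm : d ∈ Ioo P Q := ⟨hP₁.trans hd.2, hd'.trans hQ₂⟩
      filter_upwards [hposev d hdm μ hμ (h.pos_mid d ⟨hd.2, hd'⟩)] with σ hσ
      exact hd.1.trans (hmid d hdm σ hσ.1 hσ.2).2
    · obtain ⟨d, hd, hd'⟩ := exists_between (lt_min hc hQ₂)
      rw [lt_min_iff] at hd'
      have hdm : d ∈ Ioo P Q := ⟨by linarith [h.lt], hd'.2⟩
      filter_upwards [hnegev d hdm μ hμ (h.neg_right d ⟨hd, hd'.2⟩),
        hposev m hm μ hμ (h.pos_mid m ⟨hm₁, hm₂⟩)] with σ hσ hσ'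
      have h1 := (hmid m hm σ hσ'.1 hσ'.2).1
      exact ((hout d hdm σ hσ.1 hσ.2).resolve_left (by linarith)).trans hd'.1

/-! ### Local expansion of the family -/

/-- Partial derivatives in `x` and `μ`, as functions on the plane. -/
theorem exists_partials {n : WithTop ℕ∞} {F : ℝ × ℝ → ℝ} {W : Set (ℝ × ℝ)} (hW : IsOpen W)
    (hF : ContDiffOn ℝ (n + 1) F W) :
    ∃ Fx Fy : ℝ × ℝ → ℝ, ContDiffOn ℝ n Fx W ∧ ContDiffOn ℝ n Fy W ∧
      (∀ z ∈ W, HasDerivAt (fun x => F (x, z.2)) (Fx z) z.1) ∧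
      ∀ z ∈ W, HasDerivAt (fun y => F (z.1, y)) (Fy z) z.2 := by
  have h1 : ContDiffOn ℝ n (fderiv ℝ F) W := hF.fderiv_of_isOpen hW le_rfl
  have hd : ∀ z ∈ W, HasFDerivAt F (fderiv ℝ F z) z := fun z hz =>
    ((hF.differentiableOn (by simp)).differentiableAt (hW.mem_nhds hz)).hasFDerivAt
  refine ⟨fun z => fderiv ℝ F z (1, 0), fun z => fderiv ℝ F z (0, 1), h1.clm_apply contDiffOn_const,
    h1.clm_apply contDiffOn_const, fun z hz => ?_, fun z hz => ?_⟩
  · exact (hd z hz).comp_hasDerivAt z.1 ((hasDerivAt_id z.1).prodMk (hasDerivAt_const z.1 z.2))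
  · exact (hd z hz).comp_hasDerivAt z.2 ((hasDerivAt_const z.2 z.1).prodMk (hasDerivAt_id z.2))

theorem abs_sub_le_of_abs_deriv_le {g g' : ℝ → ℝ} {t B : ℝ}
    (hd : ∀ u, |u| ≤ |t| → HasDerivAt g (g' u) u) (hb : ∀ u, |u| ≤ |t| → |g' u| ≤ B) :
    |g t - g 0| ≤ B * |t| := by
  have := (convex_Icc (-|t|) |t|).norm_image_sub_le_of_norm_hasDerivWithin_le (f := g) (f' := g')
    (C := B) (x := 0) (y := t) (fun u hu => (hd u (abs_le.2 hu)).hasDerivWithinAt)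
    (fun u hu => hb u (abs_le.2 hu)) (abs_le.1 (by simp)) (abs_le.1 le_rfl)
  simpa using this

/-- What the theorem uses of a generic saddle-node family near the origin: monotonicity in `μ`,
concavity in `x`, and the expansions of `f` and of `fx = f_x` with the error terms that correspond
to the weights `1` of `x` and `2` of `μ`. -/
structure LocalExpansion (f : ℝ → ℝ → ℝ) (fx : ℝ × ℝ → ℝ) (δ α β γ b C : ℝ) : Prop where
  δ_pos : 0 < δ
  δ_le : δ ≤ 1
  α_pos : 0 < α
  b_pos : 0 < b
  C_pos : 0 < C
  cont_fx : ContinuousOn fx (Icc (-δ) δ ×ˢ Icc (-δ) δ)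
  hasDeriv : ∀ x ∈ Icc (-δ) δ, ∀ μ ∈ Icc (-δ) δ, HasDerivAt (fun x => f x μ) (fx (x, μ)) x
  anti : ∀ μ ∈ Icc (-δ) δ, StrictAntiOn (fun x => fx (x, μ)) (Icc (-δ) δ)
  mono : ∀ x ∈ Icc (-δ) δ, StrictMonoOn (f x) (Icc (-δ) δ)
  zero : f 0 0 = 0
  fx_zero : fx (0, 0) = 0
  bound_fx : ∀ x ∈ Icc (-δ) δ, ∀ μ ∈ Icc (-δ) δ,
    |fx (x, μ) - (-2 * α * x + 3 * β * x ^ 2 + γ * μ)| ≤ C * (|x| ^ 3 + |x| * |μ| + μ ^ 2)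
  bound_f : ∀ x ∈ Icc (-δ) δ, ∀ μ ∈ Icc (-δ) δ,
    |f x μ - (b * μ - α * x ^ 2 + β * x ^ 3 + γ * x * μ)| ≤
      C * (x ^ 4 + x ^ 2 * |μ| + |x| * μ ^ 2 + μ ^ 2)

theorem exists_localExpansion {f : ℝ → ℝ → ℝ} {W : Set (ℝ × ℝ)} (hW : IsOpen W)
    (h0 : ((0 : ℝ), (0 : ℝ)) ∈ W) (hf : ContDiffOn ℝ 4 (fun p : ℝ × ℝ => f p.1 p.2) W)
    (hgen : IsGeneric f) :
    ∃ fx δ α β γ b C, LocalExpansion f fx δ α β γ b C ∧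
      Icc (-δ) δ ×ˢ Icc (-δ) δ ⊆ W ∧ p₀ f ^ 2 = b * α ∧ a₀ f = β / α ^ 2 := by
  have hf4 : ContDiffOn ℝ (0 + 1 + 1 + 1 + 1) (fun p : ℝ × ℝ => f p.1 p.2) W := by
    convert hf using 1
    norm_num
  obtain ⟨F1, F2, c1, c2, d1, d2⟩ := exists_partials hW hf4
  obtain ⟨F11, F12, c11, c12, d11, d12⟩ := exists_partials hW c1
  obtain ⟨-, F22, -, c22, -, d22⟩ := exists_partials hW c2
  obtain ⟨F111, -, c111, -, d111, -⟩ := exists_partials hW c11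
  obtain ⟨F121, F122, c121, c122, d121, d122⟩ := exists_partials hW c12
  obtain ⟨F1111, -, c1111, -, d1111, -⟩ := exists_partials hW c111
  have hnear : ∀ᶠ x in 𝓝 (0 : ℝ), (x, (0 : ℝ)) ∈ W :=
    (Continuous.tendsto (by fun_prop : Continuous fun x : ℝ => (x, (0 : ℝ))) 0).eventually
      (hW.mem_nhds h0)
  have e1 : deriv (fun x => f x 0) =ᶠ[𝓝 0] fun x => F1 (x, 0) :=
    hnear.mono fun x hx => (d1 _ hx).deriv
  have e2 : deriv (deriv (fun x => f x 0)) =ᶠ[𝓝 0] fun x => F11 (x, 0) :=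
    e1.deriv.trans (hnear.mono fun x hx => (d11 _ hx).deriv)
  have e3 : deriv (deriv (deriv (fun x => f x 0))) =ᶠ[𝓝 0] fun x => F111 (x, 0) :=
    e2.deriv.trans (hnear.mono fun x hx => (d111 _ hx).deriv)
  have i1 : F1 (0, 0) = 0 := by rw [← e1.eq_of_nhds]; exact hgen.f_x
  have i2 : iteratedDeriv 2 (fun x => f x 0) 0 = F11 (0, 0) := by
    rw [iteratedDeriv_succ, iteratedDeriv_one, e2.eq_of_nhds]
  have i3 : iteratedDeriv 3 (fun x => f x 0) 0 = F111 (0, 0) := by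
    rw [iteratedDeriv_succ, iteratedDeriv_succ, iteratedDeriv_one, e3.eq_of_nhds]
  have i4 : deriv (fun μ => f 0 μ) 0 = F2 (0, 0) := (d2 _ h0).deriv
  have hb : 0 < F2 (0, 0) := i4 ▸ hgen.f_mu
  have hα : F11 (0, 0) < 0 := i2 ▸ hgen.f_xx
  have hev : ∀ᶠ z in 𝓝 ((0 : ℝ), (0 : ℝ)), z ∈ W ∧ 0 < F2 z ∧ F11 z < 0 :=
    (show ∀ᶠ z in 𝓝 ((0 : ℝ), (0 : ℝ)), z ∈ W from hW.mem_nhds h0).and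
      (((c2.continuousOn.continuousAt (hW.mem_nhds h0)).eventually (lt_mem_nhds hb)).and
        ((c11.continuousOn.continuousAt (hW.mem_nhds h0)).eventually (gt_mem_nhds hα)))
  obtain ⟨δ', hδ', hball⟩ := Metric.eventually_nhds_iff_ball.1 hev
  set δ := min (δ' / 2) 1 with hδ
  have hδpos : 0 < δ := lt_min (by linarith) one_pos
  have hδlt : δ < δ' := (min_le_left _ _).trans_lt (by linarith)
  have hR : ∀ x μ : ℝ, |x| ≤ δ → |μ| ≤ δ → (x, μ) ∈ W ∧ 0 < F2 (x, μ) ∧ F11 (x, μ) < 0 := by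
    intro x μ hx hμ
    refine hball _ ?_
    rw [Metric.mem_ball, Prod.dist_eq, max_lt_iff]
    simp only [dist_zero_right, Real.norm_eq_abs]
    exact ⟨hx.trans_lt hδlt, hμ.trans_lt hδlt⟩
  have hW' : ∀ x μ : ℝ, |x| ≤ δ → |μ| ≤ δ → (x, μ) ∈ W := fun x μ hx hμ => (hR x μ hx hμ).1
  have hRW : Icc (-δ) δ ×ˢ Icc (-δ) δ ⊆ W := fun z hz =>
    hW' z.1 z.2 (abs_le.2 hz.1) (abs_le.2 hz.2)
  have habs0 : |(0 : ℝ)| ≤ δ := by simpa using hδpos.le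
  have hcomp : IsCompact (Icc (-δ) δ ×ˢ Icc (-δ) δ) := isCompact_Icc.prod isCompact_Icc
  have hbd : ∀ H : ℝ × ℝ → ℝ, ContinuousOn H W →
      ∃ K, ∀ x μ : ℝ, |x| ≤ δ → |μ| ≤ δ → |H (x, μ)| ≤ K := by
    intro H hH
    obtain ⟨K, hK⟩ := hcomp.exists_bound_of_continuousOn (hH.mono hRW)
    exact ⟨K, fun x μ hx hμ => hK (x, μ) ⟨abs_le.1 hx, abs_le.1 hμ⟩⟩
  obtain ⟨K1, hK1⟩ := hbd _ c1111.continuousOn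
  obtain ⟨K2, hK2⟩ := hbd _ c121.continuousOn
  obtain ⟨K3, hK3⟩ := hbd _ c122.continuousOn
  obtain ⟨K4, hK4⟩ := hbd _ c22.continuousOn
  obtain ⟨C, hC1, hC2, hC3, hC4, hC0⟩ : ∃ C, K1 ≤ C ∧ K2 ≤ C ∧ K3 ≤ C ∧ K4 ≤ C ∧ 0 < C :=
    ⟨|K1| + |K2| + |K3| + |K4| + 1, by
      have h1 := le_abs_self K1
      have h2 := le_abs_self K2
      have h3 := le_abs_self K3
      have h4 := le_abs_self K4
      have g1 := abs_nonneg K1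
      have g2 := abs_nonneg K2
      have g3 := abs_nonneg K3
      have g4 := abs_nonneg K4
      refine ⟨?_, ?_, ?_, ?_, ?_⟩ <;> linarith⟩
  -- The expansion of `f_x` comes from repeated integration of bounds on its higher derivatives.
  -- `f` itself is expanded by integrating `f_x` in `x`, so that both expansions share `γ`.
  have b111 : ∀ x, |x| ≤ δ → |F111 (x, 0) - F111 (0, 0)| ≤ C * |x| := fun x hx =>
    abs_sub_le_of_abs_deriv_le (g := fun x => F111 (x, 0))
      (fun u hu => d1111 _ (hW' u 0 (hu.trans hx) habs0))
      fun u hu => (hK1 u 0 (hu.trans hx) habs0).trans hC1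
  have b11 : ∀ x, |x| ≤ δ → |F11 (x, 0) - F11 (0, 0) - F111 (0, 0) * x| ≤ C * |x| ^ 2 := by
    intro x hx
    have := abs_sub_le_of_abs_deriv_le (t := x) (B := C * |x|)
      (g := fun x => F11 (x, 0) - F111 (0, 0) * x) (g' := fun x => F111 (x, 0) - F111 (0, 0))
      (fun u hu => by
        have h1 := (d111 _ (hW' u 0 (hu.trans hx) habs0)).fun_sub
          ((hasDerivAt_id u).const_mul (F111 (0, 0)))
        simpa using h1)
      fun u hu => (b111 u (hu.trans hx)).trans (mul_le_mul_of_nonneg_left hu hC0.le)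
    convert this using 1
    · congr 1; ring
    · ring
  have b1 : ∀ x, |x| ≤ δ →
      |F1 (x, 0) - F11 (0, 0) * x - F111 (0, 0) / 2 * x ^ 2| ≤ C * |x| ^ 3 := by
    intro x hx
    have := abs_sub_le_of_abs_deriv_le (t := x) (B := C * |x| ^ 2)
      (g := fun x => F1 (x, 0) - F11 (0, 0) * x - F111 (0, 0) / 2 * x ^ 2)
      (g' := fun x => F11 (x, 0) - F11 (0, 0) - F111 (0, 0) * x)
      (fun u hu => by
        have h1 := ((d11 _ (hW' u 0 (hu.trans hx) habs0)).fun_sub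
          ((hasDerivAt_id u).const_mul (F11 (0, 0)))).fun_sub
          ((hasDerivAt_pow 2 u).const_mul (F111 (0, 0) / 2))
        refine h1.congr_deriv ?_
        push_cast; ring)
      fun u hu => (b11 u (hu.trans hx)).trans (by gcongr)
    convert this using 1
    · congr 1; simp [i1]
    · ring
  have b12 : ∀ x μ, |x| ≤ δ → |μ| ≤ δ → |F12 (x, μ) - F12 (0, 0)| ≤ C * (|x| + |μ|) := by
    intro x μ hx hμ
    have h1 := abs_sub_le_of_abs_deriv_le (t := x) (B := C) (g := fun x => F12 (x, 0))
      (fun u hu => d121 _ (hW' u 0 (hu.trans hx) habs0))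
      fun u hu => (hK2 u 0 (hu.trans hx) habs0).trans hC2
    have h2 := abs_sub_le_of_abs_deriv_le (t := μ) (B := C) (g := fun μ => F12 (x, μ))
      (fun u hu => d122 _ (hW' x u hx (hu.trans hμ)))
      fun u hu => (hK3 x u hx (hu.trans hμ)).trans hC3
    calc |F12 (x, μ) - F12 (0, 0)|
        = |(F12 (x, μ) - F12 (x, 0)) + (F12 (x, 0) - F12 (0, 0))| := by ring_nf
      _ ≤ C * |μ| + C * |x| := (abs_add_le _ _).trans (add_le_add h2 h1)
      _ = C * (|x| + |μ|) := by ring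
  have b1μ : ∀ x μ, |x| ≤ δ → |μ| ≤ δ →
      |F1 (x, μ) - (F11 (0, 0) * x + F111 (0, 0) / 2 * x ^ 2 + F12 (0, 0) * μ)| ≤
        C * (|x| ^ 3 + |x| * |μ| + μ ^ 2) := by
    intro x μ hx hμ
    have h2 := abs_sub_le_of_abs_deriv_le (t := μ) (B := C * (|x| + |μ|))
      (g := fun μ => F1 (x, μ) - F12 (0, 0) * μ) (g' := fun μ => F12 (x, μ) - F12 (0, 0))
      (fun u hu => by
        have h1 := (d12 _ (hW' x u hx (hu.trans hμ))).fun_sub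
          ((hasDerivAt_id u).const_mul (F12 (0, 0)))
        simpa using h1)
      fun u hu => (b12 x u hx (hu.trans hμ)).trans (by gcongr)
    have h1 := b1 x hx
    calc _ = |(F1 (x, μ) - F12 (0, 0) * μ - (F1 (x, 0) - F12 (0, 0) * 0)) +
          (F1 (x, 0) - F11 (0, 0) * x - F111 (0, 0) / 2 * x ^ 2)| := by congr 1; ring
      _ ≤ C * (|x| + |μ|) * |μ| + C * |x| ^ 3 := (abs_add_le _ _).trans (add_le_add h2 h1)
      _ = C * (|x| ^ 3 + |x| * |μ| + |μ| ^ 2) := by ring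
      _ = _ := by rw [sq_abs]
  have b2 : ∀ μ, |μ| ≤ δ → |F2 (0, μ) - F2 (0, 0)| ≤ C * |μ| := fun μ hμ =>
    abs_sub_le_of_abs_deriv_le (g := fun μ => F2 (0, μ))
      (fun u hu => d22 _ (hW' 0 u habs0 (hu.trans hμ)))
      fun u hu => (hK4 0 u habs0 (hu.trans hμ)).trans hC4
  have b0 : ∀ μ, |μ| ≤ δ → |f 0 μ - F2 (0, 0) * μ| ≤ C * μ ^ 2 := by
    intro μ hμ
    have := abs_sub_le_of_abs_deriv_le (t := μ) (B := C * |μ|)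
      (g := fun μ => f 0 μ - F2 (0, 0) * μ) (g' := fun μ => F2 (0, μ) - F2 (0, 0))
      (fun u hu => by
        have h1 := (d2 _ (hW' 0 u habs0 (hu.trans hμ))).fun_sub
          ((hasDerivAt_id u).const_mul (F2 (0, 0)))
        simpa using h1)
      fun u hu => (b2 u (hu.trans hμ)).trans (mul_le_mul_of_nonneg_left hu hC0.le)
    convert this using 1
    · congr 1; simp [hgen.f_zero]
    · rw [← sq_abs]; ring
  have bf : ∀ x μ, |x| ≤ δ → |μ| ≤ δ →
      |f x μ - (F2 (0, 0) * μ + F11 (0, 0) / 2 * x ^ 2 + F111 (0, 0) / 6 * x ^ 3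
        + F12 (0, 0) * x * μ)| ≤ C * (x ^ 4 + x ^ 2 * |μ| + |x| * μ ^ 2 + μ ^ 2) := by
    intro x μ hx hμ
    have h1 := abs_sub_le_of_abs_deriv_le (t := x) (B := C * (|x| ^ 3 + |x| * |μ| + μ ^ 2))
      (g := fun x => f x μ - (F11 (0, 0) / 2 * x ^ 2 + F111 (0, 0) / 6 * x ^ 3
        + F12 (0, 0) * x * μ))
      (g' := fun x => F1 (x, μ) - (F11 (0, 0) * x + F111 (0, 0) / 2 * x ^ 2 + F12 (0, 0) * μ))
      (fun u hu => by
        have h1 := (d1 _ (hW' u μ (hu.trans hx) hμ)).fun_sub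
          ((((hasDerivAt_pow 2 u).const_mul (F11 (0, 0) / 2)).fun_add
            ((hasDerivAt_pow 3 u).const_mul (F111 (0, 0) / 6))).fun_add
            (((hasDerivAt_id u).const_mul (F12 (0, 0))).mul_const μ))
        refine h1.congr_deriv ?_
        push_cast; ring)
      fun u hu => (b1μ u μ (hu.trans hx) hμ).trans (by gcongr)
    have h2 := b0 μ hμ
    calc _ = |(f x μ - (F11 (0, 0) / 2 * x ^ 2 + F111 (0, 0) / 6 * x ^ 3 + F12 (0, 0) * x * μ)
          - (f 0 μ - (F11 (0, 0) / 2 * 0 ^ 2 + F111 (0, 0) / 6 * 0 ^ 3 + F12 (0, 0) * 0 * μ)))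
          + (f 0 μ - F2 (0, 0) * μ)| := by congr 1; ring
      _ ≤ C * (|x| ^ 3 + |x| * |μ| + μ ^ 2) * |x| + C * μ ^ 2 :=
        (abs_add_le _ _).trans (add_le_add h1 h2)
      _ = C * ((|x| ^ 2) ^ 2 + |x| ^ 2 * |μ| + |x| * μ ^ 2 + μ ^ 2) := by ring
      _ = _ := by rw [sq_abs]; ring
  refine ⟨F1, δ, -(F11 (0, 0) / 2), F111 (0, 0) / 6, F12 (0, 0), F2 (0, 0), C,
    ⟨hδpos, min_le_right _ _, by linarith, hb, hC0, c1.continuousOn.mono hRW,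
      fun x hx μ hμ => d1 (x, μ) (hRW ⟨hx, hμ⟩), fun μ hμ => ?_, fun x hx => ?_, hgen.f_zero, i1,
      fun x hx μ hμ => ?_, fun x hx μ hμ => ?_⟩, hRW, ?_, ?_⟩
  · refine strictAntiOn_of_deriv_neg (convex_Icc _ _) ?_ fun x hx => ?_
    · exact fun x hx => (d11 (x, μ) (hRW ⟨hx, hμ⟩)).continuousAt.continuousWithinAt
    · rw [interior_Icc] at hx
      have hx' := Ioo_subset_Icc_self hx
      rw [(d11 (x, μ) (hRW ⟨hx', hμ⟩)).deriv]
      exact (hR x μ (abs_le.2 hx') (abs_le.2 hμ)).2.2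
  · refine strictMonoOn_of_deriv_pos (convex_Icc _ _) ?_ fun μ hμ => ?_
    · exact fun μ hμ => (d2 (x, μ) (hRW ⟨hx, hμ⟩)).continuousAt.continuousWithinAt
    · rw [interior_Icc] at hμ
      have hμ' := Ioo_subset_Icc_self hμ
      have h1 : deriv (f x) μ = F2 (x, μ) := (d2 (x, μ) (hRW ⟨hx, hμ'⟩)).deriv
      rw [h1]
      exact (hR x μ (abs_le.2 hx) (abs_le.2 hμ')).2.1
  · convert b1μ x μ (abs_le.2 hx) (abs_le.2 hμ) using 2
    ring
  · convert bf x μ (abs_le.2 hx) (abs_le.2 hμ) using 2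
    ring
  · rw [p₀, Real.sq_sqrt, i2, i4]
    · ring
    · rw [i2, i4]; nlinarith
  · rw [a₀, i2, i3]
    have := hα.ne
    field_simp
    ring

/-! ### Asymptotics of the eigenvalues -/

theorem isBigO_sqrt_mul {f g : ℝ → ℝ} {m n k : ℕ} (hk : k ≤ m + n)
    (hf : f =O[𝓝[>] 0] fun μ => √μ ^ m) (hg : g =O[𝓝[>] 0] fun μ => √μ ^ n) :
    (fun μ => f μ * g μ) =O[𝓝[>] 0] fun μ => √μ ^ k := by
  have h := hf.mul hg
  simp only [← pow_add] at h
  exact h.trans (isBigO_sqrt_pow hk)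

theorem isBigO_id_sqrt_sq : (fun μ : ℝ => μ) =O[𝓝[>] 0] fun μ => √μ ^ 2 :=
  sqrt_sq_eventuallyEq.symm.isBigO

namespace LocalExpansion

variable {f : ℝ → ℝ → ℝ} {fx : ℝ × ℝ → ℝ} {δ α β γ b C : ℝ}

/-- The zeros of `f · μ` near the origin are of size `O(√μ)`. -/
theorem sq_le_of_zero (H : LocalExpansion f fx δ α β γ b C) {ε x μ : ℝ} (hεδ : ε ≤ δ)
    (hε : (|β| + 2 * C) * ε ≤ α / 2) (hx : |x| ≤ ε) (hμ0 : 0 < μ) (hμ : μ ≤ ε)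
    (hz : f x μ = 0) : x ^ 2 ≤ 2 * (b + |γ| + 2 * C) / α * μ := by
  have hα := H.α_pos
  have hC := H.C_pos
  have hε1 : ε ≤ 1 := hεδ.trans H.δ_le
  have hε0 : 0 ≤ ε := (abs_nonneg x).trans hx
  have hx1 : |x| ≤ 1 := hx.trans hε1
  have hb := H.bound_f x (abs_le.1 (hx.trans hεδ)) μ ⟨by linarith [H.δ_pos], by linarith⟩
  rw [hz, zero_sub, abs_neg, abs_of_pos hμ0] at hb
  have hb' := (abs_le.1 hb).1
  have t1 : β * x ^ 3 ≤ |β| * ε * x ^ 2 := by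
    calc β * x ^ 3 ≤ |β * x ^ 3| := le_abs_self _
      _ = |β| * (|x| * |x| ^ 2) := by rw [abs_mul, abs_pow]; ring
      _ ≤ |β| * (ε * |x| ^ 2) := by gcongr
      _ = _ := by rw [sq_abs]; ring
  have t2 : γ * x * μ ≤ |γ| * μ := by
    calc γ * x * μ ≤ |γ * x * μ| := le_abs_self _
      _ = |γ| * (|x| * μ) := by rw [abs_mul, abs_mul, abs_of_pos hμ0]; ring
      _ ≤ |γ| * (1 * μ) := by gcongr
      _ = _ := by ring
  have hxε : x ^ 2 ≤ ε := by
    rw [← sq_abs]; nlinarith [abs_nonneg x]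
  have t3 : x ^ 4 ≤ ε * x ^ 2 := by nlinarith [sq_nonneg x]
  have t4 : x ^ 2 * μ ≤ ε * x ^ 2 := by nlinarith [sq_nonneg x]
  have t5 : μ ^ 2 ≤ μ := by nlinarith
  have t6 : |x| * μ ^ 2 ≤ μ := by nlinarith [abs_nonneg x, sq_nonneg μ]
  have t7 : C * (x ^ 4 + x ^ 2 * μ + |x| * μ ^ 2 + μ ^ 2) ≤ C * (2 * ε * x ^ 2 + 2 * μ) :=
    mul_le_mul_of_nonneg_left (by linarith) hC.le
  have t8 : (|β| + 2 * C) * ε * x ^ 2 ≤ α / 2 * x ^ 2 :=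
    mul_le_mul_of_nonneg_right hε (sq_nonneg x)
  have key : α * x ^ 2 ≤ 2 * (b + |γ| + 2 * C) * μ := by nlinarith
  rw [div_mul_eq_mul_div, le_div_iff₀ hα]
  linarith

theorem isBigO_root (H : LocalExpansion f fx δ α β γ b C) {ε μ₀ : ℝ} {x : ℝ → ℝ} (hεδ : ε ≤ δ)
    (hε : (|β| + 2 * C) * ε ≤ α / 2) (hμ₀ : 0 < μ₀) (hμ₀ε : μ₀ ≤ ε)
    (hx : ∀ μ ∈ Ioo 0 μ₀, |x μ| ≤ ε) (hz : ∀ μ ∈ Ioo 0 μ₀, f (x μ) μ = 0) :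
    x =O[𝓝[>] 0] (fun μ => √μ ^ 1) ∧
      (fun μ => b * μ - α * x μ ^ 2 + β * x μ ^ 3 + γ * x μ * μ) =O[𝓝[>] 0] (fun μ => √μ ^ 4) ∧
      (fun μ => fx (x μ, μ) - (-2 * α * x μ + 3 * β * x μ ^ 2 + γ * μ)) =O[𝓝[>] 0]
        fun μ => √μ ^ 3 := by
  have hx1 : x =O[𝓝[>] 0] (fun μ => √μ ^ 1) := by
    refine IsBigO.of_pow two_ne_zero (IsBigO.of_bound (2 * (b + |γ| + 2 * C) / α) ?_)
    filter_upwards [Ioo_mem_nhdsGT hμ₀] with μ hμ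
    have h1 := H.sq_le_of_zero hεδ hε (hx μ hμ) hμ.1 (hμ.2.le.trans hμ₀ε) (hz μ hμ)
    simp only [Pi.pow_apply, pow_one]
    rw [Real.sq_sqrt hμ.1.le, Real.norm_of_nonneg (sq_nonneg _), Real.norm_of_nonneg hμ.1.le]
    exact h1
  have habs : (fun μ => |x μ|) =O[𝓝[>] 0] (fun μ => √μ ^ 1) := hx1.abs_left
  have hμ := isBigO_id_sqrt_sq
  have hμabs : (fun μ : ℝ => |μ|) =O[𝓝[>] 0] (fun μ => √μ ^ 2) := hμ.abs_left
  have hμ2 : (fun μ : ℝ => μ ^ 2) =O[𝓝[>] 0] (fun μ => √μ ^ 4) := by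
    simpa [← pow_mul] using hμ.pow 2
  have hxp : ∀ n : ℕ, (fun μ => x μ ^ n) =O[𝓝[>] 0] fun μ => √μ ^ n := fun n => by
    simpa using hx1.pow n
  have hap : ∀ n : ℕ, (fun μ => |x μ| ^ n) =O[𝓝[>] 0] fun μ => √μ ^ n := fun n => by
    simpa using habs.pow n
  refine ⟨hx1, ?_, ?_⟩
  · have hbd : (fun μ => C * (x μ ^ 4 + x μ ^ 2 * |μ| + |x μ| * μ ^ 2 + μ ^ 2)) =O[𝓝[>] 0]
        fun μ => √μ ^ 4 :=
      (((((hxp 4).add (isBigO_sqrt_mul (by norm_num) (hxp 2) hμabs)).add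
        (isBigO_sqrt_mul (by norm_num) habs hμ2))).add hμ2).const_mul_left C
    refine IsBigO.trans (IsBigO.of_bound 1 ?_) hbd
    filter_upwards [Ioo_mem_nhdsGT hμ₀] with μ hμ
    have h1 := H.bound_f (x μ) (abs_le.1 ((hx μ hμ).trans hεδ)) μ
      ⟨by linarith [H.δ_pos, hμ.1], by linarith [hμ.2]⟩
    rw [hz μ hμ, zero_sub, abs_neg] at h1
    rw [one_mul]
    exact h1.trans (le_abs_self _)
  · have hbd : (fun μ => C * (|x μ| ^ 3 + |x μ| * |μ| + μ ^ 2)) =O[𝓝[>] 0]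
        fun μ => √μ ^ 3 :=
      (((hap 3).add (isBigO_sqrt_mul (by norm_num) habs hμabs)).add
        (hμ2.trans (isBigO_sqrt_pow (by norm_num)))).const_mul_left C
    refine IsBigO.trans (IsBigO.of_bound 1 ?_) hbd
    filter_upwards [Ioo_mem_nhdsGT hμ₀] with μ hμ
    rw [one_mul]
    exact (H.bound_fx (x μ) (abs_le.1 ((hx μ hμ).trans hεδ)) μ
      ⟨by linarith [H.δ_pos, hμ.1], by linarith [hμ.2]⟩).trans (le_abs_self _)

end LocalExpansion

theorem isBigO_sub_of_sq {y : ℝ → ℝ} {κ : ℝ} (hκ : 0 < κ) (hy : ∀ᶠ μ in 𝓝[>] 0, 0 < y μ)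
    (h : (fun μ => y μ ^ 2 - κ ^ 2 * μ) =O[𝓝[>] 0] fun μ => √μ ^ 3) :
    (fun μ => y μ - κ * √μ) =O[𝓝[>] 0] fun μ => √μ ^ 2 := by
  have hinv : (fun μ => (y μ + κ * √μ)⁻¹) =O[𝓝[>] 0] fun μ => (√μ)⁻¹ := by
    refine IsBigO.of_bound κ⁻¹ ?_
    filter_upwards [hy, self_mem_nhdsWithin] with μ h1 h2
    have hs : 0 < √μ := Real.sqrt_pos.2 h2
    have h3 : 0 < κ * √μ := mul_pos hκ hs
    rw [norm_inv, norm_inv, Real.norm_of_nonneg (by linarith), Real.norm_of_nonneg hs.le,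
      ← mul_inv]
    exact inv_anti₀ h3 (by linarith)
  refine (h.mul hinv).congr' ?_ ?_
  · filter_upwards [hy, self_mem_nhdsWithin, sqrt_sq_eventuallyEq] with μ h1 h2 h3
    have hs : 0 < √μ := Real.sqrt_pos.2 h2
    have h4 : y μ + κ * √μ ≠ 0 := (add_pos h1 (mul_pos hκ hs)).ne'
    rw [mul_inv_eq_iff_eq_mul₀ h4]
    linear_combination κ ^ 2 * h3
  · filter_upwards [self_mem_nhdsWithin] with μ hμ
    have : √μ ≠ 0 := (Real.sqrt_pos.2 hμ).ne'
    field_simp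

/-- The eigenvalues `l₁ > 0 > l₂` at the two zeros satisfy `l₁ - l₂ = 4 p √μ + O(μ)` and
`l₁ + l₂ = (a / 4) (l₁ - l₂) ^ 2 + O(μ ^ (3 / 2))`. For the second relation, the difference of the
equations `f = 0` at the two zeros, divided by their distance, gives the sum of the zeros. -/
theorem LocalExpansion.isBigO_eigenvalues {f : ℝ → ℝ → ℝ} {fx : ℝ × ℝ → ℝ}
    {δ α β γ b C ε μ₀ p : ℝ} {x₁ x₂ : ℝ → ℝ} (H : LocalExpansion f fx δ α β γ b C) (hεδ : ε ≤ δ)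
    (hε : (|β| + 2 * C) * ε ≤ α / 2) (hμ₀ : 0 < μ₀) (hμ₀ε : μ₀ ≤ ε) (hp : 0 < p)
    (hpsq : p ^ 2 = b * α)
    (hx₁ : ∀ μ ∈ Ioo 0 μ₀, |x₁ μ| ≤ ε) (hz₁ : ∀ μ ∈ Ioo 0 μ₀, f (x₁ μ) μ = 0)
    (hx₂ : ∀ μ ∈ Ioo 0 μ₀, |x₂ μ| ≤ ε) (hz₂ : ∀ μ ∈ Ioo 0 μ₀, f (x₂ μ) μ = 0)
    (hneg : ∀ μ ∈ Ioo 0 μ₀, x₁ μ < 0) (hpos : ∀ μ ∈ Ioo 0 μ₀, 0 < x₂ μ) :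
    (fun μ => (fx (x₁ μ, μ) - fx (x₂ μ, μ)) - 4 * p * √μ) =O[𝓝[>] 0] (fun μ => √μ ^ 2) ∧
      (fun μ => (fx (x₁ μ, μ) + fx (x₂ μ, μ)) -
        β / α ^ 2 / 4 * (fx (x₁ μ, μ) - fx (x₂ μ, μ)) ^ 2) =O[𝓝[>] 0] fun μ => √μ ^ 3 := by
  have hα := H.α_pos
  obtain ⟨r₁, e₁, g₁⟩ := H.isBigO_root hεδ hε hμ₀ hμ₀ε hx₁ hz₁
  obtain ⟨r₂, e₂, g₂⟩ := H.isBigO_root hεδ hε hμ₀ hμ₀ε hx₂ hz₂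
  obtain ⟨κ, hκ⟩ : ∃ κ, κ = p / α := ⟨_, rfl⟩
  have hκ0 : 0 < κ := hκ ▸ div_pos hp hα
  have hκp : α * κ = p := by rw [hκ]; field_simp
  have hκb : α * κ ^ 2 = b := by
    have : α * (α * κ ^ 2) = α * b := by rw [mul_comm α b, ← hpsq, ← hκp]; ring
    exact mul_left_cancel₀ hα.ne' this
  have hμ := isBigO_id_sqrt_sq
  have hsq : ∀ x : ℝ → ℝ, x =O[𝓝[>] 0] (fun μ => √μ ^ 1) →
      (fun μ => b * μ - α * x μ ^ 2 + β * x μ ^ 3 + γ * x μ * μ) =O[𝓝[>] 0]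
        (fun μ => √μ ^ 4) →
      (fun μ => x μ ^ 2 - κ ^ 2 * μ) =O[𝓝[>] 0] fun μ => √μ ^ 3 := by
    intro x r e
    have h3 : (fun μ => x μ ^ 3) =O[𝓝[>] 0] fun μ => √μ ^ 3 := by simpa using r.pow 3
    have h4 : (fun μ => x μ * μ) =O[𝓝[>] 0] fun μ => √μ ^ 3 := isBigO_sqrt_mul le_rfl r hμ
    have h5 := (((h3.const_mul_left β).add (h4.const_mul_left γ)).sub
      (e.trans (isBigO_sqrt_pow (by norm_num : 3 ≤ 4)))).const_mul_left α⁻¹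
    refine h5.congr_left fun μ => ?_
    rw [← hκb]
    field_simp
    ring
  have s₁ := hsq x₁ r₁ e₁
  have s₂ := hsq x₂ r₂ e₂
  have d₂ := isBigO_sub_of_sq hκ0 (by filter_upwards [Ioo_mem_nhdsGT hμ₀] with μ h using hpos μ h)
    s₂
  have d₁ := isBigO_sub_of_sq (y := fun μ => -x₁ μ) hκ0
    (by filter_upwards [Ioo_mem_nhdsGT hμ₀] with μ h using neg_pos.2 (hneg μ h))
    (s₁.congr_left fun μ => by ring)
  have hgap : (fun μ => (x₂ μ - x₁ μ) - 2 * κ * √μ) =O[𝓝[>] 0] fun μ => √μ ^ 2 :=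
    (d₂.add d₁).congr_left fun μ => by ring
  obtain ⟨hgpos, hgO, hginv⟩ := comparable_of_isBigO (by positivity) hgap
  have hgO1 : (fun μ => x₂ μ - x₁ μ) =O[𝓝[>] 0] fun μ => √μ ^ 1 := by simpa using hgO
  -- The equations `f = 0` at the two zeros, subtracted and divided by `x₂ - x₁`.
  have hT : (fun μ => α * (x₁ μ + x₂ μ) - β * (x₁ μ ^ 2 + x₁ μ * x₂ μ + x₂ μ ^ 2) - γ * μ)
      =O[𝓝[>] 0] fun μ => √μ ^ 3 := by
    refine ((e₁.sub e₂).mul hginv).congr' ?_ ?_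
    · filter_upwards [hgpos] with μ h
      rw [mul_inv_eq_iff_eq_mul₀ h.ne']
      ring
    · filter_upwards [self_mem_nhdsWithin] with μ hμ
      have : √μ ≠ 0 := (Real.sqrt_pos.2 hμ).ne'
      field_simp
  have hD : (fun μ => (fx (x₁ μ, μ) - fx (x₂ μ, μ)) - 2 * α * (x₂ μ - x₁ μ)) =O[𝓝[>] 0]
      fun μ => √μ ^ 3 :=
    (((s₁.sub s₂).const_mul_left (3 * β)).add (g₁.sub g₂)).congr_left fun μ => by ring
  refine ⟨?_, ?_⟩
  · refine ((hD.trans (isBigO_sqrt_pow (by norm_num : 2 ≤ 3))).add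
      (hgap.const_mul_left (2 * α))).congr_left fun μ => ?_
    rw [← hκp]; ring
  · have hgD := isBigO_sqrt_mul (k := 3) (by norm_num) hgO1 hD
    have hDD := isBigO_sqrt_mul (k := 3) (by norm_num) hD hD
    refine (((g₁.add g₂).sub (hT.const_mul_left 2)).sub
      (((hgD.const_mul_left (4 * α)).add hDD).const_mul_left (β / α ^ 2 / 4))).congr_left
      fun μ => ?_
    field_simp
    ring

namespace LocalExpansion

variable {f : ℝ → ℝ → ℝ} {fx : ℝ × ℝ → ℝ} {δ α β γ b C : ℝ}

theorem neg_of_ne_zero (H : LocalExpansion f fx δ α β γ b C) {x : ℝ} (hx : x ∈ Icc (-δ) δ)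
    (hx0 : x ≠ 0) : f x 0 < 0 := by
  have hδ := H.δ_pos
  have h0 : (0 : ℝ) ∈ Icc (-δ) δ := ⟨by linarith, hδ.le⟩
  have hder := fun y hy => H.hasDeriv y hy 0 h0
  have hcont : ContinuousOn (fun x => f x 0) (Icc (-δ) δ) := fun y hy =>
    (hder y hy).continuousAt.continuousWithinAt
  rcases lt_or_gt_of_ne hx0 with h | h
  · have hmono : StrictMonoOn (fun x => f x 0) (Icc (-δ) 0) := by
      refine strictMonoOn_of_deriv_pos (convex_Icc _ _)
        (hcont.mono (Icc_subset_Icc_right hδ.le)) fun y hy => ?_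
      rw [interior_Icc] at hy
      have hy' : y ∈ Icc (-δ) δ := ⟨hy.1.le, by linarith [hy.2]⟩
      rw [(hder y hy').deriv]
      simpa [H.fx_zero] using H.anti 0 h0 hy' h0 hy.2
    have := hmono ⟨hx.1, h.le⟩ ⟨by linarith, le_rfl⟩ h
    simpa [H.zero] using this
  · have hanti : StrictAntiOn (fun x => f x 0) (Icc 0 δ) := by
      refine strictAntiOn_of_deriv_neg (convex_Icc _ _)
        (hcont.mono (Icc_subset_Icc_left (by linarith))) fun y hy => ?_
      rw [interior_Icc] at hy
      have hy' : y ∈ Icc (-δ) δ := ⟨by linarith [hy.1], hy.2.le⟩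
      rw [(hder y hy').deriv]
      simpa [H.fx_zero] using H.anti 0 h0 h0 hy' hy.1
    have := hanti ⟨le_rfl, hδ.le⟩ ⟨h.le, hx.2⟩ h
    simpa [H.zero] using this

theorem neg_of_neg (H : LocalExpansion f fx δ α β γ b C) {x μ : ℝ} (hx : x ∈ Icc (-δ) δ)
    (hμ : μ ∈ Ico (-δ) 0) : f x μ < 0 := by
  have hδ := H.δ_pos
  have h1 : f x μ < f x 0 :=
    H.mono x hx ⟨hμ.1, by linarith [hμ.2]⟩ ⟨by linarith, hδ.le⟩ hμ.2
  rcases eq_or_ne x 0 with rfl | h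
  · rwa [H.zero] at h1
  · exact h1.trans (H.neg_of_ne_zero hx h)

theorem abs_le (H : LocalExpansion f fx δ α β γ b C) {x μ : ℝ} (hx : x ∈ Icc (-δ) δ)
    (hμ : μ ∈ Icc (-δ) δ) : |f x μ| ≤ (b + α + |β| + |γ| + 4 * C) * (|x| + |μ|) := by
  have hα := H.α_pos
  have hb := H.b_pos
  have hC := H.C_pos
  have hx1 : |x| ≤ 1 := (_root_.abs_le.2 hx).trans H.δ_le
  have hμ1 : |μ| ≤ 1 := (_root_.abs_le.2 hμ).trans H.δ_le
  have hx0 := abs_nonneg x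
  have hμ0 := abs_nonneg μ
  have h1 := H.bound_f x hx μ hμ
  have q2 : x ^ 2 ≤ |x| + |μ| := by rw [← sq_abs]; nlinarith
  have q3 : |x| ^ 3 ≤ |x| + |μ| := by
    have := pow_le_of_le_one hx0 hx1 (n := 3) (by norm_num); linarith
  have q4 : x ^ 4 ≤ |x| + |μ| := by
    have := pow_le_of_le_one hx0 hx1 (n := 4) (by norm_num)
    rw [show x ^ 4 = (x ^ 2) ^ 2 by ring, ← sq_abs x]
    rw [show (|x| ^ 2) ^ 2 = |x| ^ 4 by ring]
    linarith
  have q5 : |x| * |μ| ≤ |x| + |μ| := by nlinarith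
  have q6 : x ^ 2 * |μ| ≤ |x| + |μ| := by
    rw [← sq_abs]; nlinarith [mul_le_one₀ hx1 hx0 hx1]
  have q7 : μ ^ 2 ≤ |x| + |μ| := by rw [← sq_abs]; nlinarith
  have q8 : |x| * μ ^ 2 ≤ |x| + |μ| := by
    rw [← sq_abs μ]; nlinarith [mul_le_one₀ hμ1 hμ0 hμ1]
  have h2 : C * (x ^ 4 + x ^ 2 * |μ| + |x| * μ ^ 2 + μ ^ 2) ≤ C * (4 * (|x| + |μ|)) :=
    mul_le_mul_of_nonneg_left (by linarith) hC.le
  have h3 : |b * μ - α * x ^ 2 + β * x ^ 3 + γ * x * μ| ≤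
      b * (|x| + |μ|) + α * (|x| + |μ|) + |β| * (|x| + |μ|) + |γ| * (|x| + |μ|) := by
    have p1 : |b * μ| ≤ b * (|x| + |μ|) := by
      rw [abs_mul, abs_of_pos hb]; gcongr; linarith
    have p2 : |α * x ^ 2| ≤ α * (|x| + |μ|) := by
      rw [abs_mul, abs_of_pos hα, abs_of_nonneg (sq_nonneg x)]; gcongr
    have p3 : |β * x ^ 3| ≤ |β| * (|x| + |μ|) := by
      rw [abs_mul, abs_pow]; gcongr
    have p4 : |γ * x * μ| ≤ |γ| * (|x| + |μ|) := by
      rw [mul_assoc, abs_mul, abs_mul]; gcongr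
    exact (abs_add_le _ _).trans (add_le_add ((abs_add_le _ _).trans (add_le_add
      ((abs_sub _ _).trans (add_le_add p1 p2)) p3)) p4)
  calc |f x μ| = |(f x μ - (b * μ - α * x ^ 2 + β * x ^ 3 + γ * x * μ))
        + (b * μ - α * x ^ 2 + β * x ^ 3 + γ * x * μ)| := by ring_nf
    _ ≤ _ := (abs_add_le _ _).trans (add_le_add (h1.trans h2) h3)
    _ = _ := by ring

end LocalExpansion

/-! ### Conjugacies on both sides of the bifurcation -/

/-- Negative parameters: `f · μ` and the normal form have no zeros, and `ν` is determined by
equality of the transit times. -/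
theorem exists_conjugate_of_neg {k : ℕ∞} (hk : 1 ≤ k) {f : ℝ → ℝ → ℝ} {fx : ℝ × ℝ → ℝ}
    {δ α β γ b C u₀ u₁ v₀ v₁ μ₀ A : ℝ} (H : LocalExpansion f fx δ α β γ b C)
    (hf : ContDiffOn ℝ k (fun p : ℝ × ℝ => f p.1 p.2) (Icc (-δ) δ ×ˢ Icc (-δ) δ))
    (hu₀ : u₀ < 0) (hu₁ : 0 < u₁) (hu₀δ : -δ ≤ u₀) (hu₁δ : u₁ ≤ δ) (hv₀ : v₀ < 0) (hv₁ : 0 < v₁)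
    (hA : ∀ y ∈ Icc v₀ v₁, A * |y| ≤ 1) (hμ₀ : 0 < μ₀) (hμ₀δ : μ₀ ≤ δ) (a : ℝ) :
    ∃ ν : ℝ → ℝ, ContinuousOn ν (Ioo (-μ₀) 0) ∧
      (|a| ≤ A → Tendsto ν (𝓝[<] 0) (𝓝 0)) ∧
      ∀ μ ∈ Ioo (-μ₀) 0,
        Conjugate k (fun x => f x μ) (Ioo u₀ u₁) (normalForm (ν μ) a) (Ioo v₀ v₁) := by
  have hu : u₀ < u₁ := hu₀.trans hu₁
  have hv : v₀ < v₁ := hv₀.trans hv₁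
  have hUδ : Icc u₀ u₁ ⊆ Icc (-δ) δ := Icc_subset_Icc hu₀δ hu₁δ
  have hMδ : Ioo (-μ₀) 0 ⊆ Icc (-δ) δ := fun μ hμ =>
    ⟨by linarith [hμ.1], by linarith [hμ.2, H.δ_pos]⟩
  have hneg : ∀ μ ∈ Ioo (-μ₀) 0, ∀ x ∈ Icc u₀ u₁, f x μ < 0 := fun μ hμ x hx =>
    H.neg_of_neg (hUδ hx) ⟨by linarith [hμ.1], hμ.2⟩
  have hslice : ∀ μ ∈ Ioo (-μ₀) 0, ContDiffOn ℝ k (fun x => f x μ) (Icc u₀ u₁) := fun μ hμ =>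
    hf.comp (contDiff_id.prodMk contDiff_const).contDiffOn fun x hx => ⟨hUδ hx, hMδ hμ⟩
  let τ : ℝ → ℝ := fun μ => transitTime (fun x => f x μ) u₀ u₁
  have hτpos : ∀ μ ∈ Ioo (-μ₀) 0, τ μ ∈ Ioi (0 : ℝ) := by
    intro μ hμ
    refine intervalIntegral.intervalIntegral_pos_of_pos_on ?_ (fun x hx => ?_) hu
    · apply ContinuousOn.intervalIntegrable
      rw [uIcc_of_le hu.le]
      exact (hslice μ hμ).continuousOn.neg.inv₀ fun x hx => (neg_pos.2 (hneg μ hμ x hx)).ne'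
    · exact inv_pos.2 (neg_pos.2 (hneg μ hμ x (Ioo_subset_Icc_self hx)))
  have hτc : ContinuousOn τ (Ioo (-μ₀) 0) := by
    refine continuousOn_parametric_integral hu.le (Φ := fun μ x => (-f x μ)⁻¹) ?_
    refine ContinuousOn.inv₀ (ContinuousOn.neg ?_) fun z hz =>
      (neg_pos.2 (hneg z.1 hz.1 z.2 hz.2)).ne'
    exact hf.continuousOn.comp (f := fun z : ℝ × ℝ => (z.2, z.1)) (by fun_prop)
      fun z hz => ⟨hUδ hz.2, hMδ hz.1⟩
  have hτtop : Tendsto τ (𝓝[<] 0) atTop := by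
    refine tendsto_atTop.2 fun M => ?_
    have hK : 0 < b + α + |β| + |γ| + 4 * C := by
      have := H.b_pos
      have := H.α_pos
      have := H.C_pos
      positivity
    obtain ⟨ε, hε, h⟩ := exists_le_integral_inv hu (⟨hu₀.le, hu₁.le⟩ : (0 : ℝ) ∈ Icc u₀ u₁) hK M
    filter_upwards [Ioo_mem_nhdsLT (neg_lt_zero.2 hμ₀), Ioo_mem_nhdsLT (neg_lt_zero.2 hε)]
      with μ hμ hμε
    refine h (fun x => -f x μ) (hslice μ hμ).continuousOn.neg
      (fun x hx => neg_pos.2 (hneg μ hμ x hx)) fun x hx => ?_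
    rw [sub_zero]
    refine ((neg_le_abs _).trans (H.abs_le (hUδ hx) (hMδ hμ))).trans ?_
    have : |μ| ≤ ε := by rw [abs_of_neg hμ.2]; linarith [hμε.1]
    gcongr
  let w : ℝ → ℝ := fun y => y ^ 2 - a * y ^ 3
  have hwd : ContDiff ℝ 1 w := by fun_prop
  have hwc : ContinuousOn w (Icc v₀ v₁) := hwd.continuous.continuousOn
  obtain ⟨y₀, hy₀, hmin⟩ := isCompact_Icc.exists_isMinOn (nonempty_Icc.2 hv.le) hwc
  obtain ⟨K, hK⟩ := hwd.contDiffOn.exists_lipschitzOnWith (s := Icc v₀ v₁) one_ne_zero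
    (convex_Icc _ _) isCompact_Icc
  have hKpos : (0 : ℝ) < K + 1 := by positivity
  obtain ⟨N, hNc, hNtop, hN⟩ := exists_inverse_transitTime hv hy₀ hwc
    (fun y hy => hmin hy) hKpos fun y hy => by
      have h1 := hK.dist_le_mul y hy y₀ hy₀
      rw [Real.dist_eq, Real.dist_eq] at h1
      have h2 := abs_nonneg (y - y₀)
      linarith [le_abs_self (w y - w y₀)]
  have hNF : ∀ ν, (fun y => ν - w y) = normalForm ν a := fun ν => by
    funext y; simp only [w, normalForm]; ring
  refine ⟨fun μ => N (τ μ), hNc.comp hτc hτpos, fun ha => ?_, fun μ hμ => ?_⟩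
  · have hw0 : w y₀ = 0 := by
      apply le_antisymm
      · simpa [w] using hmin (⟨hv₀.le, hv₁.le⟩ : (0 : ℝ) ∈ Icc v₀ v₁)
      · have h1 : a * y₀ ≤ 1 := (le_abs_self _).trans (by
          rw [abs_mul]
          exact (mul_le_mul_of_nonneg_right ha (abs_nonneg _)).trans (hA y₀ hy₀))
        have h2 : w y₀ = y₀ ^ 2 * (1 - a * y₀) := by simp only [w]; ring
        rw [h2]
        exact mul_nonneg (sq_nonneg _) (by linarith)
    rw [hw0] at hNtop
    exact hNtop.comp hτtop
  · obtain ⟨hN1, hN2⟩ := hN (τ μ) (hτpos μ hμ)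
    rw [hNF] at hN2
    refine conjugate_of_transitTime_eq hk hu (hslice μ hμ).continuousOn
      ((hslice μ hμ).mono Ioo_subset_Icc_self) (hneg μ hμ) hv
      (contDiff_normalForm (n := 1) _ _).continuous.continuousOn
      (contDiff_normalForm _ _).contDiffOn (fun y hy => ?_) hN2.symm
    have h1 : w y₀ ≤ w y := hmin hy
    rw [← hNF]
    simp only
    linarith

/-- Positive parameters: `ν` and `a` are determined by equality of the eigenvalues at the two
zeros, and the linearisations of both fields there give the conjugacies on the basins. -/
theorem exists_conjugate_of_pos {k : ℕ∞} (hk : 2 ≤ k) {f : ℝ → ℝ → ℝ} {fx : ℝ × ℝ → ℝ}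
    {δ α β γ b C ε p u₀ u₁ v₀ v₁ : ℝ} (H : LocalExpansion f fx δ α β γ b C)
    (hf : ContDiffOn ℝ k (fun p : ℝ × ℝ => f p.1 p.2) (Icc (-δ) δ ×ˢ Icc (-δ) δ))
    (hp : 0 < p) (hpsq : p ^ 2 = b * α) (hεδ : ε < δ) (hε : (|β| + 2 * C) * ε ≤ α / 2)
    (hu₀ : u₀ < 0) (hu₁ : 0 < u₁) (hu₀ε : -ε < u₀) (hu₁ε : u₁ < ε) (hv₀ : v₀ < 0) (hv₁ : 0 < v₁)
    (hv : ∀ y ∈ Ioo (2 * v₀) (2 * v₁), (|β / α ^ 2| + 1) * |y| ≤ 1 / 3) :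
    ∃ μ₀ > 0, ∃ ν a : ℝ → ℝ, ContinuousOn ν (Ioo 0 μ₀) ∧ ContinuousOn a (Ioo 0 μ₀) ∧
      (fun μ => ν μ - p ^ 2 * μ) =O[𝓝[>] 0] (fun μ => √μ ^ 3) ∧
      (fun μ => a μ - β / α ^ 2) =O[𝓝[>] 0] (fun μ => √μ) ∧
      ∀ μ ∈ Ioo 0 μ₀, ∃ x₁ x₂ y₁ y₂ : ℝ, x₁ < x₂ ∧ y₁ < y₂ ∧
        {x ∈ Ioo u₀ u₁ | f x μ = 0} = {x₁, x₂} ∧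
        {y ∈ Ioo v₀ v₁ | normalForm (ν μ) (a μ) y = 0} = {y₁, y₂} ∧
        0 < deriv (fun x => f x μ) x₁ ∧
        deriv (fun x => f x μ) x₁ = deriv (normalForm (ν μ) (a μ)) y₁ ∧
        deriv (fun x => f x μ) x₂ < 0 ∧
        deriv (fun x => f x μ) x₂ = deriv (normalForm (ν μ) (a μ)) y₂ ∧
        Conjugate k
          (fun x => f x μ) (basinOfRepulsion (fun x => f x μ) (Ioo u₀ u₁) x₁)
          (normalForm (ν μ) (a μ))
          (basinOfRepulsion (normalForm (ν μ) (a μ)) (Ioo v₀ v₁) y₁) ∧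
        Conjugate k
          (fun x => f x μ) (basinOfAttraction (fun x => f x μ) (Ioo u₀ u₁) x₂)
          (normalForm (ν μ) (a μ))
          (basinOfAttraction (normalForm (ν μ) (a μ)) (Ioo v₀ v₁) y₂) := by
  have hδ := H.δ_pos
  have hεpos : 0 < ε := hu₁.trans hu₁ε
  have h0 : (0 : ℝ) ∈ Icc (-δ) δ := ⟨by linarith, hδ.le⟩
  have hmu₀ : u₀ ∈ Icc (-δ) δ := ⟨by linarith, by linarith⟩
  have hmu₁ : u₁ ∈ Icc (-δ) δ := ⟨by linarith, by linarith⟩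
  have hcol : ∀ x ∈ Icc (-δ) δ, ContinuousOn (f x) (Icc (-δ) δ) := fun x hx =>
    hf.continuousOn.comp (f := fun μ : ℝ => (x, μ)) (by fun_prop) fun μ hμ => ⟨hx, hμ⟩
  have hend : ∀ x ∈ Icc (-δ) δ, x ≠ 0 → ∀ᶠ μ in 𝓝 (0 : ℝ), f x μ < 0 := fun x hx hx0 =>
    ((hcol x hx).continuousAt (Icc_mem_nhds (by linarith) hδ)).eventually
      (gt_mem_nhds (H.neg_of_ne_zero hx hx0))
  obtain ⟨μ₁, hμ₁, hball⟩ := Metric.eventually_nhds_iff_ball.1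
    ((hend u₀ hmu₀ hu₀.ne).and (hend u₁ hmu₁ hu₁.ne'))
  rw [Real.ball_eq_Ioo, zero_sub, zero_add] at hball
  obtain ⟨μ₂, hμ₂def⟩ : ∃ μ₂, μ₂ = min μ₁ ε := ⟨_, rfl⟩
  have hμ₂ : 0 < μ₂ := hμ₂def ▸ lt_min hμ₁ hεpos
  have hμ₂ε : μ₂ ≤ ε := hμ₂def ▸ min_le_right _ _
  have hμ₂₁ : μ₂ ≤ μ₁ := hμ₂def ▸ min_le_left _ _
  have hM : Ioo 0 μ₂ ⊆ Icc (-δ) δ := fun μ hμ => ⟨by linarith [hμ.1], by linarith [hμ.2]⟩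
  have hslice : ∀ μ ∈ Ioo 0 μ₂, ContDiffOn ℝ k (fun x => f x μ) (Ioo (-δ) δ) := fun μ hμ =>
    hf.comp (contDiff_id.prodMk contDiff_const).contDiffOn
      fun x hx => ⟨Ioo_subset_Icc_self hx, hM hμ⟩
  have hex : ∀ μ ∈ Ioo 0 μ₂, ∃ x₁ x₂, x₁ < 0 ∧ 0 < x₂ ∧
      TwoZeros (fun x => f x μ) (-δ) u₀ x₁ x₂ u₁ δ := by
    intro μ hμ
    have hder := fun x (hx : x ∈ Ioo (-δ) δ) => H.hasDeriv x (Ioo_subset_Icc_self hx) μ (hM hμ)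
    have hb := hball μ ⟨by linarith [hμ.1], by linarith [hμ.2]⟩
    refine exists_twoZeros (by linarith) hu₀ hu₁ (by linarith)
      (fun x hx => (hder x hx).differentiableAt.differentiableWithinAt) ?_ hb.1 ?_ hb.2
    · intro x hx y hy hxy
      rw [(hder x hx).deriv, (hder y hy).deriv]
      exact H.anti μ (hM hμ) (Ioo_subset_Icc_self hx) (Ioo_subset_Icc_self hy) hxy
    · have := H.mono 0 h0 h0 (hM hμ) hμ.1
      rwa [H.zero] at this
  choose! x₁ x₂ hx₁ hx₂ hTZ using hex
  obtain ⟨hc₁, hc₂⟩ := continuousOn_zeros (M := Ioo 0 μ₂)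
    (fun c hc => (hcol c (Ioo_subset_Icc_self hc)).mono hM) hTZ
  have hm₁ : ∀ μ ∈ Ioo 0 μ₂, x₁ μ ∈ Icc (-δ) δ := fun μ hμ =>
    ⟨by linarith [(hTZ μ hμ).p_lt], by linarith [hx₁ μ hμ]⟩
  have hm₂ : ∀ μ ∈ Ioo 0 μ₂, x₂ μ ∈ Icc (-δ) δ := fun μ hμ =>
    ⟨by linarith [hx₂ μ hμ], by linarith [(hTZ μ hμ).lt_q]⟩
  let l₁ : ℝ → ℝ := fun μ => fx (x₁ μ, μ)
  let l₂ : ℝ → ℝ := fun μ => fx (x₂ μ, μ)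
  have hl₁ : ∀ μ ∈ Ioo 0 μ₂, deriv (fun x => f x μ) (x₁ μ) = l₁ μ := fun μ hμ =>
    (H.hasDeriv _ (hm₁ μ hμ) μ (hM hμ)).deriv
  have hl₂ : ∀ μ ∈ Ioo 0 μ₂, deriv (fun x => f x μ) (x₂ μ) = l₂ μ := fun μ hμ =>
    (H.hasDeriv _ (hm₂ μ hμ) μ (hM hμ)).deriv
  have hl₁pos : ∀ μ ∈ Ioo 0 μ₂, 0 < l₁ μ := fun μ hμ => hl₁ μ hμ ▸ (hTZ μ hμ).deriv_left
  have hl₂neg : ∀ μ ∈ Ioo 0 μ₂, l₂ μ < 0 := fun μ hμ => hl₂ μ hμ ▸ (hTZ μ hμ).deriv_right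
  have hl : ∀ μ ∈ Ioo 0 μ₂, l₂ μ < l₁ μ := fun μ hμ => (hl₂neg μ hμ).trans (hl₁pos μ hμ)
  have hl₁c : ContinuousOn l₁ (Ioo 0 μ₂) :=
    H.cont_fx.comp (hc₁.prodMk continuousOn_id) fun μ hμ => ⟨hm₁ μ hμ, hM hμ⟩
  have hl₂c : ContinuousOn l₂ (Ioo 0 μ₂) :=
    H.cont_fx.comp (hc₂.prodMk continuousOn_id) fun μ hμ => ⟨hm₂ μ hμ, hM hμ⟩
  obtain ⟨hdiff, hsum⟩ := H.isBigO_eigenvalues hεδ.le hε hμ₂ hμ₂ε hp hpsq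
    (fun μ hμ => abs_le.2 ⟨by linarith [(hTZ μ hμ).p_lt], by linarith [hx₁ μ hμ]⟩)
    (fun μ hμ => (hTZ μ hμ).zero_left)
    (fun μ hμ => abs_le.2 ⟨by linarith [hx₂ μ hμ], by linarith [(hTZ μ hμ).lt_q]⟩)
    (fun μ hμ => (hTZ μ hμ).zero_right) hx₁ hx₂
  have hdiff' : (fun μ => (l₁ μ - l₂ μ) - 4 * p * √μ) =O[𝓝[>] 0] fun μ => √μ ^ 2 := hdiff
  have hν := isBigO_paramNu hdiff' hp hsum
  have ha := isBigO_paramA hdiff' hp hsum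
  have hgap := tendsto_halfGap hdiff' hp hsum
  have hatend := ha.trans_tendsto tendsto_sqrt_nhdsGT_zero
  have hev : ∀ᶠ μ in 𝓝[>] (0 : ℝ), |paramA (l₁ μ) (l₂ μ) - β / α ^ 2| < 1 ∧
      halfGap (l₁ μ) (l₂ μ) < min (-v₀ / 2) (v₁ / 2) := by
    refine Eventually.and ?_ (hgap.eventually (gt_mem_nhds (lt_min (by linarith) (by linarith))))
    have := hatend.abs
    rw [abs_zero] at this
    exact this.eventually (gt_mem_nhds one_pos)
  obtain ⟨μ₃, hμ₃, hsub⟩ := mem_nhdsGT_iff_exists_Ioo_subset.1 hev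
  obtain ⟨μ₀, hμ₀def⟩ : ∃ μ₀, μ₀ = min μ₂ μ₃ := ⟨_, rfl⟩
  have h₂ : Ioo 0 μ₀ ⊆ Ioo 0 μ₂ := Ioo_subset_Ioo_right (hμ₀def ▸ min_le_left _ _)
  have h₃ : Ioo 0 μ₀ ⊆ Ioo 0 μ₃ := Ioo_subset_Ioo_right (hμ₀def ▸ min_le_right _ _)
  refine ⟨μ₀, hμ₀def ▸ lt_min hμ₂ hμ₃, fun μ => paramNu (l₁ μ) (l₂ μ),
    fun μ => paramA (l₁ μ) (l₂ μ), (continuousOn_paramNu hl₁c hl₂c hl).mono h₂,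
    (continuousOn_paramA hl₁c hl₂c hl).mono h₂, hν, ha, fun μ hμ => ?_⟩
  have hμ₂' := h₂ hμ
  obtain ⟨ha1, hgap1⟩ := hsub (h₃ hμ)
  rw [lt_min_iff] at hgap1
  have habound : |paramA (l₁ μ) (l₂ μ)| ≤ |β / α ^ 2| + 1 := by
    have := abs_sub_abs_le_abs_sub (paramA (l₁ μ) (l₂ μ)) (β / α ^ 2)
    linarith
  have hT := hTZ μ hμ₂'
  have hT' := twoZeros_normalForm (hl₁pos μ hμ₂') (hl₂neg μ hμ₂')
    (by linarith : 2 * v₀ < v₀) (by linarith [hgap1.1]) (by linarith [hgap1.2])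
    (by linarith : v₁ < 2 * v₁) (fun y hy => by
      rw [abs_mul]
      exact (mul_le_mul_of_nonneg_right habound (abs_nonneg y)).trans (hv y hy))
  have e₁ := (hl₁ μ hμ₂').trans (deriv_normalForm_left (hl μ hμ₂')).symm
  have e₂ := (hl₂ μ hμ₂').trans (deriv_normalForm_right (hl μ hμ₂')).symm
  exact ⟨x₁ μ, x₂ μ, _, _, hT.lt, hT'.lt, hT.setOf_zero, hT'.setOf_zero, hT.deriv_left, e₁,
    hT.deriv_right, e₂,
    hT.conjugate_basinOfRepulsion hk (hslice μ hμ₂') hT' (contDiff_normalForm _ _).contDiffOn e₁,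
    hT.conjugate_basinOfAttraction hk (hslice μ hμ₂') hT' (contDiff_normalForm _ _).contDiffOn e₂⟩

end SaddleNode

theorem theorem6 (k : ℕ∞) (hk : 4 ≤ k) (f : ℝ → ℝ → ℝ) (W : Set (ℝ × ℝ)) (hW : IsOpen W)
    (h0 : ((0 : ℝ), (0 : ℝ)) ∈ W)
    (hf : ContDiffOn ℝ (k : WithTop ℕ∞) (fun p : ℝ × ℝ => f p.1 p.2) W)
    (hgen : SaddleNode.IsGeneric f) (A : ℝ) :
    ∃ u₀ u₁ v₀ v₁ μ₀ : ℝ, u₀ < 0 ∧ 0 < u₁ ∧ v₀ < 0 ∧ 0 < v₁ ∧ 0 < μ₀ ∧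
      Ioo u₀ u₁ ×ˢ Ioo (-μ₀) μ₀ ⊆ W ∧
      -- (i) negative parameter values
      (∀ a : ℝ, ∃ ν : ℝ → ℝ, ContinuousOn ν (Ioo (-μ₀) 0) ∧
        (|a| ≤ A → Tendsto ν (𝓝[<] 0) (𝓝 0)) ∧
        ∀ μ ∈ Ioo (-μ₀) 0,
          SaddleNode.Conjugate k (fun x => f x μ) (Ioo u₀ u₁)
            (SaddleNode.normalForm (ν μ) a) (Ioo v₀ v₁)) ∧
      -- (ii) the bifurcation value
      (ContDiffOn ℝ ∞ (fun p : ℝ × ℝ => f p.1 p.2) W →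
        SaddleNode.Conjugate ∞ (fun x => f x 0) (Ioo u₀ u₁)
          (SaddleNode.normalForm 0 (SaddleNode.a₀ f)) (Ioo v₀ v₁)) ∧
      -- (iii) positive parameter values
      (∃ ν a : ℝ → ℝ, ContinuousOn ν (Ioo 0 μ₀) ∧ ContinuousOn a (Ioo 0 μ₀) ∧
        (fun μ => ν μ - SaddleNode.p₀ f ^ 2 * μ) =O[𝓝[>] 0] (fun μ => √μ ^ 3) ∧
        (fun μ => a μ - SaddleNode.a₀ f) =O[𝓝[>] 0] (fun μ => √μ) ∧
        ∀ μ ∈ Ioo 0 μ₀, ∃ x₁ x₂ y₁ y₂ : ℝ, x₁ < x₂ ∧ y₁ < y₂ ∧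
          {x ∈ Ioo u₀ u₁ | f x μ = 0} = {x₁, x₂} ∧
          {y ∈ Ioo v₀ v₁ | SaddleNode.normalForm (ν μ) (a μ) y = 0} = {y₁, y₂} ∧
          0 < deriv (fun x => f x μ) x₁ ∧
          deriv (fun x => f x μ) x₁ = deriv (SaddleNode.normalForm (ν μ) (a μ)) y₁ ∧
          deriv (fun x => f x μ) x₂ < 0 ∧
          deriv (fun x => f x μ) x₂ = deriv (SaddleNode.normalForm (ν μ) (a μ)) y₂ ∧
          SaddleNode.Conjugate k
            (fun x => f x μ) (SaddleNode.basinOfRepulsion (fun x => f x μ) (Ioo u₀ u₁) x₁)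
            (SaddleNode.normalForm (ν μ) (a μ))
            (SaddleNode.basinOfRepulsion (SaddleNode.normalForm (ν μ) (a μ)) (Ioo v₀ v₁) y₁) ∧
          SaddleNode.Conjugate k
            (fun x => f x μ) (SaddleNode.basinOfAttraction (fun x => f x μ) (Ioo u₀ u₁) x₂)
            (SaddleNode.normalForm (ν μ) (a μ))
            (SaddleNode.basinOfAttraction (SaddleNode.normalForm (ν μ) (a μ)) (Ioo v₀ v₁) y₂)) := by
  have hf4 : ContDiffOn ℝ 4 (fun p : ℝ × ℝ => f p.1 p.2) W := hf.of_le (by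
    have h : ((4 : ℕ∞) : WithTop ℕ∞) ≤ k := WithTop.coe_le_coe.2 hk
    exact h)
  obtain ⟨fx, δ, α, β, γ, b, C, H, hRW, hp, ha₀⟩ :=
    SaddleNode.exists_localExpansion hW h0 hf4 hgen
  have hα := H.α_pos
  have hb := H.b_pos
  have hC := H.C_pos
  have hδ := H.δ_pos
  have hppos : 0 < SaddleNode.p₀ f := by
    refine lt_of_le_of_ne (Real.sqrt_nonneg _) fun h => ?_
    rw [← h] at hp
    exact (mul_pos hb hα).ne' (by rw [← hp]; ring)
  obtain ⟨D, hD⟩ : ∃ D, D = |β| + 2 * C := ⟨_, rfl⟩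
  have hD0 : 0 < D := by rw [hD]; positivity
  obtain ⟨B, hB⟩ : ∃ B, B = |A| + |β / α ^ 2| + 1 := ⟨_, rfl⟩
  have hB0 : 0 < B := by rw [hB]; positivity
  obtain ⟨ε, hε⟩ : ∃ ε, ε = min (δ / 2) (min (α / 2 / D) (1 / 6 / B)) := ⟨_, rfl⟩
  have hε0 : 0 < ε := by rw [hε]; positivity
  have hεδ : ε < δ := by
    have : ε ≤ δ / 2 := by rw [hε]; exact min_le_left _ _
    linarith
  have hεD : D * ε ≤ α / 2 := by
    have : ε ≤ α / 2 / D := by rw [hε]; exact (min_le_right _ _).trans (min_le_left _ _)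
    rwa [le_div_iff₀ hD0, mul_comm] at this
  have hεB : B * ε ≤ 1 / 6 := by
    have : ε ≤ 1 / 6 / B := by rw [hε]; exact (min_le_right _ _).trans (min_le_right _ _)
    rwa [le_div_iff₀ hB0, mul_comm] at this
  -- For smooth `f`, `V` has to be the image of `U` under the conjugacy at `μ = 0`; otherwise any
  -- small `U` and `V` serve.
  obtain ⟨u₀, u₁, v₀, v₁, hu₀ε, hu₀, hu₁, hu₁ε, hv₀ε, hv₀, hv₁, hv₁ε, hii⟩ :
      ∃ u₀ u₁ v₀ v₁ : ℝ, -ε < u₀ ∧ u₀ < 0 ∧ 0 < u₁ ∧ u₁ < ε ∧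
        -ε < v₀ ∧ v₀ < 0 ∧ 0 < v₁ ∧ v₁ < ε ∧
        (ContDiffOn ℝ ∞ (fun p : ℝ × ℝ => f p.1 p.2) W →
          SaddleNode.Conjugate ∞ (fun x => f x 0) (Ioo u₀ u₁)
            (SaddleNode.normalForm 0 (SaddleNode.a₀ f)) (Ioo v₀ v₁)) := by
    by_cases hs : ContDiffOn ℝ ∞ (fun p : ℝ × ℝ => f p.1 p.2) W
    · have hs0 : ContDiffOn ℝ ∞ (fun x => f x 0) (Ioo (-δ) δ) :=
        hs.comp (contDiff_id.prodMk contDiff_const).contDiffOn fun x hx =>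
          hRW ⟨Ioo_subset_Icc_self hx, ⟨by simpa using hδ.le, hδ.le⟩⟩
      obtain ⟨u₀, u₁, v₀, v₁, h1, h2, h3, h4, h5, h6, h7, h8, h9⟩ :=
        SaddleNode.exists_conjugate_takens hδ hε0 hs0 hgen.f_zero hgen.f_x hgen.f_xx
      exact ⟨u₀, u₁, v₀, v₁, h1, h2, h3, h4, h5, h6, h7, h8, fun _ => h9⟩
    · exact ⟨-(ε / 2), ε / 2, -(ε / 2), ε / 2, by linarith, by linarith, by linarith, by linarith,
        by linarith, by linarith, by linarith, by linarith, fun h => absurd h hs⟩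
  have hk1 : (1 : ℕ∞) ≤ k := le_trans (by norm_num) hk
  have hk2 : (2 : ℕ∞) ≤ k := le_trans (by norm_num) hk
  have hfR := hf.mono hRW
  have hAB : A ≤ B := by rw [hB]; linarith [le_abs_self A, abs_nonneg (β / α ^ 2)]
  have hβB : |β / α ^ 2| + 1 ≤ B := by rw [hB]; linarith [abs_nonneg A]
  obtain ⟨μ₁, hμ₁, ν, a, hνc, hac, hν, ha, hiii⟩ := SaddleNode.exists_conjugate_of_pos hk2 H hfR
    hppos hp hεδ (hD ▸ hεD) hu₀ hu₁ hu₀ε hu₁ε hv₀ hv₁ fun y hy => by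
      have hy' : |y| ≤ 2 * ε := abs_le.2 ⟨by linarith [hy.1], by linarith [hy.2]⟩
      calc (|β / α ^ 2| + 1) * |y| ≤ B * (2 * ε) := by gcongr
        _ ≤ 1 / 3 := by linarith
  obtain ⟨μ₀, hμ₀def⟩ : ∃ μ₀, μ₀ = min μ₁ δ := ⟨_, rfl⟩
  have hμ₀ : 0 < μ₀ := hμ₀def ▸ lt_min hμ₁ hδ
  have hμ₀δ : μ₀ ≤ δ := hμ₀def ▸ min_le_right _ _
  have hsub : Ioo 0 μ₀ ⊆ Ioo 0 μ₁ := Ioo_subset_Ioo_right (hμ₀def ▸ min_le_left _ _)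
  refine ⟨u₀, u₁, v₀, v₁, μ₀, hu₀, hu₁, hv₀, hv₁, hμ₀, fun z hz => hRW ⟨⟨?_, ?_⟩, ?_, ?_⟩, ?_,
    hii, ν, a, hνc.mono hsub, hac.mono hsub, hν, ha₀ ▸ ha, fun μ hμ => hiii μ (hsub hμ)⟩
  · linarith [hz.1.1]
  · linarith [hz.1.2]
  · linarith [hz.2.1]
  · linarith [hz.2.2]
  · refine SaddleNode.exists_conjugate_of_neg hk1 H hfR hu₀ hu₁ (by linarith) (by linarith)
      hv₀ hv₁ (fun y hy => ?_) hμ₀ hμ₀δ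
    have hy' : |y| ≤ ε := abs_le.2 ⟨by linarith [hy.1], by linarith [hy.2]⟩
    calc A * |y| ≤ B * ε := by gcongr
      _ ≤ 1 := by linarith
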